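/- Let $k$ be an algebraically closed field of characteristic $0$. Let $X$ be an irreducible projective variety over $k$ (an integral closed subscheme of some $\mathbb{P}^n_k$) of dimension $d\ge 2$ which satisfies Serre's condition $S_2$, i.e. $\operatorname{depth}\mathcal{O}_{X,x}\ge\min(2,\dim\mathcal{O}_{X,x})$ for every $x\in X$. Let $Y\subset X$ be a closed subvariety (a reduced closed subscheme, possibly reducible) with ideal sheaf $\mathcal I$, let $X_{/Y}=(Y,\varprojlim_n\mathcal{O}_X/\mathcal{I}^{n+1})$ be the formal completion of $X$ along $Y$, and let $\hat{i}:X_{/Y}\to X$ be the canonical morphism (the same symbol is used for $X_{/Y}\to U$, when $U$ is an open subset of $X$ containing $Y$). For $\mathcal{Z}=X$ or $\mathcal Z=X_{/Y}$ let $\mathcal{M}_{\mathcal Z}$ be the sheaf associated with the presheaf which sends an affine open set $U$ to the total ring of fractions of $\mathcal{O}_{\mathcal Z}(U)$, and put $K(\mathcal{Z})=H^0(\mathcal{Z},\mathcal{M}_{\mathcal{Z}})$. Since $\hat i$ is flat, it induces a ring homomorphism $\alpha:K(X)\to K(X_{/Y})$. For a line bundle $\mathcal{L}$ on $X$, let $K(X,\mathcal{L})\subset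 K(X)$ be the set of all ratios $s_0/s_1$ with $s_0,s_1\in H^0(X,\mathcal{L}^m)$, $s_1\neq0$, $m\ge0$, computed after choosing an embedding $\mathcal{L}^m\hookrightarrow\mathcal{M}_X$. If $K(X_{/Y})$ is a field, let $K(X_{/Y},\hat{i}^*\mathcal{L})\subset K(X_{/Y})$ be the set of all ratios $s_0/s_1$ with $s_0,s_1\in H^0(X_{/Y},\hat{i}^*\mathcal{L}^m)$, $s_1\neq 0$, $m\ge 0$, computed in the induced embedding $\hat{i}^*\mathcal{L}^m\hookrightarrow\mathcal{M}_{X_{/Y}}$. (Neither set depends on the chosen embeddings.) One says that $Y$ is weakly G3 in $X$ with respect to $\mathcal{L}$ if $K(X_{/Y})$ is a field, $K(X)=K(X,\mathcal{L})$, and $\alpha$ maps $K(X,\mathcal L)$ onto $K(X_{/Y},\hat{i}^*\mathcal{L})$. Assume that $Y$ is weakly G3 in $X$ with respect to some ample line bundle $\mathcal{L}$ on $X$, and that $Y$ meets the support of every nonzero effective (Weil) divisor on $X$. Then the pair $(X,Y)$ satisfies the Grothendieck--Lefschetz condition $\mathrm{Lef}(X,Y)$: for every connected open subset $U\subset X$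 containing $Y$ and every vector bundle $\mathcal{E}$ on $U$, the natural map $$H^0(U,\mathcal{E})\longrightarrow H^0(X_{/Y},\hat{i}^*\mathcal{E})$$ is an isomorphism. -/

import Mathlib

universe u
open CategoryTheory TopologicalSpace Opposite AlgebraicGeometry

noncomputable section

namespace FormalGeometry

/-! ### The formal completion -/

section Completion

variable {X : Scheme.{u}} (Y : Closeds X)

/-- The `n`-th infinitesimal neighbourhood of `Y` in `X`: the closed subscheme `V(I ^ (n + 1))`,
where `I` is the ideal sheaf of the reduced closed subscheme `Y`. -/
abbrev thickening (n : ℕ) : Scheme.{u} :=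
  (Scheme.IdealSheafData.vanishingIdeal Y ^ (n + 1)).subscheme

/-- The closed immersion of the `n`-th infinitesimal neighbourhood. -/
abbrev thickeningι (n : ℕ) : thickening Y n ⟶ X :=
  (Scheme.IdealSheafData.vanishingIdeal Y ^ (n + 1)).subschemeι

/-- The transition maps between infinitesimal neighbourhoods. -/
def thickeningSucc (n : ℕ) : thickening Y n ⟶ thickening Y (n + 1) :=
  Scheme.IdealSheafData.inclusion
    (Scheme.IdealSheafData.le_def.2 fun _ => Ideal.pow_le_pow_right (Nat.le_succ _))

lemma thickeningSucc_ι (n : ℕ) :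
    thickeningSucc Y n ≫ thickeningι Y (n + 1) = thickeningι Y n :=
  Scheme.IdealSheafData.inclusion_subschemeι _

lemma range_thickeningι (n : ℕ) : Set.range (thickeningι Y n) = (Y : Set X) := by
  rw [thickeningι, Scheme.IdealSheafData.range_subschemeι,
    Scheme.IdealSheafData.support_pow_succ, Scheme.IdealSheafData.coe_support_vanishingIdeal]

lemma thickeningι_mem (n : ℕ) (x : thickening Y n) : thickeningι Y n x ∈ Y := by
  have h : thickeningι Y n x ∈ Set.range (thickeningι Y n) := Set.mem_range_self x
  rw [range_thickeningι] at h
  exact h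

/-- The `n`-th infinitesimal neighbourhood has underlying space `Y`. -/
def thickeningProj (n : ℕ) : (thickening Y n).carrier ⟶ TopCat.of Y :=
  TopCat.ofHom ⟨fun x => ⟨thickeningι Y n x, thickeningι_mem Y n x⟩,
    (thickeningι Y n).continuous.subtype_mk _⟩

lemma thickeningProj_coe (n : ℕ) (x : thickening Y n) :
    ((thickeningProj Y n x : Y) : X) = thickeningι Y n x := rfl

lemma thickeningProj_succ (n : ℕ) (x : thickening Y n) :
    thickeningProj Y (n + 1) (thickeningSucc Y n x) = thickeningProj Y n x := by
  apply Subtype.ext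
  rw [thickeningProj_coe, thickeningProj_coe, ← thickeningSucc_ι Y n]
  rfl

/-- An open subset of `Y`, regarded as an open subset of the `n`-th neighbourhood. -/
abbrev thickeningOpen (n : ℕ) (W : Opens (TopCat.of Y)) : (thickening Y n).Opens :=
  (Opens.map (thickeningProj Y n)).obj W

lemma thickeningOpen_le (n : ℕ) (W : Opens (TopCat.of Y)) :
    thickeningOpen Y n W ≤ thickeningSucc Y n ⁻¹ᵁ thickeningOpen Y (n + 1) W := by
  intro x hx
  change thickeningProj Y (n + 1) (thickeningSucc Y n x) ∈ W
  rw [thickeningProj_succ]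
  exact hx

/-- The restriction `Γ(W, 𝒪_X / I ^ (n + 2)) → Γ(W, 𝒪_X / I ^ (n + 1))`. -/
def transition (n : ℕ) (W : Opens (TopCat.of Y)) :
    Γ(thickening Y (n + 1), thickeningOpen Y (n + 1) W) ⟶
      Γ(thickening Y n, thickeningOpen Y n W) :=
  (thickeningSucc Y n).appLE _ _ (thickeningOpen_le Y n W)

/-- `lim_n Γ(W, 𝒪_X / I ^ (n + 1))`, as the ring of compatible families. -/
def completionSections (W : Opens (TopCat.of Y)) :
    Subring (∀ n, Γ(thickening Y n, thickeningOpen Y n W)) where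
  carrier := {s | ∀ n, transition Y n W (s (n + 1)) = s n}
  mul_mem' ha hb n := by simp [map_mul, ha n, hb n]
  one_mem' n := by simp
  add_mem' ha hb n := by simp [map_add, ha n, hb n]
  zero_mem' n := by simp
  neg_mem' ha n := by simp [map_neg, ha n]

/-- The restriction maps of the `n`-th neighbourhood. -/
abbrev thickeningRes (n : ℕ) {W W' : Opens (TopCat.of Y)} (h : W' ⟶ W) :
    Γ(thickening Y n, thickeningOpen Y n W) ⟶ Γ(thickening Y n, thickeningOpen Y n W') :=
  (thickening Y n).presheaf.map ((Opens.map (thickeningProj Y n)).map h).op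

lemma transition_res (n : ℕ) {W W' : Opens (TopCat.of Y)} (h : W' ⟶ W) :
    thickeningRes Y (n + 1) h ≫ transition Y n W' = transition Y n W ≫ thickeningRes Y n h := by
  simp [transition, thickeningRes]

lemma thickeningRes_id (n : ℕ) (W : Opens (TopCat.of Y)) : thickeningRes Y n (𝟙 W) = 𝟙 _ :=
  (thickening Y n).presheaf.map_id _

lemma thickeningRes_comp (n : ℕ) {W W' W'' : Opens (TopCat.of Y)} (f : W' ⟶ W) (g : W'' ⟶ W') :
    thickeningRes Y n (g ≫ f) = thickeningRes Y n f ≫ thickeningRes Y n g :=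
  (thickening Y n).presheaf.map_comp _ _

/-- The presheaf of rings `W ↦ lim_n Γ(W, 𝒪_X / I ^ (n + 1))` on `Y`. -/
def completionPresheaf : TopCat.Presheaf CommRingCat.{u} (TopCat.of Y) where
  obj W := CommRingCat.of (completionSections Y W.unop)
  map {W W'} h := CommRingCat.ofHom
    { toFun s := ⟨fun n => thickeningRes Y n h.unop (s.1 n), fun n => by
        have := congr($(transition_res Y n h.unop) (s.1 (n + 1)))
        simp only [ConcreteCategory.comp_apply] at this
        rw [this, s.2 n]⟩
      map_one' := Subtype.ext (funext fun n => map_one _)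
      map_zero' := Subtype.ext (funext fun n => map_zero _)
      map_mul' _ _ := Subtype.ext (funext fun n => map_mul _ _ _)
      map_add' _ _ := Subtype.ext (funext fun n => map_add _ _ _) }
  map_id W := CommRingCat.hom_ext (RingHom.ext fun s => Subtype.ext (funext fun n =>
    congr($(thickeningRes_id Y n W.unop) (s.1 n))))
  map_comp f g := CommRingCat.hom_ext (RingHom.ext fun s => Subtype.ext (funext fun n =>
    congr($(thickeningRes_comp Y n f.unop g.unop) (s.1 n))))

lemma completionPresheaf_map_coe {W W' : Opens (TopCat.of Y)} (h : W' ⟶ W)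
    (s : completionSections Y W) (n : ℕ) :
    ((completionPresheaf Y).map h.op s : completionSections Y W').1 n =
      thickeningRes Y n h (s.1 n) := rfl

lemma completionPresheaf_isSheaf : (completionPresheaf Y).IsSheaf := by
  rw [TopCat.Presheaf.isSheaf_iff_isSheafUniqueGluing]
  intro ι U sf hsf
  have key : ∀ n, ∃! t : Γ(thickening Y n, thickeningOpen Y n (iSup U)),
      ∀ i, thickeningRes Y n (Opens.leSupr U i) t = (sf i).1 n := by
    intro n
    refine (thickening Y n).sheaf.existsUnique_gluing' (fun i => thickeningOpen Y n (U i))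
      (thickeningOpen Y n (iSup U)) (fun i => (Opens.map (thickeningProj Y n)).map
        (Opens.leSupr U i)) ?_ (fun i => (sf i).1 n) ?_
    · intro x hx
      obtain ⟨i, hi⟩ := Opens.mem_iSup.1 (show thickeningProj Y n x ∈ iSup U from hx)
      exact Opens.mem_iSup.2 ⟨i, hi⟩
    · intro i j
      exact congr($(hsf i j).1 n)
  choose t ht htu using key
  have htr : ∀ n, transition Y n (iSup U) (t (n + 1)) = t n := by
    intro n
    refine htu n _ fun i => ?_
    have := congr($(transition_res Y n (Opens.leSupr U i)) (t (n + 1)))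
    simp only [ConcreteCategory.comp_apply] at this
    rw [← this, ht (n + 1) i, (sf i).2 n]
  refine ⟨⟨t, htr⟩, fun i => Subtype.ext (funext fun n => ht n i), ?_⟩
  rintro ⟨t', ht'⟩ h
  exact Subtype.ext (funext fun n => htu n _ fun i => congr($(h i).1 n))

/-- The formal completion `X_{/Y}` of `X` along `Y`, as a ringed space. -/
def completion : RingedSpace.{u, u} where
  carrier := TopCat.of Y
  presheaf := completionPresheaf Y
  IsSheaf := completionPresheaf_isSheaf Y

/-- The morphism `X_{/Y} ⟶ Z` given by a compatible family of morphisms from the infinitesimal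
neighbourhoods of `Y` to a scheme `Z` which all have the underlying continuous map `b`. -/
def completionDesc {Z : Scheme.{u}} (b : TopCat.of Y ⟶ Z.carrier)
    (g : ∀ n, thickening Y n ⟶ Z) (hb : ∀ n x, g n x = b (thickeningProj Y n x))
    (hg : ∀ n, thickeningSucc Y n ≫ g (n + 1) = g n) :
    completion Y ⟶ Z.toSheafedSpace :=
  have le (n : ℕ) (V : Z.Opens) : thickeningOpen Y n ((Opens.map b).obj V) ≤ g n ⁻¹ᵁ V :=
    fun x hx => by
      change g n x ∈ V
      rw [hb]
      exact hx
  InducedCategory.homMk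
    { base := b
      c :=
        { app := fun V => CommRingCat.ofHom
            { toFun s := ⟨fun n => (g n).appLE V.unop _ (le n V.unop) s, fun n => by
                change ((g (n + 1)).appLE V.unop _ (le (n + 1) V.unop) ≫
                  transition Y n ((Opens.map b).obj V.unop)) s = _
                rw [transition, Scheme.Hom.appLE_comp_appLE]
                simp only [hg]⟩
              map_one' := Subtype.ext (funext fun n => map_one _)
              map_zero' := Subtype.ext (funext fun n => map_zero _)
              map_mul' _ _ := Subtype.ext (funext fun n => map_mul _ _ _)
              map_add' _ _ := Subtype.ext (funext fun n => map_add _ _ _) }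
          naturality V V' h := by
            refine CommRingCat.hom_ext (RingHom.ext fun s => Subtype.ext (funext fun n => ?_))
            change (Z.presheaf.map h ≫ (g n).appLE V'.unop _ (le n V'.unop)) s =
              ((g n).appLE V.unop _ (le n V.unop) ≫
                thickeningRes Y n ((Opens.map b).map h.unop)) s
            rw [Scheme.Hom.appLE_map, ← h.op_unop, Scheme.Hom.map_appLE] } }

/-- The canonical morphism `î : X_{/Y} ⟶ X`. -/
def completionι : completion Y ⟶ X.toSheafedSpace :=
  completionDesc Y (TopCat.ofHom ⟨Subtype.val, continuous_subtype_val⟩) (thickeningι Y)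
    (fun _ _ => rfl) (thickeningSucc_ι Y)

/-- The canonical morphism `î : X_{/Y} ⟶ U`, for an open neighbourhood `U` of `Y`. -/
def completionToOpen (U : X.Opens) (hU : (Y : Set X) ⊆ U) :
    completion Y ⟶ (U : Scheme.{u}).toSheafedSpace :=
  have hr (n : ℕ) : Set.range (thickeningι Y n) ⊆ Set.range U.ι := by
    rw [range_thickeningι, Scheme.Opens.range_ι]
    exact hU
  completionDesc Y
    (TopCat.ofHom ⟨fun y => ⟨y.1, hU y.2⟩, continuous_subtype_val.subtype_mk _⟩)
    (fun n => IsOpenImmersion.lift U.ι (thickeningι Y n) (hr n))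
    (fun n x => Subtype.ext <| by
      change U.ι _ = thickeningι Y n x
      rw [← Scheme.Hom.comp_apply, IsOpenImmersion.lift_fac])
    (fun n => by
      rw [← cancel_mono U.ι, Category.assoc, IsOpenImmersion.lift_fac,
        IsOpenImmersion.lift_fac, thickeningSucc_ι])

end Completion

/-! ### Modules on ringed spaces -/

section Modules

/-- The structure sheaf of a ringed space, as a sheaf of (not necessarily commutative) rings. -/
abbrev ringSheaf (Z : RingedSpace.{u, u}) : TopCat.Sheaf RingCat.{u} Z.carrier :=
  (sheafCompose _ (forget₂ CommRingCat RingCat.{u})).obj Z.sheaf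

/-- The category of sheaves of modules on a ringed space. -/
abbrev Mod (Z : RingedSpace.{u, u}) := SheafOfModules.{u} (ringSheaf Z)

/-- A morphism of ringed spaces, as a morphism of sheaves of rings. -/
def ringSheafHom {Z W : RingedSpace.{u, u}} (f : Z ⟶ W) :
    ringSheaf W ⟶ ((Opens.map f.hom.base).sheafPushforwardContinuous _ _ _).obj (ringSheaf Z) where
  hom := Functor.whiskerRight f.hom.c _

/-- Sections of a module over an open subset. -/
abbrev sections {Z : RingedSpace.{u, u}} (M : Mod Z) (U : Opens Z) := M.val.obj (op U)


instance presheafPushforward_isRightAdjoint {Z W : RingedSpace.{u, u}} (f : Z ⟶ W) :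
    (PresheafOfModules.pushforward.{u} (ringSheafHom f).hom).IsRightAdjoint :=
  Functor.isRightAdjoint_of_leftAdjointObjIsDefined_eq_top
    (PresheafOfModules.pullbackObjIsDefined_eq_top (F := Opens.map f.hom.base) (ringSheafHom f).hom)

instance pushforward_isRightAdjoint {Z W : RingedSpace.{u, u}} (f : Z ⟶ W) :
    (SheafOfModules.pushforward.{u} (ringSheafHom f)).IsRightAdjoint :=
  (SheafOfModules.PullbackConstruction.adjunction.{u} (ringSheafHom f)).isRightAdjoint

/-- The pullback `f ^* M`. -/
def pullback {Z W : RingedSpace.{u, u}} (f : Z ⟶ W) : Mod W ⥤ Mod Z :=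
  SheafOfModules.pullback.{u} (ringSheafHom f)

/-- The pushforward `f_* M`. -/
def pushforward {Z W : RingedSpace.{u, u}} (f : Z ⟶ W) : Mod Z ⥤ Mod W :=
  SheafOfModules.pushforward.{u} (ringSheafHom f)

/-- The adjunction between pullback and pushforward. -/
def pullbackAdj {Z W : RingedSpace.{u, u}} (f : Z ⟶ W) : pullback f ⊣ pushforward f :=
  SheafOfModules.pullbackPushforwardAdjunction.{u} (ringSheafHom f)

/-- The natural map `H⁰(W, M) → H⁰(Z, f ^* M)`. -/
def pullbackSections {Z W : RingedSpace.{u, u}} (f : Z ⟶ W) (M : Mod W) :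
    sections M ⊤ → sections ((pullback f).obj M) ⊤ :=
  ((pullbackAdj f).unit.app M).val.app (op ⊤)

/-- The tensor product of sheaves of modules: the sheafification of
`U ↦ Γ(U, M) ⊗ Γ(U, N)`. -/
def tensor {Z : RingedSpace.{u, u}} (M N : Mod Z) : Mod Z :=
  (PresheafOfModules.sheafification (R := ringSheaf Z) (𝟙 (ringSheaf Z).obj)).obj
    (MonoidalCategory.tensorObj
      (C := PresheafOfModules.{u} (Z.presheaf ⋙ forget₂ CommRingCat RingCat)) M.val N.val)

/-- The tensor powers of a sheaf of modules. -/
def tensorPow {Z : RingedSpace.{u, u}} (M : Mod Z) : ℕ → Mod Z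
  | 0 => SheafOfModules.unit _
  | n + 1 => tensor (tensorPow M n) M

/-- `b` is a basis of `M` over the open set `V`, i.e. the sections `b` of `M` over `V` define an
isomorphism `𝒪_V ^ n ≅ M|_V`. -/
def IsFrame {Z : RingedSpace.{u, u}} (M : Mod Z) (V : Opens Z) {n : ℕ}
    (b : Fin n → sections M V) : Prop :=
  ∀ (W : Opens Z) (h : W ⟶ V), Function.Bijective
    fun c : Fin n → (ringSheaf Z).obj.obj (op W) =>
      (∑ i, c i • (show sections M W from M.val.map h.op (b i)) : sections M W)

/-- Vector bundles: locally free sheaves of modules of finite rank. -/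
def IsVectorBundle {Z : RingedSpace.{u, u}} (M : Mod Z) : Prop :=
  ∀ z : Z, ∃ V : Opens Z, z ∈ V ∧ ∃ (n : ℕ) (b : Fin n → sections M V), IsFrame M V b

/-- Line bundles: locally free sheaves of modules of rank one. -/
def IsLineBundle {Z : RingedSpace.{u, u}} (M : Mod Z) : Prop :=
  ∀ z : Z, ∃ V : Opens Z, z ∈ V ∧ ∃ b : Fin 1 → sections M V, IsFrame M V b

/-- The open set `Z_s` of points where the section `s` generates the line bundle `M`. -/
def generatingLocus {Z : RingedSpace.{u, u}} (M : Mod Z) (s : sections M ⊤) : Opens Z :=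
  sSup {V | IsFrame M V fun _ : Fin 1 => (show sections M V from M.val.map (homOfLE le_top).op s)}

/-- A line bundle `L` on a scheme is ample if the open sets `X_s` which are affine, for sections
`s` of positive powers of `L`, cover `X`. (On a quasi-compact scheme.) -/
def IsAmple {X : Scheme.{u}} (L : Mod X.toSheafedSpace) : Prop :=
  IsLineBundle L ∧ ∀ x : X, ∃ (m : ℕ) (s : sections (tensorPow L m) ⊤), 0 < m ∧
    x ∈ generatingLocus (tensorPow L m) s ∧
      IsAffineOpen (X := X) (generatingLocus (tensorPow L m) s)

end Modules

/-! ### Rational functions -/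

section Rational

variable (Z : RingedSpace.{u, u})

/-- The sections over `U` which are nonzerodivisors on every open subset of `U`. -/
def regularSections (U : Opens Z) : Submonoid (Z.presheaf.obj (op U)) where
  carrier := {s | ∀ (V : Opens Z) (h : V ⟶ U),
    Z.presheaf.map h.op s ∈ nonZeroDivisors (Z.presheaf.obj (op V))}
  mul_mem' ha hb V h := by
    rw [map_mul]
    exact mul_mem (ha V h) (hb V h)
  one_mem' V h := by
    rw [map_one]
    exact one_mem _

lemma regularSections_map {U V : Opens Z} (h : V ⟶ U) {s : Z.presheaf.obj (op U)}
    (hs : s ∈ regularSections Z U) : Z.presheaf.map h.op s ∈ regularSections Z V := by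
  intro W g
  rw [← ConcreteCategory.comp_apply, ← Functor.map_comp, ← op_comp]
  exact hs W _

/-- The canonical map to a localization. -/
abbrev fracOf {R : CommRingCat.{u}} (S : Submonoid R) : R ⟶ CommRingCat.of (Localization S) :=
  CommRingCat.ofHom (algebraMap R (Localization S))

/-- The map between localizations induced by a ring homomorphism. -/
def fracMap {R R' : CommRingCat.{u}} (S : Submonoid R) (T : Submonoid R') (φ : R ⟶ R')
    (h : ∀ s ∈ S, φ s ∈ T) : CommRingCat.of (Localization S) ⟶ CommRingCat.of (Localization T) :=
  CommRingCat.ofHom (IsLocalization.map (Localization T) φ.hom (M := S) (T := T) h)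

lemma fracOf_fracMap {R R' : CommRingCat.{u}} (S : Submonoid R) (T : Submonoid R') (φ : R ⟶ R')
    (h : ∀ s ∈ S, φ s ∈ T) : fracOf S ≫ fracMap S T φ h = φ ≫ fracOf T :=
  CommRingCat.hom_ext (IsLocalization.map_comp (M := S) (T := T) h)

lemma frac_hom_ext {R R' : CommRingCat.{u}} (S : Submonoid R)
    {a b : CommRingCat.of (Localization S) ⟶ R'} (h : fracOf S ≫ a = fracOf S ≫ b) : a = b :=
  CommRingCat.hom_ext (IsLocalization.ringHom_ext S (congrArg CommRingCat.Hom.hom h))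

/-- The presheaf `U ↦ S(U)⁻¹ 𝒪(U)`, where `S(U)` is the set of regular sections. -/
def rationalPresheaf : TopCat.Presheaf CommRingCat.{u} Z.carrier where
  obj U := CommRingCat.of (Localization (regularSections Z U.unop))
  map {U V} h := fracMap (regularSections Z U.unop) (regularSections Z V.unop) (Z.presheaf.map h)
    (fun _ hs => regularSections_map Z h.unop hs)
  map_id U := frac_hom_ext _ <| by
    rw [fracOf_fracMap, Z.presheaf.map_id, Category.id_comp, Category.comp_id]
  map_comp {U V W} f g := frac_hom_ext _ <| by
    rw [fracOf_fracMap, ← Category.assoc, fracOf_fracMap, Category.assoc, fracOf_fracMap,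
      Functor.map_comp, Category.assoc]

/-- The structure sheaf maps to the presheaf of fractions. -/
def toRationalPresheaf : Z.presheaf ⟶ rationalPresheaf Z where
  app U := fracOf (regularSections Z U.unop)
  naturality _ _ _ := (fracOf_fracMap _ _ _ _).symm

/-- The sheaf `ℳ_Z` of rational functions. -/
def rationalSheaf : TopCat.Sheaf CommRingCat.{u} Z.carrier :=
  (presheafToSheaf (Opens.grothendieckTopology Z.carrier) CommRingCat.{u}).obj (rationalPresheaf Z)

/-- The canonical map from the presheaf of fractions to its sheafification. -/
def toRationalSheaf : rationalPresheaf Z ⟶ (rationalSheaf Z).obj :=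
  toSheafify (Opens.grothendieckTopology Z.carrier) (rationalPresheaf Z)

/-- The ringed space `(|Z|, ℳ_Z)`. -/
def rationalSpace : RingedSpace.{u, u} where
  carrier := Z.carrier
  presheaf := (rationalSheaf Z).obj
  IsSheaf := (rationalSheaf Z).property

/-- The morphism of ringed spaces `(|Z|, ℳ_Z) ⟶ (|Z|, 𝒪_Z)` given by `𝒪_Z ⟶ ℳ_Z`. -/
def rationalSpaceMap : rationalSpace Z ⟶ Z :=
  InducedCategory.homMk
    { base := 𝟙 _
      c := toRationalPresheaf Z ≫ toRationalSheaf Z }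

/-- `ℳ_Z` as a sheaf of `𝒪_Z`-modules. -/
def rationalModule : Mod Z :=
  (pushforward (rationalSpaceMap Z)).obj (SheafOfModules.unit _)

/-- The ring of rational functions. -/
abbrev RationalFunctions : CommRingCat.{u} := (rationalSheaf Z).obj.obj (op ⊤)

variable {Z}
variable {W : RingedSpace.{u, u}} (f : Z ⟶ W)

/-- The ring homomorphism `𝒪_W(U) → 𝒪_Z(f⁻¹ U)`. -/
def pullRing {Z W : RingedSpace.{u, u}} (f : Z ⟶ W) (U : Opens W) :
    W.presheaf.obj (op U) →+* Z.presheaf.obj (op ((Opens.map f.hom.base).obj U)) :=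
  (f.hom.c.app (op U)).hom

/-- `f` pulls back regular sections to regular sections. -/
def PreservesRegular : Prop :=
  ∀ (U : Opens W) (s : W.presheaf.obj (op U)), s ∈ regularSections W U →
    pullRing f U s ∈ regularSections Z ((Opens.map f.hom.base).obj U)

variable {f} (hf : PreservesRegular f)

/-- The map of presheaves of fractions induced by a morphism that preserves regular sections. -/
def rationalPresheafMap : rationalPresheaf W ⟶
    (TopCat.Presheaf.pushforward _ f.hom.base).obj (rationalPresheaf Z) where
  app U := fracMap (regularSections W U.unop)
    (regularSections Z ((Opens.map f.hom.base).obj U.unop)) (f.hom.c.app U) (hf U.unop)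
  naturality U V h := frac_hom_ext _ <| by
    have h₁ : fracOf (regularSections W U.unop) ≫ (rationalPresheaf W).map h =
      W.presheaf.map h ≫ fracOf (regularSections W V.unop) := fracOf_fracMap _ _ _ _
    have h₂ : fracOf (regularSections Z ((Opens.map f.hom.base).obj U.unop)) ≫
        (rationalPresheaf Z).map ((Opens.map f.hom.base).map h.unop).op =
      Z.presheaf.map ((Opens.map f.hom.base).map h.unop).op ≫
        fracOf (regularSections Z ((Opens.map f.hom.base).obj V.unop)) := fracOf_fracMap _ _ _ _
    have h₃ : W.presheaf.map h ≫ f.hom.c.app V =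
      f.hom.c.app U ≫ Z.presheaf.map ((Opens.map f.hom.base).map h.unop).op :=
        f.hom.c.naturality h
    have h₄ := fracOf_fracMap (regularSections W U.unop)
      (regularSections Z ((Opens.map f.hom.base).obj U.unop)) (f.hom.c.app U) (hf U.unop)
    have h₅ := fracOf_fracMap (regularSections W V.unop)
      (regularSections Z ((Opens.map f.hom.base).obj V.unop)) (f.hom.c.app V) (hf V.unop)
    refine (Category.assoc _ _ _).symm.trans ((congr($h₁ ≫ fracMap _ _ _ (hf V.unop))).trans ?_)
    refine (Category.assoc _ _ _).trans (congr(W.presheaf.map h ≫ $h₅).trans ?_)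
    refine (Category.assoc _ _ _).symm.trans
      (congr($h₃ ≫ fracOf (regularSections Z ((Opens.map f.hom.base).obj V.unop))).trans ?_)
    refine (Category.assoc _ _ _).trans (congr(f.hom.c.app U ≫ $h₂.symm).trans ?_)
    refine (Category.assoc _ _ _).symm.trans
      (congr($h₄.symm ≫ (rationalPresheaf Z).map ((Opens.map f.hom.base).map h.unop).op).trans ?_)
    exact Category.assoc _ _ _

/-- The induced map `ℳ_W ⟶ f_* ℳ_Z`. -/
def rationalSheafMap : (rationalSheaf W).obj ⟶
    (TopCat.Presheaf.pushforward _ f.hom.base).obj (rationalSheaf Z).obj :=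
  sheafifyLift (Opens.grothendieckTopology W.carrier) (rationalPresheafMap hf ≫
    (TopCat.Presheaf.pushforward _ f.hom.base).map (toRationalSheaf Z))
    ((TopCat.Sheaf.pushforward _ f.hom.base).obj (rationalSheaf Z)).property

lemma toRationalSheaf_rationalSheafMap : toRationalSheaf W ≫ rationalSheafMap hf =
    rationalPresheafMap hf ≫ (TopCat.Presheaf.pushforward _ f.hom.base).map (toRationalSheaf Z) :=
  toSheafify_sheafifyLift _ _ _

lemma structure_rationalSheafMap :
    (toRationalPresheaf W ≫ toRationalSheaf W) ≫ rationalSheafMap hf =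
      f.hom.c ≫ (TopCat.Presheaf.pushforward _ f.hom.base).map
        (toRationalPresheaf Z ≫ toRationalSheaf Z) := by
  rw [Category.assoc, toRationalSheaf_rationalSheafMap, Functor.map_comp, ← Category.assoc,
    ← Category.assoc]
  congr 1
  refine NatTrans.ext (funext fun U => ?_)
  exact fracOf_fracMap _ _ _ _

/-- The induced homomorphism `K(W) → K(Z)`. -/
def rationalMap : RationalFunctions W ⟶ RationalFunctions Z :=
  (rationalSheafMap hf).app (op ⊤)

/-- The induced `𝒪_W`-linear map `ℳ_W ⟶ f_* ℳ_Z`. -/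
def rationalModuleMap : rationalModule W ⟶ (pushforward f).obj (rationalModule Z) where
  val.app U := ModuleCat.homMk
    ((forget₂ RingCat AddCommGrpCat).map ((forget₂ CommRingCat RingCat).map
      ((rationalSheafMap hf).app U)))
    (fun r => by
      ext m
      have h : (rationalSheafMap hf).app U ((toRationalPresheaf W ≫ toRationalSheaf W).app U r) =
          (toRationalPresheaf Z ≫ toRationalSheaf Z).app _ (f.hom.c.app U r) :=
        ConcreteCategory.congr_hom (congr($(structure_rationalSheafMap hf).app U)) r
      have h' := ((rationalSheafMap hf).app U).hom.map_mul
        ((toRationalPresheaf W ≫ toRationalSheaf W).app U r) m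
      refine Eq.symm (h'.trans ?_)
      exact congrArg (fun z : (rationalSheaf Z).obj.obj ((Opens.map f.hom.base).op.obj U) =>
        z * (show (rationalSheaf Z).obj.obj ((Opens.map f.hom.base).op.obj U) from
          (rationalSheafMap hf).app U m)) h)
  val.naturality h := by
    ext m
    exact ConcreteCategory.congr_hom ((rationalSheafMap hf).naturality h) m


end Rational

section Comp

variable {X : Scheme.{u}} (Y : Closeds X)

/-- A consequence of the Artin--Rees lemma. -/
lemma exists_pow_of_mul_mem {A : Type*} [CommRing A] [IsDomain A] [IsNoetherianRing A]
    (I : Ideal A) (a : A) (ha : a ≠ 0) (n : ℕ) :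
    ∃ m, ∀ b : A, a * b ∈ I ^ m → b ∈ I ^ n := by
  obtain ⟨k, hk⟩ := I.exists_pow_inf_eq_pow_smul (Ideal.span {a} : Submodule A A)
  refine ⟨k + n, fun b hb => ?_⟩
  have h := hk (k + n) (Nat.le_add_right _ _)
  have h1 : a * b ∈ (I ^ (k+n) • (⊤ : Submodule A A) ⊓ (Ideal.span {a} : Submodule A A)) :=
    ⟨by simpa using hb, Ideal.mem_span_singleton.2 ⟨b, rfl⟩⟩
  rw [h, Nat.add_sub_cancel_left] at h1
  have h2 : a * b ∈ I ^ n * Ideal.span {a} := Submodule.smul_mono le_rfl inf_le_right h1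
  obtain ⟨c, hc, hcb⟩ := Ideal.mem_mul_span_singleton.1 h2
  rw [mul_comm c a] at hcb
  rwa [← mul_left_cancel₀ ha hcb]

/-- The inclusion `Y ⟶ X`. -/
abbrev incl : TopCat.of Y ⟶ X.carrier := TopCat.ofHom ⟨Subtype.val, continuous_subtype_val⟩

lemma family_eq_of_le {W : Opens (TopCat.of Y)} {s t : completionSections Y W} {n m : ℕ}
    (hnm : n ≤ m) (h : s.1 m = t.1 m) : s.1 n = t.1 n := by
  induction hnm with
  | refl => exact h
  | step _ ih =>
    refine ih ?_
    rw [← s.2, ← t.2, h]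

/-- The ring homomorphism `Γ(V, 𝒪_X) → Γ(V, 𝒪_X / I ^ (n + 1))`. -/
def toThickening (n : ℕ) (V : X.Opens) :
    Γ(X, V) →+* Γ(thickening Y n, thickeningOpen Y n ((Opens.map (incl Y)).obj V)) :=
  ((thickeningι Y n).app V).hom

lemma toThickening_surjective (n : ℕ) (A : X.affineOpens) :
    Function.Surjective (toThickening Y n A.1) :=
  Scheme.IdealSheafData.subschemeι_app_surjective _ A

lemma toThickening_eq_zero (n : ℕ) (A : X.affineOpens) (c : Γ(X, A)) :
    toThickening Y n A.1 c = 0 ↔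
      c ∈ (Scheme.IdealSheafData.vanishingIdeal Y).ideal A ^ (n + 1) := by
  rw [← RingHom.mem_ker]
  exact iff_of_eq (congrArg (c ∈ ·) (Scheme.IdealSheafData.ker_subschemeι_app
    (Scheme.IdealSheafData.vanishingIdeal Y ^ (n + 1)) A))

/-- The ring homomorphism `Γ(V, 𝒪_X) → lim_n Γ(V, 𝒪_X / I ^ (n + 1))`. -/
def toCompletion (V : X.Opens) : Γ(X, V) →+* completionSections Y ((Opens.map (incl Y)).obj V) :=
  pullRing (completionι Y) V

lemma toCompletion_coe (V : X.Opens) (s : Γ(X, V)) (n : ℕ) :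
    (toCompletion Y V s).1 n = toThickening Y n V s := by
  change (thickeningι Y n).appLE V _ _ s = (thickeningι Y n).app V s
  rw [Scheme.Hom.app_eq_appLE]

lemma eq_zero_of_toCompletion_mul [IsIntegral X] [IsLocallyNoetherian X] (A : X.affineOpens)
    (hA : Nonempty A.1) (a : Γ(X, A)) (ha : a ≠ 0)
    (t : completionSections Y ((Opens.map (incl Y)).obj A.1))
    (h : toCompletion Y A.1 a * t = 0) : t = 0 := by
  have : IsNoetherianRing Γ(X, A) := IsLocallyNoetherian.component_noetherian A
  refine Subtype.ext (funext fun n => ?_)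
  obtain ⟨m, hm⟩ := exists_pow_of_mul_mem ((Scheme.IdealSheafData.vanishingIdeal Y).ideal A) a ha
    (n + 1)
  obtain ⟨b, hb⟩ := toThickening_surjective Y (max n m) A (t.1 (max n m))
  have hb' : (toCompletion Y A.1 b).1 (max n m) = t.1 (max n m) := by
    rw [toCompletion_coe, hb]
  rw [← family_eq_of_le Y (le_max_left n m) hb', toCompletion_coe]
  refine (toThickening_eq_zero Y n A b).2 (hm b ?_)
  refine Ideal.pow_le_pow_right (show m ≤ max n m + 1 by omega) ?_
  rw [← toThickening_eq_zero, map_mul, hb, ← toCompletion_coe]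
  exact congrFun (congrArg Subtype.val h) (max n m)

/-- Flatness of `X_{/Y} ⟶ X`, in the form needed to pull back rational functions. -/
lemma completionι_preservesRegular [IsIntegral X] [IsLocallyNoetherian X] :
    PreservesRegular (completionι Y) := by
  intro V s hs W h
  rw [mem_nonZeroDivisors_iff_right]
  intro t ht
  obtain ⟨O, hO, hOW⟩ := isOpen_induced_iff.1 W.isOpen
  have hWV : ∀ y : TopCat.of Y, y ∈ W → y.1 ∈ V := fun y hy => h.le hy
  have key : ∀ y : W, ∃ A : X.affineOpens, y.1.1 ∈ A.1 ∧ (A.1 : Set X) ⊆ O ∩ V := by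
    intro y
    have hy : y.1.1 ∈ O := by
      have : y.1 ∈ Subtype.val ⁻¹' O := hOW ▸ y.2
      exact this
    obtain ⟨_, ⟨A, hA, rfl⟩, hxA, hAU⟩ := X.isBasis_affineOpens.exists_subset_of_mem_open
      (show y.1.1 ∈ O ∩ V from ⟨hy, hWV _ y.2⟩) (hO.inter V.isOpen)
    exact ⟨⟨A, hA⟩, hxA, hAU⟩
  choose A hyA hA using key
  have hAW (y : W) : (Opens.map (completionι Y).hom.base).obj (A y).1 ≤ W := by
    intro z hz
    have hz' : z ∈ Subtype.val ⁻¹' O := (hA y hz).1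
    exact (Set.ext_iff.1 hOW z).1 hz'
  refine (completion Y).sheaf.eq_of_locally_eq' (fun y : W => _) W (fun y => homOfLE (hAW y))
    (fun y hy => Opens.mem_iSup.2 ⟨⟨y, hy⟩, hyA ⟨y, hy⟩⟩) _ _ fun y => ?_
  have hle : (A y).1 ≤ V := fun x hx => (hA y hx).2
  have hne : Nonempty (A y).1 := ⟨⟨_, hyA y⟩⟩
  refine (eq_zero_of_toCompletion_mul Y (A y) hne (X.presheaf.map (homOfLE hle).op s) ?_ _ ?_).trans
    (map_zero ((completion Y).presheaf.map (homOfLE (hAW y)).op).hom).symm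
  · exact nonZeroDivisors.ne_zero (hs _ (homOfLE hle))
  · have h₁ : pullRing (completionι Y) (A y).1 (X.presheaf.map (homOfLE hle).op s) =
        (completion Y).presheaf.map ((Opens.map (completionι Y).hom.base).map (homOfLE hle)).op
          (pullRing (completionι Y) V s) :=
      ConcreteCategory.congr_hom ((completionι Y).hom.c.naturality (homOfLE hle).op) s
    have h₂ : (completion Y).presheaf.map
        ((Opens.map (completionι Y).hom.base).map (homOfLE hle)).op
          (pullRing (completionι Y) V s) = (completion Y).presheaf.map (homOfLE (hAW y)).op
            ((completion Y).presheaf.map h.op (pullRing (completionι Y) V s)) := by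
      rw [← ConcreteCategory.comp_apply, ← Functor.map_comp]
      rfl
    have h₃ : (completion Y).presheaf.map (homOfLE (hAW y)).op
        (t * (completion Y).presheaf.map h.op (pullRing (completionι Y) V s)) = 0 := by
      rw [ht, map_zero]
    rw [map_mul, mul_comm, ← h₂, ← h₁] at h₃
    exact h₃

end Comp

/-! ### Ratios of sections, the weak G3 property and the condition Lef -/

section Lef

variable {X : Scheme.{u}}

/-- `K(X, L)`: the rational functions which are ratios of global sections of some `L ^ m`,
computed after embedding `L ^ m` into `ℳ_X`. -/
def ratios (L : Mod X.toSheafedSpace) : Set (RationalFunctions X.toSheafedSpace) :=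
  {f | ∃ (m : ℕ) (e : tensorPow L m ⟶ rationalModule X.toSheafedSpace) (_ : Mono e)
    (s₀ s₁ : sections (tensorPow L m) ⊤),
    (show RationalFunctions X.toSheafedSpace from e.val.app (op ⊤) s₁) ≠ 0 ∧
      f * (show RationalFunctions X.toSheafedSpace from e.val.app (op ⊤) s₁) =
        (show RationalFunctions X.toSheafedSpace from e.val.app (op ⊤) s₀)}

variable [IsIntegral X] [IsLocallyNoetherian X] (Y : Closeds X)

/-- The natural homomorphism `α : K(X) → K(X_{/Y})`. -/
def alpha : RationalFunctions X.toSheafedSpace ⟶ RationalFunctions (completion Y) :=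
  rationalMap (completionι_preservesRegular Y)

/-- The map `î ^* M ⟶ ℳ_{X_{/Y}}` induced by a map `M ⟶ ℳ_X`. -/
def inducedEmbedding {M : Mod X.toSheafedSpace} (e : M ⟶ rationalModule X.toSheafedSpace) :
    (pullback (completionι Y)).obj M ⟶ rationalModule (completion Y) :=
  ((pullbackAdj (completionι Y)).homEquiv _ _).symm
    (e ≫ rationalModuleMap (completionι_preservesRegular Y))

/-- `K(X_{/Y}, î ^* L)`: the formal rational functions which are ratios of global sections of some
`î ^* L ^ m`, computed with the embedding of `î ^* L ^ m` into `ℳ_{X_{/Y}}` induced by an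
embedding of `L ^ m` into `ℳ_X`. -/
def formalRatios (L : Mod X.toSheafedSpace) : Set (RationalFunctions (completion Y)) :=
  {f | ∃ (m : ℕ) (e : tensorPow L m ⟶ rationalModule X.toSheafedSpace) (_ : Mono e)
    (s₀ s₁ : sections ((pullback (completionι Y)).obj (tensorPow L m)) ⊤),
    (show RationalFunctions (completion Y) from
        (inducedEmbedding Y e).val.app (op ⊤) s₁) ≠ 0 ∧
      f * (show RationalFunctions (completion Y) from
          (inducedEmbedding Y e).val.app (op ⊤) s₁) =
        (show RationalFunctions (completion Y) from
          (inducedEmbedding Y e).val.app (op ⊤) s₀)}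

/-- `Y` is weakly G3 in `X` with respect to `L`: the ring `K(X_{/Y})` is a field and
`K(X) = K(X, L) = K(X_{/Y}, î ^* L)` via `α`. -/
def WeaklyG3 (L : Mod X.toSheafedSpace) : Prop :=
  IsField (RationalFunctions (completion Y)) ∧ ratios L = Set.univ ∧
    alpha Y '' ratios L = formalRatios Y L

/-- The Grothendieck--Lefschetz condition `Lef(X, Y)`. -/
def Lef {X : Scheme.{u}} (Y : Closeds X) : Prop :=
  ∀ (U : X.Opens) (hU : (Y : Set X) ⊆ U), _root_.IsConnected (U : Set X) →
    ∀ E : Mod (U : Scheme.{u}).toSheafedSpace, IsVectorBundle E →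
      Function.Bijective (pullbackSections (completionToOpen Y U hU) E)

end Lef

/-! ### Projective varieties, the condition `S_n` and divisors -/

section Varieties

/-- The depth of a local ring: the supremum of the lengths of the regular sequences in the maximal
ideal. -/
def depth (R : Type*) [CommRing R] [IsLocalRing R] : ℕ∞ :=
  ⨆ (rs : List R) (_ : RingTheory.Sequence.IsRegular R rs ∧
    ∀ r ∈ rs, r ∈ IsLocalRing.maximalIdeal R), (rs.length : ℕ∞)

/-- Serre's condition `S_n`: `depth 𝒪_{X, x} ≥ min (n, dim 𝒪_{X, x})` for all `x`. -/
def SatisfiesSerre (n : ℕ) (X : Scheme.{u}) : Prop :=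
  ∀ x : X, min (n : WithBot ℕ∞) (ringKrullDim (X.presheaf.stalk x)) ≤
    (depth (X.presheaf.stalk x) : WithBot ℕ∞)

/-- Effective Weil divisors: cycles with nonnegative coefficients, supported at (the generic
points of) prime divisors. -/
def IsEffectiveDivisor {X : Scheme.{u}} (D : AlgebraicCycle X ℤ) : Prop :=
  (∀ x, 0 ≤ D x) ∧ ∀ x, D x ≠ 0 → ringKrullDim (X.presheaf.stalk x) = 1

/-- The support `⋃ closure {x}` of the cycle `D` intersects `Y`. -/
def MeetsCycle {X : Scheme.{u}} (Y : Closeds X) (D : AlgebraicCycle X ℤ) : Prop :=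
  ∃ x : X, D x ≠ 0 ∧ (closure {x} ∩ (Y : Set X)).Nonempty

variable (k : Type u) [Field k]

attribute [local instance] MvPolynomial.gradedAlgebra

/-- Projective `n`-space over `k`. -/
def projectiveSpace (n : ℕ) : Scheme.{u} :=
  Proj (MvPolynomial.homogeneousSubmodule (Fin (n + 1)) k)

/-- The structure morphism of projective space. -/
def projectiveSpaceStr (n : ℕ) : projectiveSpace k n ⟶ Spec (.of k) :=
  Proj.toSpecZero (MvPolynomial.homogeneousSubmodule (Fin (n + 1)) k) ≫
    Spec.map (CommRingCat.ofHom
      (algebraMap k (MvPolynomial.homogeneousSubmodule (Fin (n + 1)) k 0)))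

/-- Irreducible projective varieties over `k`: integral separated schemes of finite type over `k`
which admit a closed immersion into some projective space over `k`. -/
structure ProjectiveVariety where
  /-- The underlying scheme. -/
  scheme : Scheme.{u}
  /-- The structure morphism. -/
  str : scheme ⟶ Spec (.of k)
  isIntegral : IsIntegral scheme
  isSeparated : IsSeparated str
  locallyOfFiniteType : LocallyOfFiniteType str
  quasiCompact : QuasiCompact str
  exists_closedImmersion : ∃ (n : ℕ) (j : scheme ⟶ projectiveSpace k n),
    IsClosedImmersion j ∧ j ≫ projectiveSpaceStr k n = str

variable {k}

instance (X : ProjectiveVariety k) : IsIntegral X.scheme := X.isIntegral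

instance (X : ProjectiveVariety k) : IsLocallyNoetherian X.scheme :=
  have := X.locallyOfFiniteType
  LocallyOfFiniteType.isLocallyNoetherian X.str

end Varieties

end FormalGeometry

end

noncomputable section

namespace FormalGeometry

/-! ### Sections and restrictions -/

section Restriction

/-! A section of `E` is determined by its coordinates in local frames. Since `X` is integral, `ℳ_X`
is constant and `K(X)` is a field, so the coordinates of a section over any nonempty open set are
elements of `K(X)`, and two frames are related by a matrix over `K(X)`. A coordinate function is a
map from `E` to the pushforward of `ℳ_{X_{/Y}}`; its transpose gives every formal section `ξ`
coordinates in `K(X_{/Y})`, even for frames whose domain misses `Y`. Injectivity follows at once: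
`α` is injective, being a homomorphism from a field to a nonzero ring.

For surjectivity, near a point of `Y` the section `ξ` is a combination of pulled-back frame elements
with formal functions as coefficients. Hence each coordinate `ζ` of `ξ` is locally of the form `∑ hᵢ
α(aᵢ)` with `hᵢ` formal functions and `aᵢ ∈ K(X)`. As `Y` is compact, finitely many `aᵢ` suffice; as
`K(X) = K(X, L)`, they have a common denominator `s` coming from a section of some `L ^ m`, with all
`s aᵢ` also sections of `L ^ m`. Then `ζ = (α(s) ζ) / α(s)` is a ratio of formal sections of `L ^
m`, so the weak G3 property gives `ζ = α(t)` (`exists_alpha_eq`).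

It remains to see that the rational functions `t` are the coordinates of a section over `U`. In a
frame at `y ∈ Y` they become formal functions near `y`, and Krull's intersection theorem shows that
they are regular at `y` (`isRegularAt_of_pullRat`). The closure of a point of codimension one is a
prime divisor and so meets `Y`; regularity therefore passes from `Y` to all points of codimension
one in `U`, after a change of frame. Condition `S_2` extends the coordinates over the remaining
points (`exists_toRat_eq_of_isRegularAt`), and the resulting local sections glue. -/

/-- Restriction of sections of a presheaf of commutative rings. -/
def ringRes {T : TopCat.{u}} (F : TopCat.Presheaf CommRingCat.{u} T) {V W : Opens T} (h : W ≤ V) :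
    F.obj (op V) →+* F.obj (op W) :=
  (F.map (homOfLE h).op).hom

variable {T : TopCat.{u}} (F : TopCat.Presheaf CommRingCat.{u} T)

lemma ringRes_ringRes {U V W : Opens T} (h : W ≤ V) (h' : V ≤ U) (s : F.obj (op U)) :
    ringRes F h (ringRes F h' s) = ringRes F (h.trans h') s := by
  change (F.map (homOfLE h').op ≫ F.map (homOfLE h).op) s = _
  rw [← F.map_comp]
  rfl

lemma ringRes_self {V : Opens T} (h : V ≤ V) (s : F.obj (op V)) : ringRes F h s = s := by
  change F.map (𝟙 (op V)) s = s
  rw [F.map_id]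
  rfl

variable {F}

lemma ringRes_eq_of_cover (hF : F.IsSheaf) {V : Opens T} {ι : Type*} (U : ι → Opens T)
    (hU : ∀ i, U i ≤ V) (hc : V ≤ iSup U) {s t : F.obj (op V)}
    (h : ∀ i, ringRes F (hU i) s = ringRes F (hU i) t) : s = t :=
  TopCat.Sheaf.eq_of_locally_eq' (⟨F, hF⟩ : TopCat.Sheaf CommRingCat.{u} T) U V
    (fun i => homOfLE (hU i)) hc s t h

lemma ringRes_eq_of_locally (hF : F.IsSheaf) {V : Opens T} {s t : F.obj (op V)}
    (h : ∀ x ∈ V, ∃ (W : Opens T) (hW : W ≤ V), x ∈ W ∧ ringRes F hW s = ringRes F hW t) :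
    s = t := by
  choose W hW hxW hst using h
  exact ringRes_eq_of_cover hF (fun x : V => W x.1 x.2) (fun x => hW x.1 x.2)
    (fun x hx => Opens.mem_iSup.2 ⟨⟨x, hx⟩, hxW x hx⟩) fun x => hst x.1 x.2

lemma exists_ringRes_glue (hF : F.IsSheaf) {V : Opens T} {ι : Type*} (U : ι → Opens T)
    (hU : ∀ i, U i ≤ V) (hc : V ≤ iSup U) (s : ∀ i, F.obj (op (U i)))
    (h : ∀ i j, ringRes F (inf_le_left : U i ⊓ U j ≤ U i) (s i) =
      ringRes F (inf_le_right : U i ⊓ U j ≤ U j) (s j)) :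
    ∃ t : F.obj (op V), ∀ i, ringRes F (hU i) t = s i :=
  (TopCat.Sheaf.existsUnique_gluing' (⟨F, hF⟩ : TopCat.Sheaf CommRingCat.{u} T) U V
    (fun i => homOfLE (hU i)) hc s h).exists

variable {Z : RingedSpace.{u, u}}

/-- The scalars of a sheaf of modules live in the image of the structure sheaf in `RingCat`. Viewing
them in `Z.presheaf` recovers commutativity, which tensor products and linear maps over the section
rings need. -/
instance sectionsModule (M : Mod Z) (V : Opens Z) :
    Module (Z.presheaf.obj (op V)) (sections M V) :=
  inferInstanceAs (Module ((ringSheaf Z).obj.obj (op V)) (M.val.obj (op V)))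

/-- Restriction of sections of a sheaf of modules. -/
def modRes (M : Mod Z) {V W : Opens Z} (h : W ≤ V) : sections M V →+ sections M W where
  toFun s := M.val.map (homOfLE h).op s
  map_zero' := map_zero _
  map_add' := map_add _

variable (M : Mod Z)

lemma modRes_smul {V W : Opens Z} (h : W ≤ V) (r : Z.presheaf.obj (op V)) (s : sections M V) :
    modRes M h (r • s) = ringRes Z.presheaf h r • modRes M h s :=
  M.val.map_smul (homOfLE h).op r s

lemma modRes_modRes {U V W : Opens Z} (h : W ≤ V) (h' : V ≤ U) (s : sections M U) :
    modRes M h (modRes M h' s) = modRes M (h.trans h') s :=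
  (M.val.map_comp_apply (homOfLE h').op (homOfLE h).op s).symm

lemma modRes_self {V : Opens Z} (h : V ≤ V) (s : sections M V) : modRes M h s = s := by
  change M.val.map (𝟙 (op V)) s = s
  rw [M.val.map_id]
  rfl

lemma modRes_eq_of_cover {V : Opens Z} {ι : Type*} (U : ι → Opens Z)
    (hU : ∀ i, U i ≤ V) (hc : V ≤ iSup U) {s t : sections M V}
    (h : ∀ i, modRes M (hU i) s = modRes M (hU i) t) : s = t :=
  TopCat.Sheaf.eq_of_locally_eq' (⟨M.val.presheaf, M.isSheaf⟩ : TopCat.Sheaf AddCommGrpCat.{u} _)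
    U V (fun i => homOfLE (hU i)) hc s t h

lemma modRes_eq_of_locally {V : Opens Z} {s t : sections M V}
    (h : ∀ x ∈ V, ∃ (W : Opens Z) (hW : W ≤ V), x ∈ W ∧ modRes M hW s = modRes M hW t) :
    s = t := by
  choose W hW hxW hst using h
  exact modRes_eq_of_cover M (fun x : V => W x.1 x.2) (fun x => hW x.1 x.2)
    (fun x hx => Opens.mem_iSup.2 ⟨⟨x, hx⟩, hxW x hx⟩) fun x => hst x.1 x.2

lemma exists_modRes_glue {V : Opens Z} {ι : Type*} (U : ι → Opens Z)
    (hU : ∀ i, U i ≤ V) (hc : V ≤ iSup U) (s : ∀ i, sections M (U i))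
    (h : ∀ i j, modRes M (inf_le_left : U i ⊓ U j ≤ U i) (s i) =
      modRes M (inf_le_right : U i ⊓ U j ≤ U j) (s j)) :
    ∃ t : sections M V, ∀ i, modRes M (hU i) t = s i := by
  have h' : TopCat.Presheaf.IsCompatible M.val.presheaf U s := h
  obtain ⟨t, ht, -⟩ := TopCat.Sheaf.existsUnique_gluing'
    (⟨M.val.presheaf, M.isSheaf⟩ : TopCat.Sheaf AddCommGrpCat.{u} _)
    U V (fun i => homOfLE (hU i)) hc s h'
  exact ⟨t, ht⟩

/-- A morphism of sheaves of modules on sections. -/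
def homApp {M N : Mod Z} (φ : M ⟶ N) (V : Opens Z) :
    sections M V →ₗ[Z.presheaf.obj (op V)] sections N V :=
  (φ.val.app (op V)).hom

lemma homApp_modRes {M N : Mod Z} (φ : M ⟶ N) {V W : Opens Z} (h : W ≤ V) (s : sections M V) :
    homApp φ W (modRes M h s) = modRes N h (homApp φ V s) :=
  PresheafOfModules.naturality_apply φ.val (homOfLE h).op s

/-- A morphism of sheaves of modules given by compatible linear maps. -/
def homOfApp {M N : Mod Z} (f : ∀ V : Opens Z, sections M V →ₗ[Z.presheaf.obj (op V)] sections N V)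
    (hf : ∀ (V W : Opens Z) (h : W ≤ V) s, f W (modRes M h s) = modRes N h (f V s)) : M ⟶ N where
  val :=
    { app V := ModuleCat.ofHom (f V.unop)
      naturality {V W} h := by
        ext s
        exact hf V.unop W.unop h.unop.le s }

lemma hom_ext_homApp {M N : Mod Z} {φ ψ : M ⟶ N}
    (h : ∀ (V : Opens Z) s, homApp φ V s = homApp ψ V s) : φ = ψ := by
  apply SheafOfModules.hom_ext
  apply PresheafOfModules.hom_ext
  intro V
  ext s
  exact h V.unop s

lemma mono_of_homApp_injective {M N : Mod Z} (φ : M ⟶ N)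
    (h : ∀ V : Opens Z, Function.Injective (homApp φ V)) : Mono φ where
  right_cancellation {P} a b hab := hom_ext_homApp fun V s => h V <| by
    have := congrArg (fun c : P ⟶ N => homApp c V s) hab
    exact this

end Restriction

/-! ### Frames -/

section Frames

variable {Z : RingedSpace.{u, u}} {M : Mod Z} {V : Opens Z} {n : ℕ} {b : Fin n → sections M V}

lemma isFrame_iff : IsFrame M V b ↔ ∀ (W : Opens Z) (h : W ≤ V), Function.Bijective
    fun c : Fin n → Z.presheaf.obj (op W) => ∑ i, c i • modRes M h (b i) :=
  ⟨fun H W h => H W (homOfLE h), fun H W h => H W h.le⟩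

lemma IsFrame.modRes (hb : IsFrame M V b) {V' : Opens Z} (h : V' ≤ V) :
    IsFrame M V' fun i => modRes M h (b i) := by
  rw [isFrame_iff] at hb ⊢
  intro W hW
  convert hb W (hW.trans h) using 5
  rw [modRes_modRes]

/-- The coordinates of a section with respect to a frame. -/
def IsFrame.coord (hb : IsFrame M V b) {W : Opens Z} (h : W ≤ V) :
    sections M W ≃ₗ[Z.presheaf.obj (op W)] (Fin n → Z.presheaf.obj (op W)) :=
  (LinearEquiv.ofBijective
    { toFun := fun c : Fin n → Z.presheaf.obj (op W) => ∑ i, c i • FormalGeometry.modRes M h (b i)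
      map_add' := fun c d => by simp [add_smul, Finset.sum_add_distrib]
      map_smul' := fun r c => by simp [mul_smul, Finset.smul_sum] } (isFrame_iff.1 hb W h)).symm

lemma IsFrame.sum_coord (hb : IsFrame M V b) {W : Opens Z} (h : W ≤ V) (s : sections M W) :
    ∑ i, hb.coord h s i • FormalGeometry.modRes M h (b i) = s :=
  (hb.coord h).symm_apply_apply s

lemma IsFrame.coord_sum (hb : IsFrame M V b) {W : Opens Z} (h : W ≤ V)
    (c : Fin n → Z.presheaf.obj (op W)) :
    hb.coord h (∑ i, c i • FormalGeometry.modRes M h (b i)) = c :=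
  (hb.coord h).apply_symm_apply c

lemma IsFrame.coord_modRes (hb : IsFrame M V b) {W W' : Opens Z} (h : W ≤ V) (h' : W' ≤ W)
    (s : sections M W) (i : Fin n) :
    hb.coord (h'.trans h) (FormalGeometry.modRes M h' s) i =
      ringRes Z.presheaf h' (hb.coord h s i) := by
  have : FormalGeometry.modRes M h' s = ∑ i, ringRes Z.presheaf h' (hb.coord h s i) •
      FormalGeometry.modRes M (h'.trans h) (b i) := by
    conv_lhs => rw [← hb.sum_coord h s]
    rw [map_sum]
    simp_rw [modRes_smul, modRes_modRes]
  rw [this, hb.coord_sum]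

/-- Sections over `V` form a frame if they are independent over every open subset and generate
locally. -/
lemma isFrame_of_locally (hinj : ∀ (W : Opens Z) (h : W ≤ V) (c : Fin n → Z.presheaf.obj (op W)),
      ∑ i, c i • modRes M h (b i) = 0 → c = 0)
    (hsurj : ∀ (W : Opens Z) (h : W ≤ V) (s : sections M W), ∀ x ∈ W, ∃ (W' : Opens Z)
      (h' : W' ≤ W), x ∈ W' ∧ ∃ c : Fin n → Z.presheaf.obj (op W'),
        modRes M h' s = ∑ i, c i • modRes M (h'.trans h) (b i)) : IsFrame M V b := by
  rw [isFrame_iff]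
  have hinj' : ∀ (W : Opens Z) (h : W ≤ V) (c d : Fin n → Z.presheaf.obj (op W)),
      ∑ i, c i • modRes M h (b i) = ∑ i, d i • modRes M h (b i) → c = d := by
    intro W h c d hcd
    refine sub_eq_zero.1 (hinj W h _ ?_)
    simp only [Pi.sub_apply, sub_smul, Finset.sum_sub_distrib, hcd, sub_self]
  intro W h
  refine ⟨fun c d hcd => hinj' W h c d hcd, fun s => ?_⟩
  choose W' hW' hx c hc using hsurj W h s
  have hcov : W ≤ ⨆ x : W, W' x.1 x.2 := fun x hx' => Opens.mem_iSup.2 ⟨⟨x, hx'⟩, hx x hx'⟩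
  -- Independence over the overlaps makes the local coefficients unique there, so they glue.
  have hglue : ∀ i, ∃ t : Z.presheaf.obj (op W), ∀ x : W,
      ringRes Z.presheaf (hW' x.1 x.2) t = c x.1 x.2 i := by
    intro i
    refine exists_ringRes_glue Z.IsSheaf (fun x : W => W' x.1 x.2) (fun x => hW' x.1 x.2) hcov
      (fun x => c x.1 x.2 i) fun x y => ?_
    refine congrFun (hinj' _ ((inf_le_left.trans (hW' x.1 x.2)).trans h) 
      (fun j => ringRes Z.presheaf inf_le_left (c x.1 x.2 j))
      (fun j => ringRes Z.presheaf inf_le_right (c y.1 y.2 j)) ?_) i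
    have h1 := congrArg (modRes M (inf_le_left : W' x.1 x.2 ⊓ W' y.1 y.2 ≤ _)) (hc x.1 x.2)
    have h2 := congrArg (modRes M (inf_le_right : W' x.1 x.2 ⊓ W' y.1 y.2 ≤ _)) (hc y.1 y.2)
    rw [modRes_modRes, map_sum] at h1 h2
    simp_rw [modRes_smul, modRes_modRes] at h1 h2
    exact h1.symm.trans h2
  choose t ht using hglue
  refine ⟨t, modRes_eq_of_cover M (fun x : W => W' x.1 x.2) (fun x => hW' x.1 x.2) hcov
    fun x => ?_⟩
  rw [hc, map_sum]
  simp_rw [modRes_smul, modRes_modRes, ht]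

/-- The morphism `M ⟶ N` obtained by applying `θ` to the `k`-th coordinate with respect to a frame
over `V`. -/
def IsFrame.functional {N : Mod Z} (hb : IsFrame M V b) (k : Fin n)
    (θ : ∀ W : Opens Z, Z.presheaf.obj (op (W ⊓ V)) →+ sections N W)
    (hθ : ∀ W r c, θ W (ringRes Z.presheaf inf_le_left r * c) = r • θ W c)
    (hθ' : ∀ (W W' : Opens Z) (h : W' ≤ W) c,
      θ W' (ringRes Z.presheaf (inf_le_inf_right V h) c) = FormalGeometry.modRes N h (θ W c)) :
    M ⟶ N :=
  homOfApp
    (fun W =>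
      { toFun := fun s => θ W (hb.coord inf_le_right (FormalGeometry.modRes M inf_le_left s) k)
        map_add' := fun s t => by simp
        map_smul' := fun r s => by
          rw [modRes_smul, map_smul, Pi.smul_apply, smul_eq_mul, hθ, RingHom.id_apply] })
    (fun W W' h s => by
      change θ W' _ = FormalGeometry.modRes N h (θ W _)
      rw [← hθ', modRes_modRes, ← hb.coord_modRes, modRes_modRes])

end Frames

end FormalGeometry

end

noncomputable section

namespace FormalGeometry

/-! ### Tensor products and tensor powers of frames -/

section Tensor

open scoped TensorProduct

variable {Z : RingedSpace.{u, u}} (M N : Mod Z)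

/-- The presheaf tensor product. -/
abbrev tensorPresheaf : PresheafOfModules.{u} (ringSheaf Z).obj :=
  MonoidalCategory.tensorObj
    (C := PresheafOfModules.{u} (Z.presheaf ⋙ forget₂ CommRingCat RingCat)) M.val N.val

/-- The canonical map from the presheaf tensor product to the tensor product. -/
def toTensor (V : Opens Z) :
    sections M V ⊗[Z.presheaf.obj (op V)] sections N V →ₗ[Z.presheaf.obj (op V)]
      sections (tensor M N) V where
  toFun x := (toSheafify (Opens.grothendieckTopology Z) (tensorPresheaf M N).presheaf).app (op V) x
  map_add' x y := map_add
    ((toSheafify (Opens.grothendieckTopology Z) (tensorPresheaf M N).presheaf).app (op V)).hom x y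
  map_smul' r x := ((PresheafOfModules.toSheafify (𝟙 (ringSheaf Z).obj)
    (toSheafify (Opens.grothendieckTopology Z)
      (tensorPresheaf M N).presheaf)).app (op V)).hom.map_smul r x

variable {M N}

/-- The section `s ⊗ t`. -/
def tmul {V : Opens Z} (s : sections M V) (t : sections N V) : sections (tensor M N) V :=
  toTensor M N V (s ⊗ₜ t)

lemma modRes_tmul {V W : Opens Z} (h : W ≤ V) (s : sections M V) (t : sections N V) :
    modRes (tensor M N) h (tmul s t) = tmul (modRes M h s) (modRes N h t) :=
  (ConcreteCategory.congr_hom ((toSheafify (Opens.grothendieckTopology Z)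
    (tensorPresheaf M N).presheaf).naturality (homOfLE h).op)
      (s ⊗ₜ[Z.presheaf.obj (op V)] t)).symm

lemma smul_tmul_smul {V : Opens Z} (r r' : Z.presheaf.obj (op V)) (s : sections M V)
    (t : sections N V) : tmul (r • s) (r' • t) = (r * r') • tmul s t := by
  rw [tmul, TensorProduct.smul_tmul_smul, map_smul, tmul]

/-- Sheafification is locally injective and locally surjective. This lemma and the next make that
concrete, so that questions on `tensor` reduce to tensor products of modules of sections. -/
lemma toTensor_locally_injective {V : Opens Z}
    (x : sections M V ⊗[Z.presheaf.obj (op V)] sections N V) (hx : toTensor M N V x = 0) :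
    ∀ z ∈ V, ∃ (W : Opens Z) (h : W ≤ V), z ∈ W ∧
      (tensorPresheaf M N).presheaf.map (homOfLE h).op x = 0 := by
  intro z hz
  have := Presheaf.equalizerSieve_mem (Opens.grothendieckTopology Z)
    (toSheafify (Opens.grothendieckTopology Z) (tensorPresheaf M N).presheaf) (X := op V) x 0
    (hx.trans (map_zero (toTensor M N V)).symm)
  obtain ⟨W, f, hf, hzW⟩ := this z hz
  exact ⟨W, f.le, hzW, hf.trans (map_zero ((tensorPresheaf M N).presheaf.map f.op).hom)⟩

lemma toTensor_locally_surjective {V : Opens Z} (t : sections (tensor M N) V) :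
    ∀ z ∈ V, ∃ (W : Opens Z) (h : W ≤ V), z ∈ W ∧ ∃ x, toTensor M N W x = modRes _ h t := by
  intro z hz
  have := Presheaf.imageSieve_mem (Opens.grothendieckTopology Z)
    (toSheafify (Opens.grothendieckTopology Z) (tensorPresheaf M N).presheaf) (U := op V) t
  obtain ⟨W, f, ⟨x, hx⟩, hzW⟩ := this z hz
  exact ⟨W, f.le, hzW, x, hx⟩

lemma tensorPresheaf_map_tmul {V W : Opens Z} (h : W ≤ V) (s : sections M V) (t : sections N V) :
    (tensorPresheaf M N).presheaf.map (homOfLE h).op (s ⊗ₜ[Z.presheaf.obj (op V)] t) =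
      modRes M h s ⊗ₜ[Z.presheaf.obj (op W)] modRes N h t := rfl

variable {V : Opens Z} {b : sections M V} {c : sections N V}

/-- The rank one case of a frame, without sums. -/
lemma isFrame_one_iff : IsFrame M V (fun _ : Fin 1 => b) ↔ ∀ (W : Opens Z) (h : W ≤ V),
    Function.Bijective fun r : Z.presheaf.obj (op W) => r • modRes M h b := by
  rw [isFrame_iff]
  refine forall₂_congr fun W h => ?_
  rw [← (Equiv.funUnique (Fin 1) (Z.presheaf.obj (op W))).symm.bijective.of_comp_iff]
  refine iff_of_eq (congrArg _ (funext fun r => ?_))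
  simp

lemma IsFrame.tmul (hb : IsFrame M V fun _ : Fin 1 => b) (hc : IsFrame N V fun _ : Fin 1 => c) :
    IsFrame (tensor M N) V fun _ : Fin 1 => tmul b c := by
  -- On the presheaf level the claim holds over every open set: the coordinates identify both
  -- factors with the ring `R` of sections, and `R ⊗ R = R` sends the tensor of the generators to
  -- `1`.
  have key : ∀ (W : Opens Z) (h : W ≤ V), Function.Bijective fun r : Z.presheaf.obj (op W) =>
      r • (FormalGeometry.modRes M h b ⊗ₜ[Z.presheaf.obj (op W)] FormalGeometry.modRes N h c) := by
    intro W h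
    let e := TensorProduct.congr (hb.coord h) (hc.coord h) ≪≫ₗ
      TensorProduct.congr (LinearEquiv.funUnique (Fin 1) _ _) (LinearEquiv.funUnique (Fin 1) _ _)
        ≪≫ₗ TensorProduct.lid _ _
    have h1 : e (FormalGeometry.modRes M h b ⊗ₜ[Z.presheaf.obj (op W)]
        FormalGeometry.modRes N h c) = 1 := by
      have hb1 := hb.coord_sum h fun _ => 1
      have hc1 := hc.coord_sum h fun _ => 1
      simp only [Finset.univ_unique, Finset.sum_singleton, one_smul] at hb1 hc1
      simp [e, hb1, hc1]
    convert e.symm.bijective using 2 with r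
    rw [LinearEquiv.eq_symm_apply, map_smul, h1, smul_eq_mul, mul_one]
  refine isFrame_of_locally (fun W h r hr => ?_) fun W h s x hx => ?_
  · simp only [Finset.univ_unique, Finset.sum_singleton, modRes_tmul] at hr
    rw [FormalGeometry.tmul, ← map_smul] at hr
    refine funext fun i => ?_
    rw [Subsingleton.elim i default]
    refine ringRes_eq_of_locally Z.IsSheaf fun z hz => ?_
    obtain ⟨W', h', hz', hW'⟩ := toTensor_locally_injective _ hr z hz
    refine ⟨W', h', hz', ?_⟩
    change _ = ringRes Z.presheaf h' 0
    rw [map_zero]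
    refine (key W' (h'.trans h)).1 ?_
    rw [TensorProduct.smul_tmul'] at hW'
    replace hW' := (tensorPresheaf_map_tmul h' _ _).symm.trans hW'
    rw [modRes_smul, modRes_modRes, modRes_modRes, ← TensorProduct.smul_tmul'] at hW'
    beta_reduce
    rw [zero_smul]
    exact hW'
  · obtain ⟨W', h', hx', t, ht⟩ := toTensor_locally_surjective s x hx
    obtain ⟨r, rfl⟩ := (key W' (h'.trans h)).2 t
    refine ⟨W', h', hx', fun _ => r, ?_⟩
    simp only [Finset.univ_unique, Finset.sum_singleton, modRes_tmul, ← ht]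
    rw [map_smul]
    rfl

/-- The powers of a section of a sheaf of modules. -/
def powSection (b : sections M V) : ∀ m : ℕ, sections (tensorPow M m) V
  | 0 => (1 : Z.presheaf.obj (op V))
  | m + 1 => FormalGeometry.tmul (powSection b m) b

lemma modRes_powSection {W : Opens Z} (h : W ≤ V) (b : sections M V) (m : ℕ) :
    modRes (tensorPow M m) h (powSection b m) = powSection (modRes M h b) m := by
  induction m with
  | zero => exact map_one (ringRes Z.presheaf h)
  | succ m ih => exact (modRes_tmul h _ _).trans (by rw [ih]; rfl)

lemma powSection_smul (r : Z.presheaf.obj (op V)) (b : sections M V) (m : ℕ) :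
    powSection (r • b) m = r ^ m • powSection b m := by
  induction m with
  | zero => rw [pow_zero, one_smul]; rfl
  | succ m ih =>
    change FormalGeometry.tmul (powSection (r • b) m) (r • b) = _
    rw [ih, smul_tmul_smul, pow_succ]
    rfl

lemma IsFrame.powSection (hb : IsFrame M V fun _ : Fin 1 => b) (m : ℕ) :
    IsFrame (tensorPow M m) V fun _ : Fin 1 => powSection b m := by
  induction m with
  | zero =>
    rw [isFrame_one_iff]
    intro W h
    have : (fun r : Z.presheaf.obj (op W) => r • FormalGeometry.modRes (tensorPow M 0) h
        (FormalGeometry.powSection b 0)) = id := funext fun r => by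
      rw [modRes_powSection]
      exact mul_one (M := Z.presheaf.obj (op W)) r
    rw [this]
    exact Function.bijective_id
  | succ m ih => exact ih.tmul hb

end Tensor

end FormalGeometry

end

noncomputable section

namespace FormalGeometry

/-! ### Sections of pullbacks -/

section PullbackSections

variable {Z S : RingedSpace.{u, u}} (f : Z ⟶ S) (M : Mod S)

/-- The preimage of an open set under a morphism of ringed spaces. -/
abbrev preimageOpen (V : Opens S) : Opens Z := (Opens.map f.hom.base).obj V

/-- The natural map from sections of `M` to sections of `f ^* M`. -/
def unitApp (V : Opens S) :
    sections M V →+ sections ((pullback f).obj M) (preimageOpen f V) where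
  toFun s := homApp ((pullbackAdj f).unit.app M) V s
  map_zero' := map_zero _
  map_add' := map_add _

variable {M}

lemma unitApp_smul {V : Opens S} (r : S.presheaf.obj (op V)) (s : sections M V) :
    unitApp f M V (r • s) = pullRing f V r • unitApp f M V s :=
  map_smul (homApp ((pullbackAdj f).unit.app M) V) r s

lemma unitApp_modRes {V V' : Opens S} (h : V' ≤ V) (s : sections M V)
    (h' : preimageOpen f V' ≤ preimageOpen f V) :
    unitApp f M V' (modRes M h s) = modRes ((pullback f).obj M) h' (unitApp f M V s) :=
  homApp_modRes ((pullbackAdj f).unit.app M) h s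

/-- A triangle identity of the adjunction. Maps out of a pullback are only ever evaluated through
this formula on pulled-back sections. -/
lemma homApp_transpose {P : Mod Z} (φ : M ⟶ (pushforward f).obj P) (V : Opens S)
    (s : sections M V) :
    homApp (((pullbackAdj f).homEquiv _ _).symm φ) (preimageOpen f V) (unitApp f M V s) =
      homApp φ V s := by
  have h := ((pullbackAdj f).homEquiv M P).apply_symm_apply φ
  rw [Adjunction.homEquiv_unit] at h
  exact congrArg (fun c : M ⟶ (pushforward f).obj P => homApp c V s) h

variable (M)

/-- The module generated by the pullbacks of sections. -/
def pulledBackSpan (W : Opens Z) :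
    Submodule (Z.presheaf.obj (op W)) (sections ((pullback f).obj M) W) :=
  Submodule.span _ {t | ∃ (V : Opens S) (h : W ≤ preimageOpen f V) (m : sections M V),
    t = modRes _ h (unitApp f M V m)}

variable {M}

lemma modRes_mem_pulledBackSpan {W W' : Opens Z} (h : W' ≤ W)
    {t : sections ((pullback f).obj M) W} (ht : t ∈ pulledBackSpan f M W) :
    modRes _ h t ∈ pulledBackSpan f M W' := by
  induction ht using Submodule.span_induction with
  | mem t ht =>
    obtain ⟨V, hV, m, rfl⟩ := ht
    exact Submodule.subset_span ⟨V, h.trans hV, m, modRes_modRes _ _ _ _⟩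
  | zero => rw [map_zero]; exact zero_mem _
  | add x y _ _ hx hy => rw [map_add]; exact add_mem hx hy
  | smul r x _ hx => rw [modRes_smul]; exact Submodule.smul_mem _ _ hx

variable (M)

/-- The subsheaf of `f ^* M` which is locally generated by pullbacks of sections. -/
def pulledBackSubmodule : PresheafOfModules.Submodule ((pullback f).obj M).val where
  obj W :=
    { carrier := {s : sections ((pullback f).obj M) W.unop | ∀ z ∈ W.unop, ∃ (W' : Opens Z)
        (h : W' ≤ W.unop), z ∈ W' ∧ modRes _ h s ∈ pulledBackSpan f M W'}
      zero_mem' := fun z hz => ⟨W.unop, le_rfl, hz, by rw [map_zero]; exact zero_mem _⟩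
      add_mem' := by
        intro s t hs ht z hz
        obtain ⟨A, hA, hzA, hsA⟩ := hs z hz
        obtain ⟨B, hB, hzB, htB⟩ := ht z hz
        refine ⟨A ⊓ B, inf_le_left.trans hA, ⟨hzA, hzB⟩, ?_⟩
        have h1 := modRes_mem_pulledBackSpan f (inf_le_left : A ⊓ B ≤ A) hsA
        have h2 := modRes_mem_pulledBackSpan f (inf_le_right : A ⊓ B ≤ B) htB
        rw [modRes_modRes] at h1 h2
        have h3 := add_mem h1 h2
        rw [← map_add] at h3
        exact h3
      smul_mem' := by
        intro r s hs z hz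
        obtain ⟨A, hA, hzA, hsA⟩ := hs z hz
        refine ⟨A, hA, hzA, ?_⟩
        have h3 := Submodule.smul_mem _ (ringRes Z.presheaf hA r) hsA
        exact (modRes_smul _ hA (show Z.presheaf.obj (op W.unop) from r) s) ▸ h3 }
  map {W W'} h s hs z hz := by
    obtain ⟨A, hA, hzA, hsA⟩ := hs z (h.unop.le hz)
    refine ⟨A ⊓ W'.unop, inf_le_right, ⟨hzA, hz⟩, ?_⟩
    have h1 := modRes_mem_pulledBackSpan f (inf_le_left : A ⊓ W'.unop ≤ A) hsA
    rw [modRes_modRes] at h1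
    have h2 := modRes_modRes ((pullback f).obj M) (inf_le_right : A ⊓ W'.unop ≤ _) h.unop.le s
    exact h2 ▸ h1

/-- The subsheaf `pulledBackSubmodule`, as a sheaf of modules. -/
def pulledBackSheaf : Mod Z where
  val := (pulledBackSubmodule f M).toPresheafOfModules
  isSheaf := by
    refine (TopCat.Presheaf.isSheaf_iff_isSheafUniqueGluing
      (pulledBackSubmodule f M).toPresheafOfModules.presheaf).2 ?_
    intro ι U sf hsf
    obtain ⟨t, ht⟩ := exists_modRes_glue ((pullback f).obj M) U (V := iSup U)
      (fun i => le_iSup U i) le_rfl (fun i => (sf i).1) fun i j => congrArg Subtype.val (hsf i j)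
    have htm : t ∈ (pulledBackSubmodule f M).obj (op (iSup U)) := by
      intro z hz
      obtain ⟨i, hi⟩ := Opens.mem_iSup.1 hz
      obtain ⟨A, hA, hzA, hsA⟩ := (sf i).2 z hi
      refine ⟨A, hA.trans (le_iSup U i), hzA, ?_⟩
      rw [← ht, modRes_modRes] at hsA
      exact hsA
    refine ⟨⟨t, htm⟩, fun i => Subtype.ext (ht i), ?_⟩
    rintro ⟨t', ht'⟩ h
    refine Subtype.ext (modRes_eq_of_cover _ U (fun i => le_iSup U i) le_rfl fun i => ?_)
    rw [ht]
    exact congrArg Subtype.val (h i)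

/-- The inclusion of `pulledBackSheaf`. -/
def pulledBackSheafι : pulledBackSheaf f M ⟶ (pullback f).obj M where
  val := (pulledBackSubmodule f M).ι

/-- The factorization of the unit through `pulledBackSheaf`. -/
def toPulledBackSheaf : M ⟶ (pushforward f).obj (pulledBackSheaf f M) :=
  homOfApp
    (fun V =>
      { toFun := fun s => ⟨unitApp f M V s, fun _ hz => ⟨_, le_rfl, hz,
          Submodule.subset_span ⟨V, le_rfl, s, rfl⟩⟩⟩
        map_add' := fun s t => Subtype.ext (map_add _ s t)
        map_smul' := fun r s => Subtype.ext (unitApp_smul f r s) })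
    (fun _ _ h s => Subtype.ext (unitApp_modRes f h s (fun _ hx => h hx)))

/-- Pulled-back sections generate `f ^* M` locally, by the universal property alone. The unit
factors through the subsheaf they generate, and the transpose of this factorization is a right
inverse of the inclusion; the inclusion is therefore surjective on sections, and no explicit
construction of the pullback is needed. -/
lemma mem_pulledBackSubmodule {W : Opens Z} (s : sections ((pullback f).obj M) W) :
    s ∈ (pulledBackSubmodule f M).obj (op W) := by
  let ψ := ((pullbackAdj f).homEquiv _ _).symm (toPulledBackSheaf f M)
  have h : ψ ≫ pulledBackSheafι f M = 𝟙 _ := by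
    apply ((pullbackAdj f).homEquiv _ _).injective
    rw [Adjunction.homEquiv_naturality_right, Equiv.apply_symm_apply, Adjunction.homEquiv_unit]
    exact hom_ext_homApp fun V s => rfl
  have h' : homApp (pulledBackSheafι f M) W (homApp ψ W s) = s :=
    congrArg (fun c : (pullback f).obj M ⟶ (pullback f).obj M => homApp c W s) h
  rw [← h']
  exact (homApp ψ W s : (pulledBackSubmodule f M).obj (op W)).2

variable {M}

lemma exists_coord_of_mem_pulledBackSpan {V : Opens S} {n : ℕ} {b : Fin n → sections M V}
    (hb : IsFrame M V b) {W : Opens Z} (hW : W ≤ preimageOpen f V)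
    {t : sections ((pullback f).obj M) W} (ht : t ∈ pulledBackSpan f M W) :
    ∃ c : Fin n → Z.presheaf.obj (op W), t = ∑ i, c i • modRes _ hW (unitApp f M V (b i)) := by
  induction ht using Submodule.span_induction with
  | mem t ht =>
    obtain ⟨V', hV', m, rfl⟩ := ht
    -- The section `m` lives on `V'`, the frame on `V`. Both restrict to `V ⊓ V'`, whose preimage
    -- still contains `W`, and there `m` can be expanded in the frame.
    have hWi : W ≤ preimageOpen f (V ⊓ V') := fun x hx => ⟨hW hx, hV' hx⟩
    refine ⟨fun i => ringRes Z.presheaf hWi (pullRing f _ (hb.coord inf_le_left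
      (modRes M inf_le_right m) i)), ?_⟩
    have h1 : modRes ((pullback f).obj M) hV' (unitApp f M V' m) =
        modRes _ hWi (unitApp f M (V ⊓ V') (modRes M inf_le_right m)) := by
      rw [unitApp_modRes f _ _ ((Opens.map f.hom.base).map (homOfLE inf_le_right)).le, modRes_modRes]
    rw [h1]
    conv_lhs => rw [← hb.sum_coord inf_le_left (modRes M inf_le_right m)]
    rw [map_sum, map_sum]
    refine Finset.sum_congr rfl fun i _ => ?_
    rw [unitApp_smul, modRes_smul, unitApp_modRes f _ _
      ((Opens.map f.hom.base).map (homOfLE inf_le_left)).le, modRes_modRes]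
  | zero => exact ⟨0, by simp⟩
  | add x y _ _ hx hy =>
    obtain ⟨c, rfl⟩ := hx
    obtain ⟨d, rfl⟩ := hy
    exact ⟨c + d, by simp [add_smul, Finset.sum_add_distrib]⟩
  | smul r x _ hx =>
    obtain ⟨c, rfl⟩ := hx
    exact ⟨r • c, by simp [mul_smul, Finset.smul_sum]⟩

/-- Sections of `f ^* M` are locally combinations of pullbacks of the elements of a frame. -/
lemma exists_coord_pullback {V : Opens S} {n : ℕ} {b : Fin n → sections M V}
    (hb : IsFrame M V b) {W : Opens Z} (s : sections ((pullback f).obj M) W) {z : Z} (hz : z ∈ W)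
    (hzV : z ∈ preimageOpen f V) :
    ∃ (W' : Opens Z) (h : W' ≤ W) (h' : W' ≤ preimageOpen f V) (c : Fin n → Z.presheaf.obj (op W')),
      z ∈ W' ∧ modRes _ h s = ∑ i, c i • modRes _ h' (unitApp f M V (b i)) := by
  obtain ⟨A, hA, hzA, hs⟩ := mem_pulledBackSubmodule f M s z hz
  have h1 := modRes_mem_pulledBackSpan f (inf_le_left : A ⊓ preimageOpen f V ≤ A) hs
  rw [modRes_modRes] at h1
  obtain ⟨c, hc⟩ := exists_coord_of_mem_pulledBackSpan f hb inf_le_right h1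
  exact ⟨_, _, _, c, ⟨hzA, hzV⟩, hc⟩

end PullbackSections

end FormalGeometry

end

noncomputable section

namespace FormalGeometry

/-! ### The sheaf of rational functions -/

section RationalSheaf

variable (Z : RingedSpace.{u, u})

/-- The ring homomorphism `𝒪_Z(V) → ℳ_Z(V)`. -/
def toRat (V : Opens Z) : Z.presheaf.obj (op V) →+* (rationalSheaf Z).obj.obj (op V) :=
  ((toRationalPresheaf Z ≫ toRationalSheaf Z).app (op V)).hom

/-- Restriction of rational functions. -/
abbrev ratRes {V W : Opens Z} (h : W ≤ V) :
    (rationalSheaf Z).obj.obj (op V) →+* (rationalSheaf Z).obj.obj (op W) :=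
  ringRes (rationalSheaf Z).obj h

variable {Z}

lemma ratRes_toRat {V W : Opens Z} (h : W ≤ V) (s : Z.presheaf.obj (op V)) :
    ratRes Z h (toRat Z V s) = toRat Z W (ringRes Z.presheaf h s) :=
  (ConcreteCategory.congr_hom
    ((toRationalPresheaf Z ≫ toRationalSheaf Z).naturality (homOfLE h).op) s).symm

instance : Presheaf.IsLocallyInjective (Opens.grothendieckTopology Z) (toRationalSheaf Z) :=
  inferInstanceAs (Presheaf.IsLocallyInjective _ (toSheafify _ (rationalPresheaf Z)))

instance : Presheaf.IsLocallySurjective (Opens.grothendieckTopology Z) (toRationalSheaf Z) :=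
  inferInstanceAs (Presheaf.IsLocallySurjective _ (toSheafify _ (rationalPresheaf Z)))

/-- Locally an equality in `ℳ_Z` is an equality of fractions, and the denominators are
nonzerodivisors. -/
lemma toRat_injective (V : Opens Z) : Function.Injective (toRat Z V) := by
  intro s t hst
  refine ringRes_eq_of_locally Z.IsSheaf fun z hz => ?_
  have := Presheaf.equalizerSieve_mem (Opens.grothendieckTopology Z) (toRationalSheaf Z)
    (X := op V) ((toRationalPresheaf Z).app (op V) s) ((toRationalPresheaf Z).app (op V) t) hst
  obtain ⟨W, f, hf, hzW⟩ := this z hz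
  refine ⟨W, f.le, hzW, ?_⟩
  have h1 := ConcreteCategory.congr_hom ((toRationalPresheaf Z).naturality f.op) s
  have h2 := ConcreteCategory.congr_hom ((toRationalPresheaf Z).naturality f.op) t
  have h3 : algebraMap _ (Localization (regularSections Z W)) (ringRes Z.presheaf f.le s) =
      algebraMap _ _ (ringRes Z.presheaf f.le t) := h1.trans (hf.trans h2.symm)
  refine IsLocalization.injective _ (M := regularSections Z W) (fun r hr => ?_) h3
  have := hr W (𝟙 W)
  rwa [op_id, Z.presheaf.map_id] at this

lemma isUnit_toRat {V : Opens Z} {q : Z.presheaf.obj (op V)} (hq : q ∈ regularSections Z V) :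
    IsUnit (toRat Z V q) :=
  (IsLocalization.map_units (Localization (regularSections Z V))
    (⟨q, hq⟩ : regularSections Z V)).map ((toRationalSheaf Z).app (op V)).hom

/-- Local surjectivity of sheafification, with the denominator cleared. Rational functions are
handled through this form only. -/
lemma exists_fraction {V : Opens Z} (t : (rationalSheaf Z).obj.obj (op V)) {z : Z} (hz : z ∈ V) :
    ∃ (W : Opens Z) (h : W ≤ V) (p q : Z.presheaf.obj (op W)), z ∈ W ∧ q ∈ regularSections Z W ∧
      toRat Z W q * ratRes Z h t = toRat Z W p := by
  have := Presheaf.imageSieve_mem (Opens.grothendieckTopology Z) (toRationalSheaf Z)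
    (U := op V) t
  obtain ⟨W, f, ⟨x, hx⟩, hzW⟩ := this z hz
  obtain ⟨⟨p, q⟩, hpq⟩ := IsLocalization.surj (regularSections Z W)
    (show Localization (regularSections Z W) from x)
  refine ⟨W, f.le, p, q.1, hzW, q.2, ?_⟩
  have h1 := congrArg ((toRationalSheaf Z).app (op W)).hom hpq
  rw [mul_comm] at h1
  refine Eq.trans ?_ h1
  refine Eq.trans ?_ (map_mul ((toRationalSheaf Z).app (op W)).hom _ _).symm
  exact congrArg _ hx.symm

lemma subsingleton_of_eq_bot {V : Opens Z} (hV : V = ⊥) {F : TopCat.Presheaf CommRingCat.{u} Z}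
    (hF : F.IsSheaf) : Subsingleton (F.obj (op V)) :=
  ⟨fun s t => ringRes_eq_of_locally hF fun z hz => by rw [hV] at hz; exact hz.elim⟩

end RationalSheaf

/-! ### Rational functions on an integral scheme. -/

section Integral

variable {X : Scheme.{u}} [IsIntegral X]

lemma nonempty_inf {V W : X.Opens} (hV : (V : Set X).Nonempty) (hW : (W : Set X).Nonempty) :
    ((V ⊓ W : X.Opens) : Set X).Nonempty :=
  nonempty_preirreducible_inter V.isOpen W.isOpen hV hW

lemma ringRes_injective {V W : X.Opens} (h : W ≤ V) (hW : (W : Set X).Nonempty) :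
    Function.Injective (ringRes X.presheaf h) := by
  have : Nonempty W := hW.to_subtype
  exact map_injective_of_isIntegral X (homOfLE h)

/-- Restriction to a nonempty open set is injective with values in a domain. Over the empty set the
ring is zero and every element is a nonzerodivisor. -/
lemma mem_regularSections {V : X.Opens} {q : Γ(X, V)} (hq : q ≠ 0) :
    q ∈ regularSections X.toSheafedSpace V := by
  intro W h
  by_cases hW : (W : Set X).Nonempty
  · have : Nonempty W := hW.to_subtype
    refine mem_nonZeroDivisors_of_ne_zero fun h0 => hq ?_
    exact ringRes_injective h.le hW (h0.trans (map_zero _).symm)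
  · have : Subsingleton (X.presheaf.obj (op W)) :=
      subsingleton_of_eq_bot (Z := X.toSheafedSpace)
        (Opens.coe_eq_empty.1 (Set.not_nonempty_iff_eq_empty.1 hW)) X.toSheafedSpace.IsSheaf
    rw [mem_nonZeroDivisors_iff_right]
    exact fun _ _ => Subsingleton.elim _ _

/-- The rational function `t` over `V` is represented by the element `f` of the function field. -/
def HasValue {V : X.Opens} (t : (rationalSheaf X.toSheafedSpace).obj.obj (op V))
    (f : X.functionField) : Prop :=
  ∃ (W : X.Opens) (h : W ≤ V) (_ : Nonempty W) (p q : Γ(X, W)), q ≠ 0 ∧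
    toRat X.toSheafedSpace W q * ratRes X.toSheafedSpace h t = toRat X.toSheafedSpace W p ∧
      X.germToFunctionField W p = f * X.germToFunctionField W q

lemma germToFunctionField_ringRes {V W : X.Opens} [Nonempty V] [Nonempty W] (h : W ≤ V)
    (s : Γ(X, V)) : X.germToFunctionField W (ringRes X.presheaf h s) =
      X.germToFunctionField V s :=
  X.presheaf.germ_res_apply (homOfLE h) _ _ s

lemma HasValue.res {V V' : X.Opens} (h : V' ≤ V) (hV' : (V' : Set X).Nonempty)
    {t : (rationalSheaf X.toSheafedSpace).obj.obj (op V)} {f : X.functionField}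
    (ht : HasValue t f) : HasValue (ratRes X.toSheafedSpace h t) f := by
  obtain ⟨W, hW, hne, p, q, hq, hqt, hpq⟩ := ht
  have hi : ((W ⊓ V' : X.Opens) : Set X).Nonempty := nonempty_inf (Set.nonempty_coe_sort.1 hne) hV'
  have hi' : Nonempty (W ⊓ V' : X.Opens) := hi.to_subtype
  refine ⟨W ⊓ V', inf_le_right, hi', ringRes X.presheaf inf_le_left p,
    ringRes X.presheaf inf_le_left q, fun h0 => hq ?_, ?_, ?_⟩
  · exact ringRes_injective inf_le_left hi (h0.trans (map_zero _).symm)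
  · rw [ringRes_ringRes, ← ringRes_ringRes (h := (inf_le_left : W ⊓ V' ≤ W)) (h' := hW)]
    exact (congrArg₂ _ (ratRes_toRat _ _).symm rfl).trans (((map_mul _ _ _).symm.trans
      (congrArg _ hqt)).trans (ratRes_toRat _ _))
  · rw [germToFunctionField_ringRes, germToFunctionField_ringRes, hpq]

lemma HasValue.of_res {V V' : X.Opens} (h : V' ≤ V)
    {t : (rationalSheaf X.toSheafedSpace).obj.obj (op V)} {f : X.functionField}
    (ht : HasValue (ratRes X.toSheafedSpace h t) f) : HasValue t f := by
  obtain ⟨W, hW, hne, p, q, hq, hqt, hpq⟩ := ht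
  rw [ringRes_ringRes] at hqt
  exact ⟨W, hW.trans h, hne, p, q, hq, hqt, hpq⟩

/-- Near any point a numerator of `t` vanishes on the intersection with `W`, which is nonempty by
irreducibility; it is then zero. -/
lemma ratRes_injective {V W : X.Opens} (h : W ≤ V) (hW : (W : Set X).Nonempty) :
    Function.Injective (ratRes X.toSheafedSpace h) := by
  rw [injective_iff_map_eq_zero]
  intro t ht
  refine ringRes_eq_of_locally (rationalSheaf X.toSheafedSpace).property fun x hx => ?_
  obtain ⟨A, hA, p, q, hxA, hq, hqt⟩ := exists_fraction t hx
  refine ⟨A, hA, hxA, ?_⟩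
  rw [map_zero]
  refine (isUnit_toRat hq).mul_right_cancel ?_
  rw [zero_mul, mul_comm, hqt]
  suffices h0 : p = 0 by rw [h0, map_zero]
  refine ringRes_injective (inf_le_left : A ⊓ W ≤ A) (nonempty_inf ⟨x, hxA⟩ hW)
    (toRat_injective (Z := X.toSheafedSpace) _ ?_)
  refine (ratRes_toRat (Z := X.toSheafedSpace) _ p).symm.trans ?_
  rw [← hqt, map_mul, ringRes_ringRes,
    ← ringRes_ringRes (h := (inf_le_right : A ⊓ W ≤ W)) (h' := h), ht, map_zero, map_zero,
    mul_zero, map_zero]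

lemma HasValue.unique {V : X.Opens} {t t' : (rationalSheaf X.toSheafedSpace).obj.obj (op V)}
    {f : X.functionField} (ht : HasValue t f) (ht' : HasValue t' f) : t = t' := by
  obtain ⟨W, hW, hne, p, q, hq, hqt, hpq⟩ := ht
  have hWne : (W : Set X).Nonempty := Set.nonempty_coe_sort.1 hne
  obtain ⟨W', hW', hne', p', q', hq', hqt', hpq'⟩ :=
    ht'.res hW hWne
  have hne'' : (W' : Set X).Nonempty := Set.nonempty_coe_sort.1 hne'
  refine ratRes_injective (hW'.trans hW) hne'' ?_
  rw [ringRes_ringRes] at hqt'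
  have e1 : toRat X.toSheafedSpace W' (ringRes X.presheaf hW' q) *
      ratRes X.toSheafedSpace (hW'.trans hW) t = toRat _ _ (ringRes X.presheaf hW' p) := by
    refine ((congrArg₂ _ (ratRes_toRat _ _).symm (ringRes_ringRes _ _ _ _).symm).trans
      (map_mul _ _ _).symm).trans ((congrArg _ hqt).trans (ratRes_toRat _ _))
  have hq0 : ringRes X.presheaf hW' q ≠ 0 := fun h0 => hq
    (ringRes_injective hW' hne'' (h0.trans (map_zero _).symm))
  -- Both fractions have the value `f`, so they agree after cross-multiplication in the function
  -- field, into which sections embed.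
  have e2 : ringRes X.presheaf hW' p * q' = p' * ringRes X.presheaf hW' q := by
    refine Scheme.germToFunctionField_injective X W' ?_
    rw [map_mul, map_mul, hpq', germToFunctionField_ringRes, germToFunctionField_ringRes, hpq]
    ring
  have u1 := isUnit_toRat (mem_regularSections hq0)
  have u2 := isUnit_toRat (mem_regularSections hq')
  refine (u1.mul u2).mul_left_cancel ?_
  have e3 := congrArg (toRat X.toSheafedSpace W') e2
  rw [map_mul, map_mul, ← e1, ← hqt'] at e3
  linear_combination e3

lemma exists_hasValue {V : X.Opens} (hV : (V : Set X).Nonempty)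
    (t : (rationalSheaf X.toSheafedSpace).obj.obj (op V)) : ∃ f, HasValue t f := by
  obtain ⟨x, hx⟩ := hV
  obtain ⟨A, hA, p, q, hxA, hq, hqt⟩ := exists_fraction t hx
  have hne : Nonempty A := ⟨⟨x, hxA⟩⟩
  have hq0 : q ≠ 0 := by
    have := nonZeroDivisors.ne_zero (hq A (𝟙 A))
    rwa [op_id, X.toSheafedSpace.presheaf.map_id] at this
  refine ⟨X.germToFunctionField A p / X.germToFunctionField A q, A, hA, hne, p, q, hq0, hqt, ?_⟩
  refine (div_mul_cancel₀ _ fun h0 => hq0 ?_).symm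
  exact Scheme.germToFunctionField_injective X A (h0.trans (map_zero _).symm)

lemma exists_hasValue_of_isAffineOpen {V : X.Opens} (hV : IsAffineOpen V)
    (hne : (V : Set X).Nonempty) (f : X.functionField) :
    ∃ t : (rationalSheaf X.toSheafedSpace).obj.obj (op V), HasValue t f := by
  have hne' : Nonempty V := hne.to_subtype
  have := functionField_isFractionRing_of_isAffineOpen X V hV
  obtain ⟨p, q, hq, rfl⟩ := IsFractionRing.div_surjective (A := Γ(X, V)) f
  have hq0 := nonZeroDivisors.ne_zero hq
  obtain ⟨v, hv⟩ := isUnit_toRat (mem_regularSections hq0)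
  refine ⟨↑v⁻¹ * toRat X.toSheafedSpace V p, V, le_rfl, hne', p, q, hq0, ?_, ?_⟩
  · rw [ringRes_self, ← mul_assoc, ← hv, Units.mul_inv, one_mul]
  · exact (div_mul_cancel₀ _ fun h0 => hq0
      (Scheme.germToFunctionField_injective X V (h0.trans (map_zero _).symm))).symm

/-- Over an affine open set `f` is a fraction of sections. Two such representatives have the same
value on overlaps, so `HasValue.unique` lets them glue. -/
lemma exists_hasValue_of_nonempty {V : X.Opens} (hne : (V : Set X).Nonempty)
    (f : X.functionField) :
    ∃ t : (rationalSheaf X.toSheafedSpace).obj.obj (op V), HasValue t f := by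
  have key : ∀ x : V, ∃ A : X.Opens, IsAffineOpen A ∧ x.1 ∈ A ∧ A ≤ V := fun x => by
    obtain ⟨_, ⟨A, hA, rfl⟩, hxA, hAV⟩ := X.isBasis_affineOpens.exists_subset_of_mem_open
      x.2 V.isOpen
    exact ⟨A, hA, hxA, hAV⟩
  choose A hA hxA hAV using key
  choose t ht using fun x => exists_hasValue_of_isAffineOpen (hA x) ⟨_, hxA x⟩ f
  obtain ⟨s, hs⟩ := exists_ringRes_glue (rationalSheaf X.toSheafedSpace).property A hAV
    (fun x hx => Opens.mem_iSup.2 ⟨⟨x, hx⟩, hxA _⟩) t fun x y => by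
      have hi := nonempty_inf ⟨_, hxA x⟩ ⟨_, hxA y⟩
      exact ((ht x).res inf_le_left hi).unique ((ht y).res inf_le_right hi)
  obtain ⟨x, hx⟩ := hne
  refine ⟨s, HasValue.of_res (hAV ⟨x, hx⟩) ?_⟩
  have := ht ⟨x, hx⟩
  rwa [← hs] at this

/-- The sheaf of rational functions of an integral scheme is constant. -/
lemma ratRes_bijective {V W : X.Opens} (h : W ≤ V)
    (hW : (V : Set X).Nonempty → (W : Set X).Nonempty) :
    Function.Bijective (ratRes X.toSheafedSpace h) := by
  by_cases hV : (V : Set X).Nonempty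
  · refine ⟨ratRes_injective h (hW hV), fun t => ?_⟩
    obtain ⟨f, hf⟩ := exists_hasValue (hW hV) t
    obtain ⟨s, hs⟩ := exists_hasValue_of_nonempty hV f
    exact ⟨s, (hs.res h (hW hV)).unique hf⟩
  · have hV0 : V = ⊥ := Opens.coe_eq_empty.1 (Set.not_nonempty_iff_eq_empty.1 hV)
    have h1 := subsingleton_of_eq_bot (Z := X.toSheafedSpace) hV0
      (rationalSheaf X.toSheafedSpace).property
    have h2 := subsingleton_of_eq_bot (Z := X.toSheafedSpace) (le_bot_iff.1 (h.trans hV0.le))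
      (rationalSheaf X.toSheafedSpace).property
    exact ⟨fun _ _ _ => Subsingleton.elim _ _, fun t => ⟨0, Subsingleton.elim _ _⟩⟩

/-- Restriction to a small open set `A` is bijective, and there `q t = p` with `p` and `q` nonzero,
hence units among the rational functions. In particular `K(X)` is a field. -/
lemma isUnit_of_ne_zero {V : X.Opens} {t : (rationalSheaf X.toSheafedSpace).obj.obj (op V)}
    (ht : t ≠ 0) : IsUnit t := by
  have hV : (V : Set X).Nonempty := by
    by_contra hV
    have := subsingleton_of_eq_bot (Z := X.toSheafedSpace)
      (Opens.coe_eq_empty.1 (Set.not_nonempty_iff_eq_empty.1 hV))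
      (rationalSheaf X.toSheafedSpace).property
    exact ht (Subsingleton.elim _ _)
  obtain ⟨x, hx⟩ := hV
  obtain ⟨A, hA, p, q, hxA, hq, hqt⟩ := exists_fraction t hx
  let e := RingEquiv.ofBijective (ratRes X.toSheafedSpace hA)
    (ratRes_bijective hA fun _ => ⟨x, hxA⟩)
  have hp : p ≠ 0 := by
    rintro rfl
    rw [map_zero] at hqt
    refine ht (e.injective ?_)
    rw [map_zero]
    exact (isUnit_toRat hq).mul_right_eq_zero.1 hqt
  have h1 : IsUnit (e t) := by
    refine isUnit_of_mul_isUnit_right (x := toRat X.toSheafedSpace A q) ?_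
    change IsUnit (_ * ratRes X.toSheafedSpace hA t)
    rw [hqt]
    exact isUnit_toRat (mem_regularSections hp)
  exact (MulEquiv.isUnit_map e).1 h1

instance [Nonempty X] : Nontrivial (RationalFunctions X.toSheafedSpace) := by
  have : Nontrivial (X.toSheafedSpace.presheaf.obj (op ⊤)) :=
    inferInstanceAs (Nontrivial Γ(X, ⊤))
  exact (toRat_injective (Z := X.toSheafedSpace) ⊤).nontrivial

end Integral

end FormalGeometry

end

noncomputable section

namespace FormalGeometry

/-! ### Extension of functions over closed subsets of codimension two -/

/-! ### Denominator ideals, depth and dimension. -/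

section Algebra

open scoped Pointwise

/-- A fraction which is multiplied into `R` by exactly the elements of a prime ideal that contains
the denominators of a given fraction. -/
lemma exists_prime_of_not_mem_range {R F : Type*} [CommRing R] [IsNoetherianRing R] [Field F]
    [Algebra R F] (f : F) (hf : f ∉ Set.range (algebraMap R F)) :
    ∃ (P : Ideal R) (_ : P.IsPrime) (φ : F),
      (∀ s : R, algebraMap R F s * f ∈ Set.range (algebraMap R F) → s ∈ P) ∧
        ∀ s : R, s ∈ P ↔ algebraMap R F s * φ ∈ Set.range (algebraMap R F) := by
  let N : Submodule R F := LinearMap.range (Algebra.linearMap R F)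
  have hmem : ∀ (s : R) (g : F), s ∈ (⊥ : Submodule R (F ⧸ N)).colon {N.mkQ g} ↔
      algebraMap R F s * g ∈ Set.range (algebraMap R F) := by
    intro s g
    rw [Submodule.mem_colon_singleton, Submodule.mem_bot, ← map_smul, Submodule.mkQ_apply,
      Submodule.Quotient.mk_eq_zero, Algebra.smul_def]
    rfl
  have hf0 : N.mkQ f ≠ 0 := by
    rw [Submodule.mkQ_apply, ne_eq, Submodule.Quotient.mk_eq_zero]
    exact hf
  -- The denominators of `f` form the annihilator of its class in `F / R`. Over a Noetherian ring
  -- this lies in an associated prime `P` of `F / R`, and `φ` lifts an element with annihilator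
  -- exactly `P`.
  obtain ⟨P, hP, hle⟩ := exists_le_isAssociatedPrime_of_isNoetherianRing R _ hf0
  obtain ⟨hPp, x, hx⟩ := isAssociatedPrime_iff.1 hP
  obtain ⟨φ, rfl⟩ := N.mkQ_surjective x
  exact ⟨P, hPp, φ, fun s hs => hle ((hmem s f).2 hs), fun s => by rw [hx, hmem]⟩

variable {A F : Type*} [CommRing A] [IsLocalRing A] [Field F] [Algebra A F]
  [IsFractionRing A F]

/-- If `a, b` began a regular sequence, put `x = aφ` and `y = bφ` in `A`. From `bx = ay` and the
regularity of `b` modulo `a` one gets `x ∈ aA`, hence `φ = x / a ∈ A`, a contradiction. -/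
lemma depth_le_one {φ : F} (hφ : φ ∉ Set.range (algebraMap A F))
    (hm : ∀ a ∈ IsLocalRing.maximalIdeal A, algebraMap A F a * φ ∈ Set.range (algebraMap A F)) :
    depth A ≤ 1 := by
  refine iSup₂_le fun rs hrs => ?_
  obtain ⟨hreg, hrm⟩ := hrs
  match rs with
  | [] => simp
  | [a] => simp
  | a :: b :: rs =>
    exfalso
    rw [RingTheory.Sequence.isRegular_cons_iff, RingTheory.Sequence.isRegular_cons_iff] at hreg
    obtain ⟨ha, hb, -⟩ := hreg
    obtain ⟨x, hx⟩ := hm a (hrm a (by simp))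
    obtain ⟨y, hy⟩ := hm b (hrm b (by simp))
    have ha0 : a ≠ 0 := by
      rintro rfl
      exact one_ne_zero (ha (show (0 : A) • (1 : A) = 0 • 0 by simp))
    have hxy : b * x = a * y := by
      refine IsFractionRing.injective A F ?_
      rw [map_mul, map_mul, hx, hy]
      ring
    have hx0 : Submodule.Quotient.mk (p := a • (⊤ : Submodule A A)) x = 0 := by
      refine hb ?_
      change b • Submodule.Quotient.mk (p := a • (⊤ : Submodule A A)) x = b • 0
      rw [smul_zero, ← Submodule.Quotient.mk_smul, Submodule.Quotient.mk_eq_zero, smul_eq_mul, hxy]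
      exact Submodule.smul_mem_pointwise_smul y a ⊤ trivial
    rw [Submodule.Quotient.mk_eq_zero] at hx0
    obtain ⟨w, -, hw⟩ := hx0
    refine hφ ⟨w, ?_⟩
    have haF : algebraMap A F a ≠ 0 := fun h0 => ha0
      (IsFractionRing.injective A F (h0.trans (map_zero _).symm))
    refine mul_left_cancel₀ haF ?_
    rw [← hx, ← map_mul]
    exact congrArg _ hw

/-- Depth at most one together with the `S_2` inequality bounds the dimension by one. Dimension zero
is impossible: the domain `A` would be a field, equal to `F`, and would contain `φ`. -/
lemma ringKrullDim_eq_one_of_depth [IsDomain A] {φ : F} (hφ : φ ∉ Set.range (algebraMap A F))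
    (hm : ∀ a ∈ IsLocalRing.maximalIdeal A, algebraMap A F a * φ ∈ Set.range (algebraMap A F))
    (hS : min ((2 : ℕ) : WithBot ℕ∞) (ringKrullDim A) ≤ (depth A : WithBot ℕ∞)) :
    ringKrullDim A = 1 := by
  have h1 : min ((2 : ℕ) : WithBot ℕ∞) (ringKrullDim A) ≤ 1 :=
    hS.trans (WithBot.coe_le_coe.2 (depth_le_one hφ hm))
  have h2 : ringKrullDim A ≤ 1 := by
    rcases min_le_iff.1 h1 with h | h
    · exact absurd h (by decide)
    · exact h
  have h3 : ¬ ringKrullDim A ≤ 0 := by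
    refine fun h0 => hφ ?_
    have : Ring.KrullDimLE 0 A := Ring.krullDimLE_iff.2 h0
    exact (IsFractionRing.surjective_iff_isField (R := A) (K := F)).2
      Ring.KrullDimLE.isField_of_isDomain φ
  exact le_antisymm h2 (Order.succ_le_of_lt (lt_of_not_ge h3))

end Algebra

/-! ### Extension of functions that are regular in codimension one. -/

section Hartogs

variable {X : Scheme.{u}} [IsIntegral X]

/-- The rational function `t` is regular at the point `x`. -/
def IsRegularAt {V : X.Opens} (t : (rationalSheaf X.toSheafedSpace).obj.obj (op V)) (x : X) :
    Prop :=
  ∃ (W : X.Opens) (h : W ≤ V), x ∈ W ∧ ∃ c : Γ(X, W),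
    ratRes X.toSheafedSpace h t = toRat X.toSheafedSpace W c

lemma hasValue_toRat {V : X.Opens} [Nonempty V] (c : Γ(X, V)) :
    HasValue (toRat X.toSheafedSpace V c) (X.germToFunctionField V c) :=
  ⟨V, le_rfl, inferInstance, c, 1, one_ne_zero, by
    rw [map_one, one_mul, ringRes_self], by rw [map_one, mul_one]⟩

lemma HasValue.unique_value {V : X.Opens} {t : (rationalSheaf X.toSheafedSpace).obj.obj (op V)}
    {f f' : X.functionField} (h : HasValue t f) (h' : HasValue t f') : f = f' := by
  obtain ⟨W, hW, hne, p, q, hq, hqt, hpq⟩ := h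
  have hWne : (W : Set X).Nonempty := Set.nonempty_coe_sort.1 hne
  obtain ⟨W', hW', hne', p', q', hq', hqt', hpq'⟩ := h'.res hW hWne
  have hne'' : (W' : Set X).Nonempty := Set.nonempty_coe_sort.1 hne'
  rw [ringRes_ringRes] at hqt'
  have e1 : toRat X.toSheafedSpace W' (ringRes X.presheaf hW' q) *
      ratRes X.toSheafedSpace (hW'.trans hW) t = toRat _ _ (ringRes X.presheaf hW' p) := by
    refine ((congrArg₂ _ (ratRes_toRat _ _).symm (ringRes_ringRes _ _ _ _).symm).trans
      (map_mul _ _ _).symm).trans ((congrArg _ hqt).trans (ratRes_toRat _ _))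
  have e2 : ringRes X.presheaf hW' p * q' = p' * ringRes X.presheaf hW' q := by
    refine toRat_injective (Z := X.toSheafedSpace) W' ?_
    refine (map_mul _ _ _).trans (Eq.trans ?_ (map_mul _ _ _).symm)
    rw [← e1, ← hqt']
    ring
  have e3 := congrArg (X.germToFunctionField W') e2
  rw [map_mul, map_mul, hpq', germToFunctionField_ringRes, germToFunctionField_ringRes, hpq] at e3
  have h0 : ∀ {V : X.Opens} [Nonempty V] {q : Γ(X, V)}, q ≠ 0 → X.germToFunctionField V q ≠ 0 :=
    fun hq h0 => hq (Scheme.germToFunctionField_injective X _ (h0.trans (map_zero _).symm))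
  refine mul_right_cancel₀ (mul_ne_zero (h0 hq) (h0 hq')) ?_
  linear_combination e3

/-- A non-regular `f` has its denominators in an associated prime `P` of the function field modulo
`Γ(X, V)`. At the point `x` of `P` the depth is at most one, so `S_2` forces codimension one; but
then regularity of `f` at `x` provides a denominator outside `P`. -/
lemma exists_toRat_eq_of_isRegularAt [IsLocallyNoetherian X] (hS2 : SatisfiesSerre 2 X)
    {V : X.Opens} (hV : IsAffineOpen V)
    (t : (rationalSheaf X.toSheafedSpace).obj.obj (op V))
    (ht : ∀ x ∈ V, ringKrullDim (X.presheaf.stalk x) = 1 → IsRegularAt t x) :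
    ∃ c : Γ(X, V), t = toRat X.toSheafedSpace V c := by
  by_cases hne : (V : Set X).Nonempty
  swap
  · have := subsingleton_of_eq_bot (Z := X.toSheafedSpace)
      (Opens.coe_eq_empty.1 (Set.not_nonempty_iff_eq_empty.1 hne))
      (rationalSheaf X.toSheafedSpace).property
    exact ⟨0, Subsingleton.elim _ _⟩
  have hne' : Nonempty V := hne.to_subtype
  have : IsNoetherianRing Γ(X, V) := IsLocallyNoetherian.component_noetherian ⟨V, hV⟩
  have := functionField_isFractionRing_of_isAffineOpen X V hV
  obtain ⟨f, hf⟩ := exists_hasValue hne t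
  by_cases hfr : f ∈ Set.range (algebraMap Γ(X, V) X.functionField)
  · obtain ⟨c, rfl⟩ := hfr
    exact ⟨c, hf.unique (hasValue_toRat c)⟩
  exfalso
  obtain ⟨P, hP, φ, hfP, hφP⟩ := exists_prime_of_not_mem_range f hfr
  let x : X := hV.fromSpec ⟨P, hP⟩
  have hxV : x ∈ V := (hV.isoSpec.inv ⟨P, hP⟩).2
  let _ : Algebra Γ(X, V) (X.presheaf.stalk x) :=
    TopCat.Presheaf.algebra_section_stalk X.presheaf ⟨x, hxV⟩
  have hloc : IsLocalization.AtPrime (X.presheaf.stalk x) P := hV.isLocalization_stalk' ⟨P, hP⟩ hxV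
  have htower : IsScalarTower Γ(X, V) (X.presheaf.stalk x) X.functionField :=
    functionField_isScalarTower X V ⟨x, hxV⟩
  -- A fraction that lies in the localization at `P` has a denominator outside `P`. This is applied
  -- to `φ`, to bound the depth, and to `f`, for the final contradiction.
  have hnot : ∀ g : X.functionField,
      (∀ s : Γ(X, V), algebraMap _ X.functionField s * g ∈
        Set.range (algebraMap Γ(X, V) X.functionField) → s ∈ P) →
      g ∉ Set.range (algebraMap (X.presheaf.stalk x) X.functionField) := by
    rintro _ hg ⟨a, rfl⟩
    obtain ⟨⟨r, s⟩, hrs⟩ := IsLocalization.surj P.primeCompl a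
    refine s.2 (hg s.1 ⟨r, ?_⟩)
    rw [IsScalarTower.algebraMap_apply Γ(X, V) (X.presheaf.stalk x), ← hrs, map_mul,
      ← IsScalarTower.algebraMap_apply Γ(X, V) (X.presheaf.stalk x), mul_comm]
  have hφ : φ ∉ Set.range (algebraMap (X.presheaf.stalk x) X.functionField) :=
    hnot φ fun s hs => (hφP s).2 hs
  -- That `P` multiplies `φ` into `Γ(X, V)` passes to the localization, where `P` generates the
  -- maximal ideal.
  have hm : ∀ a ∈ IsLocalRing.maximalIdeal (X.presheaf.stalk x),
      algebraMap _ X.functionField a * φ ∈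
        Set.range (algebraMap (X.presheaf.stalk x) X.functionField) := by
    intro a ha
    obtain ⟨r, s, rfl⟩ := IsLocalization.exists_mk'_eq P.primeCompl a
    have hr : r ∈ P := (IsLocalization.AtPrime.mk'_mem_maximal_iff _ P r s).1 ha
    obtain ⟨c, hc⟩ := (hφP r).1 hr
    refine ⟨IsLocalization.mk' _ c s, ?_⟩
    have hs0 : algebraMap Γ(X, V) X.functionField s.1 ≠ 0 := by
      intro h0
      have : s.1 = 0 := IsFractionRing.injective Γ(X, V) X.functionField (h0.trans (map_zero _).symm)
      exact s.2 (this ▸ P.zero_mem)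
    have hmk : ∀ d : Γ(X, V), algebraMap _ X.functionField
        (IsLocalization.mk' (X.presheaf.stalk x) d s) * algebraMap Γ(X, V) X.functionField s.1 =
          algebraMap Γ(X, V) X.functionField d := by
      intro d
      rw [IsScalarTower.algebraMap_apply Γ(X, V) (X.presheaf.stalk x) X.functionField s.1,
        ← map_mul, IsLocalization.mk'_spec, ← IsScalarTower.algebraMap_apply]
    refine mul_right_cancel₀ hs0 ?_
    rw [hmk, hc, ← hmk r]
    ring
  have hdim := ringKrullDim_eq_one_of_depth hφ hm (hS2 x)
  obtain ⟨W, hW, hxW, c, hc⟩ := ht x hxV hdim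
  have hWne : Nonempty W := ⟨⟨x, hxW⟩⟩
  have hfc : f = X.germToFunctionField W c := by
    refine HasValue.unique_value (hf.res hW ⟨x, hxW⟩) ?_
    rw [hc]
    exact hasValue_toRat c
  refine hnot f hfP ⟨X.presheaf.germ W x hxW c, ?_⟩
  rw [hfc, Scheme.algebraMap_germ_eq_germToFunctionField]

end Hartogs

end FormalGeometry

end

noncomputable section

namespace FormalGeometry

/-! ### Rational functions and formal functions -/

section Pull

variable {Z S : RingedSpace.{u, u}} {f : Z ⟶ S} (hf : PreservesRegular f)

/-- The homomorphism `ℳ_S(V) → ℳ_Z(f⁻¹ V)`. -/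
def pullRat (V : Opens S) :
    (rationalSheaf S).obj.obj (op V) →+* (rationalSheaf Z).obj.obj (op (preimageOpen f V)) :=
  ((rationalSheafMap hf).app (op V)).hom

lemma pullRat_toRat (V : Opens S) (s : S.presheaf.obj (op V)) :
    pullRat hf V (toRat S V s) = toRat Z _ (pullRing f V s) :=
  ConcreteCategory.congr_hom (congr($(structure_rationalSheafMap hf).app (op V))) s

lemma pullRat_ratRes {V V' : Opens S} (h : V' ≤ V) (t : (rationalSheaf S).obj.obj (op V))
    (h' : preimageOpen f V' ≤ preimageOpen f V) :
    pullRat hf V' (ratRes S h t) = ratRes Z h' (pullRat hf V t) :=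
  ConcreteCategory.congr_hom ((rationalSheafMap hf).naturality (homOfLE h).op) t

end Pull

/-! ### Regularity of rational functions along `Y`. -/

section Regular

variable {X : Scheme.{u}}

lemma exists_affineOpen_le {V : X.Opens} {x : X} (hx : x ∈ V) :
    ∃ A : X.Opens, IsAffineOpen A ∧ x ∈ A ∧ A ≤ V := by
  obtain ⟨_, ⟨A, hA, rfl⟩, hxA, hAV⟩ := X.isBasis_affineOpens.exists_subset_of_mem_open hx V.isOpen
  exact ⟨A, hA, hxA, hAV⟩

variable (Y : Closeds X)

/-- Open subsets of the formal completion are cut out by open subsets of the scheme. -/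
lemma exists_open_preimage_le {W : Opens (completion Y)} {y : Y} (hy : y ∈ W) {V : X.Opens}
    (hyV : y.1 ∈ V) :
    ∃ V' : X.Opens, V' ≤ V ∧ y.1 ∈ V' ∧ preimageOpen (completionι Y) V' ≤ W := by
  obtain ⟨O, hO, hOW⟩ := isOpen_induced_iff.1 W.isOpen
  have hyO : y ∈ Subtype.val ⁻¹' O := hOW ▸ hy
  exact ⟨⟨O, hO⟩ ⊓ V, inf_le_right, ⟨hyO, hyV⟩, fun z hz => (Set.ext_iff.1 hOW z).1 hz.1⟩

/-- If a quotient of functions is a formal function, then the denominator divides the numerator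
up to an element which is invertible along the closed subset. -/
lemma exists_mul_mem_span [IsLocallyNoetherian X] {A : X.Opens} (hA : IsAffineOpen A) {y : Y} (hy : y.1 ∈ A) (p q : Γ(X, A))
    (h : completionSections Y ((Opens.map (incl Y)).obj A))
    (hpq : toCompletion Y A q * h = toCompletion Y A p) :
    ∃ s c : Γ(X, A), y.1 ∈ X.basicOpen s ∧ s * p = q * c := by
  have : IsNoetherianRing Γ(X, A) := IsLocallyNoetherian.component_noetherian ⟨A, hA⟩
  set I := (Scheme.IdealSheafData.vanishingIdeal Y).ideal ⟨A, hA⟩ with hI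
  -- Lifting the `n`-th component of `h` to a function `c` on the affine set `A` turns the formal
  -- equation `q h = p` into a congruence modulo `I ^ (n + 1)`.
  have key : ∀ n, ∃ c, p - q * c ∈ I ^ (n + 1) := by
    intro n
    obtain ⟨c, hc⟩ := toThickening_surjective Y n ⟨A, hA⟩ (h.1 n)
    refine ⟨c, (toThickening_eq_zero Y n ⟨A, hA⟩ _).1 ?_⟩
    have h1 : (toCompletion Y A q).1 n * h.1 n = (toCompletion Y A p).1 n :=
      congrFun (congrArg Subtype.val hpq) n
    rw [toCompletion_coe, toCompletion_coe] at h1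
    rw [map_sub, map_mul, hc, h1, sub_self]
  let N : Submodule Γ(X, A) Γ(X, A) := Ideal.span {q}
  have hmem : N.mkQ p ∈ (⨅ i : ℕ, I ^ i • ⊤ : Submodule Γ(X, A) (Γ(X, A) ⧸ N)) := by
    rw [Submodule.mem_iInf]
    intro i
    obtain ⟨c, hc⟩ := key i
    have h1 : N.mkQ p = N.mkQ (p - q * c) := by
      rw [map_sub, eq_comm, sub_eq_self, Submodule.mkQ_apply, Submodule.Quotient.mk_eq_zero]
      exact Ideal.mul_mem_right _ _ (Ideal.mem_span_singleton_self q)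
    have h2 : N.mkQ (p - q * c) = (p - q * c) • N.mkQ 1 := by
      rw [← map_smul, smul_eq_mul, mul_one]
    rw [h1, h2]
    exact Submodule.smul_mem_smul (Ideal.pow_le_pow_right (Nat.le_succ i) hc) trivial
  -- Krull's intersection theorem for `Γ(X, A) / (q)`: the class of `p` lies in every `I ^ i`
  -- multiple of the module, so some `r ∈ I` fixes it. The multiplier is `s = 1 - r`, a unit at `y`
  -- because `r` vanishes on `Y`.
  obtain ⟨r, hr⟩ := (I.mem_iInf_smul_pow_eq_bot_iff _).1 hmem
  have h0 : N.mkQ ((1 - r.1) * p) = 0 := by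
    rw [sub_mul, one_mul, map_sub, ← smul_eq_mul, map_smul, hr, sub_self]
  rw [Submodule.mkQ_apply, Submodule.Quotient.mk_eq_zero] at h0
  obtain ⟨c, hc⟩ := Ideal.mem_span_singleton.1 h0
  refine ⟨1 - r.1, c, ?_, hc⟩
  have hys : y.1 ∈ (Scheme.IdealSheafData.vanishingIdeal Y).support := by
    have := Scheme.IdealSheafData.coe_support_vanishingIdeal (X := X) (Z := Y)
    exact (Set.ext_iff.1 this y.1).2 y.2
  have hyr := (X.mem_zeroLocus_iff _ _).1
    ((Scheme.IdealSheafData.mem_support_iff_of_mem (U := ⟨A, hA⟩) hy).1 hys) r.1 r.2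
  rw [X.mem_basicOpen _ _ hy] at hyr ⊢
  rw [map_sub, map_one]
  exact IsLocalRing.isUnit_one_sub_self_of_mem_nonunits _ hyr

/-- Write `t = p / q` near `y`. If `t` becomes a formal function, then `s p = q c` with `s`
invertible at `y`, by `exists_mul_mem_span`; hence `t = c / s` on the basic open set of `s`. -/
lemma isRegularAt_of_pullRat [IsIntegral X] [IsLocallyNoetherian X] {V : X.Opens}
    (t : (rationalSheaf X.toSheafedSpace).obj.obj (op V))
    {W : Opens (completion Y)} (hW : W ≤ preimageOpen (completionι Y) V)
    (h : (completion Y).presheaf.obj (op W)) {y : Y} (hy : y ∈ W)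
    (ht : ratRes (completion Y) hW (pullRat (completionι_preservesRegular Y) V t) =
      toRat (completion Y) W h) : IsRegularAt t y.1 := by
  obtain ⟨W₀, hW₀, p, q, hyW₀, hq, hqt⟩ := exists_fraction t (show y.1 ∈ V from hW hy)
  obtain ⟨V', hV', hyV', hV'W⟩ := exists_open_preimage_le Y hy hyW₀
  obtain ⟨A, hA, hyA, hAV'⟩ := exists_affineOpen_le hyV'
  have hAW₀ : A ≤ W₀ := hAV'.trans hV'
  have hAW : preimageOpen (completionι Y) A ≤ W := fun z hz => hV'W (hAV' hz)
  have hqA := regularSections_map X.toSheafedSpace (homOfLE hAW₀) hq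
  have hqt' : toRat X.toSheafedSpace A (ringRes X.presheaf hAW₀ q) *
      ratRes X.toSheafedSpace (hAW₀.trans hW₀) t = toRat _ A (ringRes X.presheaf hAW₀ p) :=
    ((congrArg₂ _ (ratRes_toRat _ _).symm (ringRes_ringRes _ _ _ _).symm).trans
      (map_mul _ _ _).symm).trans ((congrArg _ hqt).trans (ratRes_toRat _ _))
  have h1 := congrArg (pullRat (completionι_preservesRegular Y) A) hqt'
  rw [map_mul, pullRat_toRat, pullRat_toRat, pullRat_ratRes _ _ _ (hAW.trans hW),
    ← ringRes_ringRes (h := hAW) (h' := hW), ht, ratRes_toRat, ← map_mul] at h1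
  obtain ⟨s, c, hys, hsc⟩ := exists_mul_mem_span Y hA hyA _ _ _ (toRat_injective _ h1)
  have hBA : X.basicOpen s ≤ A := X.basicOpen_le s
  obtain ⟨v, hv⟩ : IsUnit (ringRes X.presheaf hBA s) := X.toRingedSpace.isUnit_res_basicOpen s
  refine ⟨X.basicOpen s, hBA.trans (hAW₀.trans hW₀), hys,
    ↑v⁻¹ * ringRes X.presheaf hBA c, ?_⟩
  have h2 : toRat X.toSheafedSpace A s * ratRes X.toSheafedSpace (hAW₀.trans hW₀) t =
      toRat X.toSheafedSpace A c := by
    refine (isUnit_toRat hqA).mul_left_cancel ?_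
    have h3 := congrArg (toRat X.toSheafedSpace A) hsc
    have h4 := (map_mul (toRat X.toSheafedSpace A) s _).symm.trans
      (h3.trans (map_mul (toRat X.toSheafedSpace A) _ c))
    refine Eq.trans ?_ h4
    rw [← hqt']
    exact mul_left_comm _ _ _
  have h5 := congrArg (ratRes X.toSheafedSpace hBA) h2
  rw [map_mul, ratRes_toRat, ratRes_toRat, ringRes_ringRes] at h5
  have h6 : IsUnit (toRat X.toSheafedSpace (X.basicOpen s) v.1) := v.isUnit.map _
  refine h6.mul_left_cancel ?_
  have h7 : (v.1 : Γ(X, X.basicOpen s)) * (↑v⁻¹ * ringRes X.presheaf hBA c) =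
    ringRes X.presheaf hBA c := by rw [← mul_assoc, Units.mul_inv, one_mul]
  rw [← hv] at h5
  refine h5.trans ((congrArg (toRat X.toSheafedSpace (X.basicOpen s)) h7).symm.trans
    (map_mul (toRat X.toSheafedSpace (X.basicOpen s)) _ _))

end Regular

end FormalGeometry

end

noncomputable section

namespace FormalGeometry

/-! ### Embeddings into the sheaf of rational functions -/

section Generic

variable {X : Scheme.{u}} [IsIntegral X]

/-- The extension of rational functions from a dense open subset. -/
def genExt {V W : X.Opens} (h : W ≤ V) (hW : (V : Set X).Nonempty → (W : Set X).Nonempty) :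
    (rationalSheaf X.toSheafedSpace).obj.obj (op W) ≃+*
      (rationalSheaf X.toSheafedSpace).obj.obj (op V) :=
  (RingEquiv.ofBijective (ratRes X.toSheafedSpace h) (ratRes_bijective h hW)).symm

lemma ratRes_genExt {V W : X.Opens} (h : W ≤ V)
    (hW : (V : Set X).Nonempty → (W : Set X).Nonempty)
    (t : (rationalSheaf X.toSheafedSpace).obj.obj (op W)) :
    ratRes X.toSheafedSpace h (genExt h hW t) = t :=
  (RingEquiv.ofBijective (ratRes X.toSheafedSpace h) (ratRes_bijective h hW)).apply_symm_apply t

lemma genExt_eq_iff {V W : X.Opens} (h : W ≤ V)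
    (hW : (V : Set X).Nonempty → (W : Set X).Nonempty)
    (t : (rationalSheaf X.toSheafedSpace).obj.obj (op W))
    (s : (rationalSheaf X.toSheafedSpace).obj.obj (op V)) :
    genExt h hW t = s ↔ t = ratRes X.toSheafedSpace h s :=
  RingEquiv.symm_apply_eq _

lemma nonempty_inf_of_nonempty {V₀ : X.Opens} (h₀ : (V₀ : Set X).Nonempty) (W : X.Opens)
    (hW : (W : Set X).Nonempty) : ((W ⊓ V₀ : X.Opens) : Set X).Nonempty :=
  nonempty_inf hW h₀

variable {M : Mod X.toSheafedSpace} {V₀ : X.Opens} {n : ℕ} {b : Fin n → sections M V₀}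

/-- The coordinate functions of a frame, as rational functions. -/
def rationalCoord (hb : IsFrame M V₀ b) (h₀ : (V₀ : Set X).Nonempty) (k : Fin n) :
    M ⟶ rationalModule X.toSheafedSpace :=
  hb.functional k
    (fun W => ((genExt inf_le_left (nonempty_inf_of_nonempty h₀ W)).toRingHom.comp
      (toRat X.toSheafedSpace (W ⊓ V₀))).toAddMonoidHom)
    (fun W r c => by
      refine (genExt_eq_iff _ (nonempty_inf_of_nonempty h₀ W) _ _).2 ?_
      refine (map_mul (toRat X.toSheafedSpace (W ⊓ V₀)) _ _).trans ?_
      refine Eq.trans ?_ (map_mul (ratRes X.toSheafedSpace _) _ _).symm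
      exact congrArg₂ _ (ratRes_toRat _ _).symm
        (ratRes_genExt inf_le_left (nonempty_inf_of_nonempty h₀ W) _).symm)
    (fun W W' h c => by
      refine (genExt_eq_iff _ (nonempty_inf_of_nonempty h₀ W') _ _).2 ?_
      refine (ratRes_toRat _ _).symm.trans ?_
      refine Eq.trans ?_ (ringRes_ringRes _ _ _ _).symm
      refine (congrArg (ratRes X.toSheafedSpace (inf_le_inf_right V₀ h))
        (ratRes_genExt inf_le_left (nonempty_inf_of_nonempty h₀ W) _).symm).trans ?_
      exact ringRes_ringRes _ _ _ _)

lemma ratRes_rationalCoord (hb : IsFrame M V₀ b) (h₀ : (V₀ : Set X).Nonempty) (k : Fin n)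
    (W : X.Opens) (s : sections M W) :
    ratRes X.toSheafedSpace (inf_le_left : W ⊓ V₀ ≤ W) (homApp (rationalCoord hb h₀ k) W s) =
      toRat X.toSheafedSpace (W ⊓ V₀) (hb.coord inf_le_right (modRes M inf_le_left s) k) :=
  ratRes_genExt inf_le_left (nonempty_inf_of_nonempty h₀ W) _

/-- Vector bundles on an integral scheme are torsion-free: the coordinates of `s` in a local frame
vanish on a nonempty open set, hence vanish. -/
lemma eq_zero_of_modRes_eq_zero (hM : IsVectorBundle M) {W W' : X.Opens} (h : W' ≤ W)
    (hW' : (W' : Set X).Nonempty) (s : sections M W) (hs : modRes M h s = 0) : s = 0 := by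
  refine modRes_eq_of_locally M fun x hx => ?_
  obtain ⟨V, hxV, n, b, hb⟩ := hM x
  refine ⟨W ⊓ V, inf_le_left, ⟨hx, hxV⟩, ?_⟩
  rw [map_zero, ← hb.sum_coord inf_le_right (modRes M _ s)]
  refine Finset.sum_eq_zero fun i _ => ?_
  have hT : ((W' ⊓ (W ⊓ V) : X.Opens) : Set X).Nonempty := nonempty_inf hW' ⟨x, hx, hxV⟩
  suffices h0 : hb.coord inf_le_right (modRes M (inf_le_left : W ⊓ V ≤ W) s) i = 0 by
    rw [h0, zero_smul]
  refine ringRes_injective (inf_le_right : W' ⊓ (W ⊓ V) ≤ W ⊓ V) hT ?_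
  have h1 := hb.coord_modRes inf_le_right (inf_le_right : W' ⊓ (W ⊓ V) ≤ W ⊓ V)
    (modRes M (inf_le_left : W ⊓ V ≤ W) s) i
  have h2 : modRes M (inf_le_right : W' ⊓ (W ⊓ V) ≤ W ⊓ V)
      (modRes M (inf_le_left : W ⊓ V ≤ W) s) = 0 := by
    rw [modRes_modRes, ← modRes_modRes (h := (inf_le_left : W' ⊓ (W ⊓ V) ≤ W')) (h' := h), hs,
      map_zero]
  rw [h2, map_zero] at h1
  exact h1.symm.trans (map_zero _).symm

lemma rationalCoord_injective {b : sections M V₀} (hM : IsVectorBundle M)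
    (hb : IsFrame M V₀ fun _ : Fin 1 => b) (h₀ : (V₀ : Set X).Nonempty) (W : X.Opens) :
    Function.Injective (homApp (rationalCoord hb h₀ 0) W) := by
  rw [injective_iff_map_eq_zero]
  intro s hs
  by_cases hW : (W : Set X).Nonempty
  · refine eq_zero_of_modRes_eq_zero hM (inf_le_left : W ⊓ V₀ ≤ W) (nonempty_inf hW h₀) s ?_
    have h1 := ratRes_rationalCoord hb h₀ 0 W s
    have h2 := (toRat_injective _ ((congrArg _ hs).symm.trans h1 |>.symm.trans
      ((map_zero (ratRes X.toSheafedSpace _)).trans (map_zero (toRat X.toSheafedSpace _)).symm)))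
    rw [← hb.sum_coord inf_le_right (modRes M inf_le_left s)]
    refine Finset.sum_eq_zero fun i _ => ?_
    rw [Subsingleton.elim i 0, h2, zero_smul]
  · refine modRes_eq_of_locally M fun x hx => (hW ⟨x, hx⟩).elim

end Generic

/-! ### Powers of `L` inside `ℳ_X` and common denominators. -/

section LineBundle

variable {X : Scheme.{u}}

/-- A family of local generators of a line bundle. -/
structure Trivialization (L : Mod X.toSheafedSpace) where
  /-- An open neighbourhood of `x`. -/
  nhd (x : X) : X.Opens
  mem_nhd (x : X) : x ∈ nhd x
  /-- A generator over the neighbourhood. -/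
  gen (x : X) : sections L (nhd x)
  isFrame (x : X) : IsFrame L (nhd x) fun _ : Fin 1 => gen x

lemma exists_trivialization {L : Mod X.toSheafedSpace} (hL : IsLineBundle L) :
    Nonempty (Trivialization L) := by
  choose V hxV b hb using hL
  refine ⟨⟨V, hxV, fun x => b x 0, fun x => ?_⟩⟩
  convert hb x using 2 with i
  rw [Subsingleton.elim i 0]

namespace Trivialization

variable {L : Mod X.toSheafedSpace}

lemma nonempty_nhd (T : Trivialization L) (x : X) : (T.nhd x : Set X).Nonempty := ⟨x, T.mem_nhd x⟩

lemma isVectorBundle_tensorPow (T : Trivialization L) (m : ℕ) : IsVectorBundle (tensorPow L m) :=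
  fun x => ⟨T.nhd x, T.mem_nhd x, 1, _, (T.isFrame x).powSection m⟩

variable (T : Trivialization L)

/-- The quotient of two local generators. -/
def ratio {W : X.Opens} (x : X) (hW : W ≤ T.nhd x) (s : sections L W) : Γ(X, W) :=
  (T.isFrame x).coord hW s 0

lemma ratio_smul {W : X.Opens} (x : X) (hW : W ≤ T.nhd x) (s : sections L W) :
    T.ratio x hW s • modRes L hW (T.gen x) = s := by
  have := (T.isFrame x).sum_coord hW s
  rwa [Finset.univ_unique, Finset.sum_singleton] at this

lemma coord_powSection {V W : X.Opens} {b : sections L V} (hb : IsFrame L V fun _ : Fin 1 => b)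
    (hW : W ≤ V) (r : Γ(X, W)) (m : ℕ) :
    (hb.powSection m).coord hW (FormalGeometry.powSection (r • modRes L hW b) m) 0 = r ^ m := by
  have h1 := (hb.powSection m).coord_sum hW fun _ => r ^ m
  rw [Finset.univ_unique, Finset.sum_singleton, modRes_powSection, ← powSection_smul] at h1
  rw [h1]

variable [IsIntegral X]

/-- The embedding of `L ^ m` into `ℳ_X` defined by the generator at the generic point. -/
def embed (m : ℕ) : tensorPow L m ⟶ rationalModule X.toSheafedSpace :=
  rationalCoord ((T.isFrame (genericPoint X)).powSection m) (T.nonempty_nhd _) 0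

lemma embed_injective (m : ℕ) (W : X.Opens) : Function.Injective (homApp (T.embed m) W) :=
  rationalCoord_injective (T.isVectorBundle_tensorPow m) _ _ W

instance (m : ℕ) : Mono (T.embed m) := mono_of_homApp_injective _ (T.embed_injective m)

/-- The rational function corresponding to the local generator at `x`. -/
def ratGen (x : X) : (rationalSheaf X.toSheafedSpace).obj.obj (op (T.nhd x)) :=
  homApp (rationalCoord (T.isFrame (genericPoint X)) (T.nonempty_nhd _) 0) (T.nhd x) (T.gen x)

/-- The embeddings of all powers are normalized by powers of one and the same generator at the
generic point, so they are multiplicative. The single family `ratGen` thus describes every `L ^ m`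
inside `ℳ_X`. -/
lemma homApp_embed_gen (m : ℕ) (x : X) :
    homApp (T.embed m) (T.nhd x) (FormalGeometry.powSection (T.gen x) m) = T.ratGen x ^ m := by
  refine ratRes_injective (inf_le_left : T.nhd x ⊓ T.nhd (genericPoint X) ≤ _)
    (nonempty_inf (T.nonempty_nhd _) (T.nonempty_nhd _)) ?_
  refine (ratRes_rationalCoord _ _ _ _ _).trans ?_
  rw [modRes_powSection, ← T.ratio_smul (genericPoint X) inf_le_right (modRes L inf_le_left _),
    coord_powSection (T.isFrame (genericPoint X)), map_pow, map_pow]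
  exact congrArg (· ^ m) (ratRes_rationalCoord _ _ _ _ _).symm

lemma ratGen_ne_zero (x : X) : T.ratGen x ≠ 0 := by
  intro h0
  have hv : IsVectorBundle L := fun x => ⟨T.nhd x, T.mem_nhd x, 1, _, T.isFrame x⟩
  have h1 : T.gen x = 0 := rationalCoord_injective hv (T.isFrame _) (T.nonempty_nhd _) _
    (h0.trans (map_zero (homApp (rationalCoord (T.isFrame (genericPoint X))
      (T.nonempty_nhd _) 0) (T.nhd x))).symm)
  have hne : Nonempty (T.nhd x) := (T.nonempty_nhd x).to_subtype
  have h2 := (isFrame_one_iff.1 (T.isFrame x) (T.nhd x) le_rfl).1 (a₁ := 0) (a₂ := 1) (by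
    simp only [h1, map_zero, smul_zero])
  exact zero_ne_one (α := Γ(X, T.nhd x)) h2

lemma ratRes_ratGen (x x' : X) {W : X.Opens} (h : W ≤ T.nhd x) (h' : W ≤ T.nhd x') :
    ratRes X.toSheafedSpace h (T.ratGen x) =
      toRat X.toSheafedSpace W (T.ratio x' h' (modRes L h (T.gen x))) *
        ratRes X.toSheafedSpace h' (T.ratGen x') := by
  set e := rationalCoord (T.isFrame (genericPoint X)) (T.nonempty_nhd _) 0
  refine (homApp_modRes e h (T.gen x)).symm.trans ?_
  conv_lhs => rw [← T.ratio_smul x' h' (modRes L h (T.gen x))]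
  rw [map_smul, homApp_modRes]
  rfl

/-- `f` corresponds to a section of `L ^ m`. -/
def IsSectionLike (m : ℕ) (f : RationalFunctions X.toSheafedSpace) : Prop :=
  ∀ x : X, ∃ c : Γ(X, T.nhd x),
    ratRes X.toSheafedSpace (le_top : T.nhd x ≤ ⊤) f = toRat X.toSheafedSpace _ c * T.ratGen x ^ m

variable {T}

lemma isSectionLike_homApp (m : ℕ) (s : sections (tensorPow L m) ⊤) :
    T.IsSectionLike m (homApp (T.embed m) ⊤ s) := by
  intro x
  refine ⟨((T.isFrame x).powSection m).coord le_rfl (modRes _ le_top s) 0, ?_⟩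
  refine (homApp_modRes (T.embed m) le_top s).symm.trans ?_
  conv_lhs => rw [← ((T.isFrame x).powSection m).sum_coord le_rfl (modRes _ le_top s)]
  rw [Finset.univ_unique, Finset.sum_singleton, map_smul, modRes_self, homApp_embed_gen]
  rfl

/-- Sections of different powers of `L` are multiplied as rational functions; no isomorphism between
`L ^ m ⊗ L ^ m'` and `L ^ (m + m')` has to be constructed. -/
lemma IsSectionLike.mul {m m' : ℕ} {f f' : RationalFunctions X.toSheafedSpace}
    (h : T.IsSectionLike m f) (h' : T.IsSectionLike m' f') :
    T.IsSectionLike (m + m') (f * f') := by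
  intro x
  obtain ⟨c, hc⟩ := h x
  obtain ⟨c', hc'⟩ := h' x
  refine ⟨c * c', ?_⟩
  have h1 : toRat X.toSheafedSpace _ (c * c') =
    toRat X.toSheafedSpace _ c * toRat X.toSheafedSpace _ c' := map_mul _ _ _
  rw [map_mul, hc, hc', h1, pow_add]
  ring

lemma isSectionLike_one : T.IsSectionLike 0 1 := fun x => ⟨1, by
  have h1 : toRat X.toSheafedSpace (T.nhd x) (1 : Γ(X, T.nhd x)) = 1 := map_one _
  rw [map_one, h1, pow_zero, one_mul]⟩

variable (T)

/-- Ratios do not depend on the embedding: near the generic point, `e` and `embed m` differ by the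
factor `g / ratGen ^ m`, which cancels. -/
lemma exists_of_mem_ratios {a : RationalFunctions X.toSheafedSpace} (ha : a ∈ ratios L) :
    ∃ (m : ℕ) (f₀ f₁ : RationalFunctions X.toSheafedSpace), T.IsSectionLike m f₀ ∧
      T.IsSectionLike m f₁ ∧ f₁ ≠ 0 ∧ a * f₁ = f₀ := by
  obtain ⟨m, e, -, s₀, s₁, h1, h2⟩ := ha
  change homApp e ⊤ s₁ ≠ 0 at h1
  change a * (show RationalFunctions X.toSheafedSpace from homApp e ⊤ s₁) = homApp e ⊤ s₀ at h2
  let η := genericPoint X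
  have hinj := ratRes_injective (le_top : T.nhd η ≤ ⊤) (T.nonempty_nhd η)
  set g : (rationalSheaf X.toSheafedSpace).obj.obj (op (T.nhd η)) :=
    homApp e (T.nhd η) (FormalGeometry.powSection (T.gen η) m) with hg
  have key : ∀ s : sections (tensorPow L m) ⊤, ∃ c : Γ(X, T.nhd η),
      ratRes X.toSheafedSpace (le_top : T.nhd η ≤ ⊤) (homApp e ⊤ s) =
          toRat X.toSheafedSpace _ c * g ∧
        ratRes X.toSheafedSpace (le_top : T.nhd η ≤ ⊤) (homApp (T.embed m) ⊤ s) =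
          toRat X.toSheafedSpace _ c * T.ratGen η ^ m := by
    intro s
    have h3 := ((T.isFrame η).powSection m).sum_coord le_rfl (modRes _ le_top s)
    rw [Finset.univ_unique, Finset.sum_singleton, modRes_self] at h3
    refine ⟨((T.isFrame η).powSection m).coord le_rfl (modRes _ le_top s) 0, ?_, ?_⟩
    · refine (homApp_modRes e le_top s).symm.trans ?_
      conv_lhs => rw [← h3]
      rw [map_smul]
      rfl
    · refine (homApp_modRes (T.embed m) le_top s).symm.trans ?_
      conv_lhs => rw [← h3]
      rw [map_smul, homApp_embed_gen]
      rfl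
  obtain ⟨c₀, h₀, h₀'⟩ := key s₀
  obtain ⟨c₁, h₁, h₁'⟩ := key s₁
  -- The image of the denominator `s₁` is nonzero and is a multiple of `g`.
  have hg0 : g ≠ 0 := by
    intro h0
    refine h1 (hinj ?_)
    rw [h₁, h0, mul_zero]
    exact (map_zero (ratRes X.toSheafedSpace _)).symm
  have hc : ratRes X.toSheafedSpace (le_top : T.nhd η ≤ ⊤) a * toRat X.toSheafedSpace _ c₁ =
      toRat X.toSheafedSpace _ c₀ := by
    refine (isUnit_of_ne_zero hg0).mul_right_cancel ?_
    rw [mul_assoc, ← h₁, ← h₀]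
    exact (map_mul _ _ _).symm.trans (congrArg _ h2)
  refine ⟨m, _, _, isSectionLike_homApp m s₀, isSectionLike_homApp m s₁, fun h0 => h1 ?_, ?_⟩
  · have h4 : s₁ = 0 := T.embed_injective m ⊤ (h0.trans (map_zero (homApp (T.embed m) ⊤)).symm)
    rw [h4, map_zero]
  · refine hinj ?_
    refine (map_mul _ _ _).trans ?_
    rw [h₁', ← mul_assoc, hc, h₀']

/-- Denominators of the individual elements are multiplied together; the powers of `L` add up. -/
lemma exists_common_denominator (hL : ratios L = Set.univ)
    (S : Finset ↑(RationalFunctions X.toSheafedSpace)) :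
    ∃ (m : ℕ) (s : RationalFunctions X.toSheafedSpace), s ≠ 0 ∧ T.IsSectionLike m s ∧
      ∀ a ∈ S, T.IsSectionLike m (s * a) := by
  classical
  induction S using Finset.induction_on with
  | empty => exact ⟨0, 1, one_ne_zero, isSectionLike_one, by simp⟩
  | insert a S _ ih =>
    obtain ⟨m, s, hs0, hs, hS⟩ := ih
    obtain ⟨m', f₀, f₁, h₀, h₁, hf, haf⟩ := T.exists_of_mem_ratios (a := a) (hL ▸ Set.mem_univ a)
    refine ⟨m + m', s * f₁, ((isUnit_of_ne_zero hs0).mul (isUnit_of_ne_zero hf)).ne_zero,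
      hs.mul h₁, fun c hc => ?_⟩
    rcases Finset.mem_insert.1 hc with rfl | hc
    · rw [mul_assoc, mul_comm f₁, haf]
      exact hs.mul h₀
    · rw [mul_right_comm]
      exact (hS c hc).mul h₁

end Trivialization

end LineBundle

end FormalGeometry

end

noncomputable section

namespace FormalGeometry

/-! ### Formal rational functions with bounded denominators -/

section FormalSections

variable {X : Scheme.{u}} (Y : Closeds X) {L : Mod X.toSheafedSpace} (T : Trivialization L)

/-- The pullback of the power of the local generator at `y`. -/
def formalPow (m : ℕ) (y : Y) : sections ((pullback (completionι Y)).obj (tensorPow L m))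
    (preimageOpen (completionι Y) (T.nhd y.1)) :=
  unitApp (completionι Y) (tensorPow L m) (T.nhd y.1) (powSection (T.gen y.1) m)

/-- The pullback of the quotient of two local generators. -/
def formalRatio (y y' : Y) : (completion Y).presheaf.obj
    (op (preimageOpen (completionι Y) (T.nhd y.1 ⊓ T.nhd y'.1))) :=
  pullRing (completionι Y) _ (T.ratio y'.1 inf_le_right (modRes L inf_le_left (T.gen y.1)))

lemma formalPow_eq (m : ℕ) (y y' : Y) {W : Opens (completion Y)}
    (h : W ≤ preimageOpen (completionι Y) (T.nhd y.1))
    (h' : W ≤ preimageOpen (completionι Y) (T.nhd y'.1))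
    (hi : W ≤ preimageOpen (completionι Y) (T.nhd y.1 ⊓ T.nhd y'.1)) :
    modRes _ h (formalPow Y T m y) =
      ringRes _ hi (formalRatio Y T y y' ^ m) • modRes _ h' (formalPow Y T m y') := by
  have h1 : modRes (tensorPow L m) (inf_le_left : T.nhd y.1 ⊓ T.nhd y'.1 ≤ _)
      (powSection (T.gen y.1) m) = T.ratio y'.1 inf_le_right
        (modRes L inf_le_left (T.gen y.1)) ^ m • modRes (tensorPow L m) inf_le_right
          (powSection (T.gen y'.1) m) := by
    rw [modRes_powSection, modRes_powSection, ← powSection_smul, T.ratio_smul]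
  have h2 := congrArg (fun s => modRes _ hi (unitApp (completionι Y) (tensorPow L m) _ s)) h1
  simp only [unitApp_smul] at h2
  rw [unitApp_modRes (completionι Y) _ _
      ((Opens.map (completionι Y).hom.base).map (homOfLE inf_le_left)).le, modRes_smul,
    unitApp_modRes (completionι Y) _ _
      ((Opens.map (completionι Y).hom.base).map (homOfLE inf_le_right)).le, modRes_modRes,
    modRes_modRes, map_pow] at h2
  exact h2

variable [IsIntegral X] [IsLocallyNoetherian X]

lemma homApp_inducedEmbedding {M : Mod X.toSheafedSpace}
    (e : M ⟶ rationalModule X.toSheafedSpace) (V : X.Opens) (s : sections M V) :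
    homApp (inducedEmbedding Y e) (preimageOpen (completionι Y) V) (unitApp (completionι Y) M V s) =
      pullRat (completionι_preservesRegular Y) V (homApp e V s) :=
  homApp_transpose (completionι Y)
    (e ≫ rationalModuleMap (completionι_preservesRegular Y)) V s

/-- The formal rational function corresponding to the local generator at `y`. -/
def formalGen (y : Y) : (rationalSheaf (completion Y)).obj.obj
    (op (preimageOpen (completionι Y) (T.nhd y.1))) :=
  pullRat (completionι_preservesRegular Y) (T.nhd y.1) (T.ratGen y.1)

lemma isUnit_formalGen (y : Y) : IsUnit (formalGen Y T y) :=
  (isUnit_of_ne_zero (T.ratGen_ne_zero y.1)).map _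

/-- `F` corresponds to a section of the pullback of `L ^ m`. -/
def IsFormalSectionLike (m : ℕ) (F : RationalFunctions (completion Y)) : Prop :=
  ∀ y : Y, ∃ (W : Opens (completion Y)) (h : W ≤ preimageOpen (completionι Y) (T.nhd y.1)),
    y ∈ W ∧ ∃ c : (completion Y).presheaf.obj (op W), ratRes (completion Y) le_top F =
      toRat (completion Y) W c * ratRes (completion Y) h (formalGen Y T y ^ m)

lemma homApp_formalPow (m : ℕ) (y : Y) :
    homApp (inducedEmbedding Y (T.embed m)) _ (formalPow Y T m y) = (formalGen Y T y ^ m :) := by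
  refine (homApp_inducedEmbedding Y (T.embed m) _ _).trans ?_
  rw [Trivialization.homApp_embed_gen]
  exact map_pow (pullRat (completionι_preservesRegular Y) _) (T.ratGen y.1) m

lemma formalGen_eq (y y' : Y) {W : Opens (completion Y)}
    (h : W ≤ preimageOpen (completionι Y) (T.nhd y.1))
    (h' : W ≤ preimageOpen (completionι Y) (T.nhd y'.1))
    (hi : W ≤ preimageOpen (completionι Y) (T.nhd y.1 ⊓ T.nhd y'.1)) :
    ratRes (completion Y) h (formalGen Y T y) =
      toRat (completion Y) W (ringRes _ hi (formalRatio Y T y y')) *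
        ratRes (completion Y) h' (formalGen Y T y') := by
  have h1 := congrArg (pullRat (completionι_preservesRegular Y) _)
    (T.ratRes_ratGen y.1 y'.1 (inf_le_left : T.nhd y.1 ⊓ T.nhd y'.1 ≤ _) inf_le_right)
  rw [map_mul, pullRat_ratRes _ _ _ ((Opens.map (completionι Y).hom.base).map
      (homOfLE inf_le_left)).le, pullRat_ratRes _ _ _ ((Opens.map (completionι Y).hom.base).map
      (homOfLE inf_le_right)).le, pullRat_toRat] at h1
  have h2 := congrArg (ratRes (completion Y) hi) h1
  rw [map_mul, ringRes_ringRes, ringRes_ringRes, ratRes_toRat] at h2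
  exact h2

/-- The local sections `c y • gen ^ m` glue. Their agreement on overlaps can be tested in
`ℳ_{X_{/Y}}`, where the images of the generators are units and both sides become `F`. -/
lemma IsFormalSectionLike.exists_section {m : ℕ} {F : RationalFunctions (completion Y)}
    (hF : IsFormalSectionLike Y T m F) :
    ∃ s : sections ((pullback (completionι Y)).obj (tensorPow L m)) ⊤,
      homApp (inducedEmbedding Y (T.embed m)) ⊤ s = F := by
  choose W hW hyW c hc using hF
  have hcov : (⊤ : Opens (completion Y)) ≤ iSup W := fun y _ => Opens.mem_iSup.2 ⟨y, hyW y⟩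
  obtain ⟨s, hs⟩ := exists_modRes_glue ((pullback (completionι Y)).obj (tensorPow L m)) W
    (fun _ => le_top) hcov (fun y => c y • modRes _ (hW y) (formalPow Y T m y)) fun y y' => by
      have h : W y ⊓ W y' ≤ preimageOpen (completionι Y) (T.nhd y.1) := inf_le_left.trans (hW y)
      have h' : W y ⊓ W y' ≤ preimageOpen (completionι Y) (T.nhd y'.1) :=
        inf_le_right.trans (hW y')
      have hi : W y ⊓ W y' ≤ preimageOpen (completionι Y) (T.nhd y.1 ⊓ T.nhd y'.1) :=
        le_inf h h'
      rw [modRes_smul, modRes_smul, modRes_modRes, modRes_modRes, formalPow_eq Y T m y y' h h' hi,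
        smul_smul]
      congr 1
      refine toRat_injective _ (((isUnit_formalGen Y T y').map (ratRes (completion Y) h')).pow m
        |>.mul_right_cancel ?_)
      have e1 := congrArg (ratRes (completion Y) (inf_le_left : W y ⊓ W y' ≤ W y)) (hc y)
      have e2 := congrArg (ratRes (completion Y) (inf_le_right : W y ⊓ W y' ≤ W y')) (hc y')
      rw [ringRes_ringRes, map_mul, ringRes_ringRes, ratRes_toRat, map_pow] at e1 e2
      rw [formalGen_eq Y T y y' h h' hi] at e1
      rw [map_mul, ← e2, e1, map_pow, map_pow]
      ring
  refine ⟨s, ringRes_eq_of_cover (rationalSheaf (completion Y)).property W (fun _ => le_top) hcov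
    fun y => ?_⟩
  refine (homApp_modRes (inducedEmbedding Y (T.embed m)) le_top s).symm.trans ?_
  rw [hs, map_smul, homApp_modRes, homApp_formalPow]
  exact (hc y).symm

lemma Trivialization.IsSectionLike.formal {m : ℕ} {f : RationalFunctions X.toSheafedSpace}
    (hf : T.IsSectionLike m f) (y : Y) : ∃ c : (completion Y).presheaf.obj
      (op (preimageOpen (completionι Y) (T.nhd y.1))),
        ratRes (completion Y) le_top (alpha Y f) =
          toRat (completion Y) _ c * formalGen Y T y ^ m := by
  obtain ⟨c, hc⟩ := hf y.1
  refine ⟨pullRing (completionι Y) _ c, ?_⟩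
  have h1 := congrArg (pullRat (completionι_preservesRegular Y) _) hc
  rw [map_mul, map_pow, pullRat_toRat, pullRat_ratRes _ _ _ le_top] at h1
  exact h1

/-- Formal rational functions which locally are formal combinations of rational functions are
rational functions. -/
lemma exists_alpha_eq (hL : IsLineBundle L) (hG3 : WeaklyG3 Y L) [CompactSpace Y]
    (ζ : RationalFunctions (completion Y))
    (hζ : ∀ y : Y, ∃ W : Opens (completion Y), y ∈ W ∧ ∃ (n : ℕ)
      (h : Fin n → (completion Y).presheaf.obj (op W))
      (a : Fin n → ↑(RationalFunctions X.toSheafedSpace)),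
        ratRes (completion Y) le_top ζ =
          ∑ i, toRat (completion Y) W (h i) * ratRes (completion Y) le_top (alpha Y (a i))) :
    ∃ t, alpha Y t = ζ := by
  classical
  obtain ⟨T⟩ := exists_trivialization hL
  obtain ⟨hfield, huniv, hrat⟩ := hG3
  choose W hyW n h a hWa using hζ
  have : CompactSpace (completion Y) := inferInstanceAs (CompactSpace Y)
  obtain ⟨I, hI⟩ := (isCompact_univ (X := completion Y)).elim_finite_subcover
    (fun y : completion Y => (W y : Set (completion Y)))
    (fun y => (W y).isOpen) fun y _ => Set.mem_iUnion.2 ⟨y, hyW y⟩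
  -- One denominator `s` serves all rational functions `a z i` occurring over the finite subcover.
  obtain ⟨m, s, hs0, hs, hsa⟩ := T.exists_common_denominator huniv
    (I.biUnion fun y => Finset.univ.image (a y))
  have h1 : IsFormalSectionLike Y T m (alpha Y s) := fun y => by
    obtain ⟨c, hc⟩ := hs.formal Y T y
    exact ⟨_, le_rfl, T.mem_nhd y.1, c, by rw [hc, ringRes_self]⟩
  -- Locally `α(s) ζ = ∑ hᵢ α(s aᵢ)`, a combination of formal sections of `L ^ m` with formal
  -- functions as coefficients.
  have h2 : IsFormalSectionLike Y T m (alpha Y s * ζ) := fun y => by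
    obtain ⟨z, hz, hyz⟩ : ∃ z ∈ I, y ∈ W z := by
      obtain ⟨z, hz, hyz⟩ := Set.mem_iUnion₂.1 (hI (Set.mem_univ y))
      exact ⟨z, hz, hyz⟩
    have hmem : ∀ i, T.IsSectionLike m (s * a z i) := fun i =>
      hsa _ (Finset.mem_biUnion.2 ⟨z, hz, Finset.mem_image_of_mem _ (Finset.mem_univ i)⟩)
    choose c hc using fun i => (hmem i).formal Y T y
    refine ⟨W z ⊓ preimageOpen (completionι Y) (T.nhd y.1), inf_le_right, ⟨hyz, T.mem_nhd y.1⟩,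
      ∑ i, ringRes _ inf_le_left (h z i) * ringRes _ inf_le_right (c i), ?_⟩
    have e0 := congrArg (ratRes (completion Y)
      (inf_le_left : W z ⊓ preimageOpen (completionι Y) (T.nhd y.1) ≤ W z)) (hWa z)
    rw [ringRes_ringRes] at e0
    rw [map_mul, e0, map_sum, map_sum, Finset.mul_sum, Finset.sum_mul]
    refine Finset.sum_congr rfl fun i _ => ?_
    have e1 := congrArg (ratRes (completion Y)
      (inf_le_right : W z ⊓ preimageOpen (completionι Y) (T.nhd y.1) ≤ _)) (hc i)
    rw [ringRes_ringRes, map_mul, map_mul, map_mul, ratRes_toRat] at e1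
    rw [map_mul, map_mul, ringRes_ringRes, ratRes_toRat, mul_assoc, ← e1]
    ring
  obtain ⟨σ₁, hσ₁⟩ := h1.exists_section
  obtain ⟨σ₀, hσ₀⟩ := h2.exists_section
  have hmem : ζ ∈ formalRatios Y L := by
    refine ⟨m, T.embed m, inferInstance, σ₀, σ₁, ?_, ?_⟩
    · change homApp (inducedEmbedding Y (T.embed m)) ⊤ σ₁ ≠ 0
      rw [hσ₁]
      have : Nontrivial (RationalFunctions (completion Y)) := hfield.nontrivial
      exact ((isUnit_of_ne_zero hs0).map (alpha Y).hom).ne_zero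
    · change ζ * (show RationalFunctions (completion Y) from
        homApp (inducedEmbedding Y (T.embed m)) ⊤ σ₁) =
          homApp (inducedEmbedding Y (T.embed m)) ⊤ σ₀
      rw [hσ₁, hσ₀, mul_comm]
  rw [← hrat] at hmem
  obtain ⟨t, -, ht⟩ := hmem
  exact ⟨t, ht⟩

end FormalSections

end FormalGeometry

end

noncomputable section

namespace FormalGeometry

/-! ### Formal coordinates of sections over an open neighbourhood -/

section OpenNeighbourhood

variable {X : Scheme.{u}} (Y : Closeds X) {U : X.Opens} (hU : (Y : Set X) ⊆ U)

lemma preimage_completionToOpen_le (W : (U : Scheme.{u}).Opens) :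
    preimageOpen (completionToOpen Y U hU) W ≤ preimageOpen (completionι Y) (U.ι ''ᵁ W) :=
  fun y hy => (Set.mem_image _ _ _).2 ⟨⟨y.1, hU y.2⟩, hy, rfl⟩

/-- The morphism to `X` factors through `U`; this is checked on each infinitesimal neighbourhood. It
lets the pullback of rational functions, set up for `X`, serve for bundles on `U`. -/
lemma pullRing_completionToOpen (W : (U : Scheme.{u}).Opens) (r : Γ(X, U.ι ''ᵁ W)) :
    pullRing (completionToOpen Y U hU) W r =
      ringRes (completion Y).presheaf (preimage_completionToOpen_le Y hU W)
        (pullRing (completionι Y) (U.ι ''ᵁ W) r) := by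
  refine Subtype.ext (funext fun n => ?_)
  have hr : Set.range (thickeningι Y n) ⊆ Set.range U.ι := by
    rw [range_thickeningι, Scheme.Opens.range_ι]
    exact hU
  have le₁ : thickeningOpen Y n (preimageOpen (completionToOpen Y U hU) W) ≤
      IsOpenImmersion.lift U.ι (thickeningι Y n) hr ⁻¹ᵁ W := fun x hx => by
    have hx' : (⟨thickeningι Y n x, hU (thickeningι_mem Y n x)⟩ : U) ∈ W := hx
    have : IsOpenImmersion.lift U.ι (thickeningι Y n) hr x =
        (⟨thickeningι Y n x, hU (thickeningι_mem Y n x)⟩ : U) := Subtype.ext <| by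
      change U.ι _ = thickeningι Y n x
      rw [← Scheme.Hom.comp_apply, IsOpenImmersion.lift_fac]
    change IsOpenImmersion.lift U.ι (thickeningι Y n) hr x ∈ W
    rw [this]
    exact hx'
  have le₂ : thickeningOpen Y n ((Opens.map (incl Y)).obj (U.ι ''ᵁ W)) ≤
    thickeningι Y n ⁻¹ᵁ (U.ι ''ᵁ W) := le_rfl
  change (IsOpenImmersion.lift U.ι (thickeningι Y n) hr).appLE W _ le₁ r =
    thickeningRes Y n (homOfLE (preimage_completionToOpen_le Y hU W))
      ((thickeningι Y n).appLE (U.ι ''ᵁ W) _ le₂ r)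
  have h2 := ConcreteCategory.congr_hom (Scheme.Hom.appLE_map (thickeningι Y n) le₂
    ((Opens.map (thickeningProj Y n)).map
      (homOfLE (preimage_completionToOpen_le Y hU W))).op) r
  refine Eq.trans ?_ h2.symm
  have h1 := Scheme.Hom.appLE_comp_appLE (IsOpenImmersion.lift U.ι (thickeningι Y n) hr) U.ι
    (U.ι ''ᵁ W) W _ (U.ι.preimage_image_eq W).ge le₁
  simp only [IsOpenImmersion.lift_fac] at h1
  rw [← h1, Scheme.Opens.ι_appLE]
  exact congrArg ((IsOpenImmersion.lift U.ι (thickeningι Y n) hr).appLE W _ le₁)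
    (ringRes_self X.presheaf le_rfl r).symm

lemma nonempty_image {W : (U : Scheme.{u}).Opens} (hW : (W : Set U).Nonempty) :
    ((U.ι ''ᵁ W : X.Opens) : Set X).Nonempty := hW.image U.ι

variable [IsIntegral X]

/-- Functions on a nonempty open subset, as rational functions. -/
def openToRat (W : (U : Scheme.{u}).Opens) (hW : (W : Set U).Nonempty) :
    Γ(U, W) →+* RationalFunctions X.toSheafedSpace :=
  (genExt (le_top : U.ι ''ᵁ W ≤ ⊤) fun _ => nonempty_image hW).toRingHom.comp
    (toRat X.toSheafedSpace (U.ι ''ᵁ W))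

lemma ratRes_openToRat (W : (U : Scheme.{u}).Opens) (hW : (W : Set U).Nonempty) (c : Γ(U, W)) :
    ratRes X.toSheafedSpace (le_top : U.ι ''ᵁ W ≤ ⊤) (openToRat W hW c) =
      toRat X.toSheafedSpace (U.ι ''ᵁ W) c :=
  ratRes_genExt _ (fun _ => nonempty_image hW) _

lemma openToRat_eq_iff (W : (U : Scheme.{u}).Opens) (hW : (W : Set U).Nonempty) (c : Γ(U, W))
    (t : RationalFunctions X.toSheafedSpace) : openToRat W hW c = t ↔
      toRat X.toSheafedSpace (U.ι ''ᵁ W) c =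
        ratRes X.toSheafedSpace (le_top : U.ι ''ᵁ W ≤ ⊤) t :=
  genExt_eq_iff _ (fun _ => nonempty_image hW) _ _

lemma openToRat_injective (W : (U : Scheme.{u}).Opens) (hW : (W : Set U).Nonempty) :
    Function.Injective (openToRat (X := X) W hW) := fun c d h => by
  have h1 := congrArg (ratRes X.toSheafedSpace (le_top : U.ι ''ᵁ W ≤ ⊤)) h
  rw [ratRes_openToRat, ratRes_openToRat] at h1
  exact toRat_injective (Z := X.toSheafedSpace) _ h1

lemma openToRat_ringRes {W W' : (U : Scheme.{u}).Opens} (h : W' ≤ W) (hW' : (W' : Set U).Nonempty)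
    (hW : (W : Set U).Nonempty) (c : Γ(U, W)) :
    openToRat W' hW' (ringRes (U : Scheme.{u}).presheaf h c) = openToRat W hW c := by
  rw [openToRat_eq_iff]
  have h1 := ratRes_toRat (Z := X.toSheafedSpace) (U.ι.image_mono h) c
  refine h1.symm.trans ?_
  rw [← ratRes_openToRat W hW c, ringRes_ringRes]

variable {E : Mod (U : Scheme.{u}).toSheafedSpace} {V₀ : (U : Scheme.{u}).Opens} {n : ℕ}
  {b : Fin n → sections E V₀}

lemma nonempty_inf_open {V W : (U : Scheme.{u}).Opens} (hV : (V : Set U).Nonempty)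
    (hW : (W : Set U).Nonempty) : ((V ⊓ W : (U : Scheme.{u}).Opens) : Set U).Nonempty := by
  have : Nonempty U := ⟨hV.some⟩
  exact nonempty_inf hV hW

/-- The coordinates of a section, as rational functions. -/
def coordRat (hb : IsFrame E V₀ b) (h₀ : (V₀ : Set U).Nonempty) (k : Fin n)
    {W : (U : Scheme.{u}).Opens} (hW : (W : Set U).Nonempty) (s : sections E W) :
    RationalFunctions X.toSheafedSpace :=
  openToRat (W ⊓ V₀) (nonempty_inf_open hW h₀) (hb.coord inf_le_right (modRes E inf_le_left s) k)

/-- Coordinates may be computed over any nonempty open set on which both the section and the frame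
are defined. -/
lemma coordRat_eq (hb : IsFrame E V₀ b) (h₀ : (V₀ : Set U).Nonempty) (k : Fin n)
    {W T : (U : Scheme.{u}).Opens} (hW : (W : Set U).Nonempty) (s : sections E W)
    (hT : (T : Set U).Nonempty) (hTW : T ≤ W) (hTV : T ≤ V₀) :
    coordRat hb h₀ k hW s = openToRat T hT (hb.coord hTV (modRes E hTW s) k) := by
  rw [coordRat, ← openToRat_ringRes (le_inf hTW hTV) hT]
  refine congrArg _ ((hb.coord_modRes inf_le_right (le_inf hTW hTV) _ _).symm.trans ?_)
  rw [modRes_modRes]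

lemma coordRat_change (hb : IsFrame E V₀ b) (h₀ : (V₀ : Set U).Nonempty) (k : Fin n)
    {V₁ : (U : Scheme.{u}).Opens} {n' : ℕ} {b' : Fin n' → sections E V₁} (hb' : IsFrame E V₁ b')
    (h₁ : (V₁ : Set U).Nonempty) {W : (U : Scheme.{u}).Opens} (hW : (W : Set U).Nonempty)
    (s : sections E W) : coordRat hb h₀ k hW s =
      ∑ l, coordRat hb h₀ k h₁ (b' l) * coordRat hb' h₁ l hW s := by
  have hT : ((W ⊓ (V₀ ⊓ V₁) : (U : Scheme.{u}).Opens) : Set U).Nonempty :=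
    nonempty_inf_open hW (nonempty_inf_open h₀ h₁)
  have hT0 : W ⊓ (V₀ ⊓ V₁) ≤ V₀ := inf_le_right.trans inf_le_left
  have hT1 : W ⊓ (V₀ ⊓ V₁) ≤ V₁ := inf_le_right.trans inf_le_right
  rw [coordRat_eq hb h₀ k hW s hT inf_le_left hT0]
  simp_rw [coordRat_eq hb h₀ k h₁ _ hT hT1 hT0, coordRat_eq hb' h₁ _ hW s hT inf_le_left hT1]
  simp_rw [← map_mul]
  rw [← map_sum]
  congr 1
  conv_lhs => rw [← hb'.sum_coord hT1 (modRes E inf_le_left s)]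
  rw [map_sum, Finset.sum_apply]
  refine Finset.sum_congr rfl fun l _ => ?_
  rw [map_smul, Pi.smul_apply, smul_eq_mul, mul_comm]

lemma coordRat_self (hb : IsFrame E V₀ b) (h₀ : (V₀ : Set U).Nonempty) (k i : Fin n) :
    coordRat hb h₀ k h₀ (b i) = if i = k then 1 else 0 := by
  classical
  rw [coordRat_eq hb h₀ k h₀ (b i) h₀ le_rfl le_rfl]
  have h1 := hb.coord_sum le_rfl (Pi.single i 1)
  rw [Finset.sum_eq_single i (fun j _ hj => by rw [Pi.single_eq_of_ne hj, zero_smul])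
    (fun h => (h (Finset.mem_univ i)).elim), Pi.single_eq_same, one_smul] at h1
  rw [h1, Pi.single_apply]
  split_ifs with h2 h3 h3
  · exact map_one _
  · exact (h3 h2.symm).elim
  · exact (h2 h3.symm).elim
  · exact map_zero _

lemma nonempty_image_inf (h₀ : (V₀ : Set U).Nonempty) (W : (U : Scheme.{u}).Opens)
    (hW : ((U.ι ''ᵁ W : X.Opens) : Set X).Nonempty) :
    ((U.ι ''ᵁ (W ⊓ V₀) : X.Opens) : Set X).Nonempty :=
  nonempty_image (nonempty_inf_open (Set.image_nonempty.1 hW) h₀)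

variable [IsLocallyNoetherian X]

/-- Rational functions near an open subset of `U`, as formal rational functions. -/
def formalRes (W : (U : Scheme.{u}).Opens) :
    (rationalSheaf X.toSheafedSpace).obj.obj (op (U.ι ''ᵁ W)) →+*
      (rationalSheaf (completion Y)).obj.obj (op (preimageOpen (completionToOpen Y U hU) W)) :=
  (ratRes (completion Y) (preimage_completionToOpen_le Y hU W)).comp
    (pullRat (completionι_preservesRegular Y) (U.ι ''ᵁ W))

lemma formalRes_toRat (W : (U : Scheme.{u}).Opens) (r : Γ(U, W)) :
    formalRes Y hU W (toRat X.toSheafedSpace (U.ι ''ᵁ W) r) =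
      toRat (completion Y) _ (pullRing (completionToOpen Y U hU) W r) := by
  refine (congrArg (ratRes (completion Y) _) (pullRat_toRat _ _ _)).trans ?_
  refine (ratRes_toRat _ _).trans ?_
  exact congrArg _ (pullRing_completionToOpen Y hU W r).symm

lemma formalRes_ratRes {W W' : (U : Scheme.{u}).Opens} (h : W' ≤ W)
    (t : (rationalSheaf X.toSheafedSpace).obj.obj (op (U.ι ''ᵁ W)))
    (h' : preimageOpen (completionToOpen Y U hU) W' ≤ preimageOpen (completionToOpen Y U hU) W) :
    formalRes Y hU W' (ratRes X.toSheafedSpace (U.ι.image_mono h) t) =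
      ratRes (completion Y) h' (formalRes Y hU W t) := by
  change ratRes _ _ (pullRat _ _ _) = ratRes _ _ (ratRes _ _ (pullRat _ _ _))
  rw [pullRat_ratRes _ _ _ ((Opens.map (completionι Y).hom.base).map
      (homOfLE (U.ι.image_mono h))).le, ringRes_ringRes, ringRes_ringRes]

lemma formalRes_ratRes_top (W : (U : Scheme.{u}).Opens) (t : RationalFunctions X.toSheafedSpace) :
    formalRes Y hU W (ratRes X.toSheafedSpace le_top t) =
      ratRes (completion Y) le_top (alpha Y t) := by
  change ratRes _ _ (pullRat _ _ _) = _
  rw [pullRat_ratRes _ _ _ le_top]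
  exact ringRes_ringRes _ _ _ _

/-- The coordinate functions of a frame, as formal rational functions. -/
def formalCoord (hb : IsFrame E V₀ b) (h₀ : (V₀ : Set U).Nonempty) (k : Fin n) :
    E ⟶ (pushforward (completionToOpen Y U hU)).obj (rationalModule (completion Y)) :=
  hb.functional k
    (fun W => ((formalRes Y hU W).comp
      ((genExt (U.ι.image_mono inf_le_left) (nonempty_image_inf h₀ W)).toRingHom.comp
        (toRat X.toSheafedSpace (U.ι ''ᵁ (W ⊓ V₀))))).toAddMonoidHom)
    (fun W r c => by
      have h1 : genExt (U.ι.image_mono inf_le_left) (nonempty_image_inf h₀ W)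
          (toRat X.toSheafedSpace (U.ι ''ᵁ (W ⊓ V₀))
            (ringRes (U : Scheme.{u}).presheaf inf_le_left r * c)) =
          toRat X.toSheafedSpace (U.ι ''ᵁ W) r *
            genExt (U.ι.image_mono inf_le_left) (nonempty_image_inf h₀ W)
              (toRat X.toSheafedSpace (U.ι ''ᵁ (W ⊓ V₀)) c) := by
        rw [genExt_eq_iff, map_mul, ratRes_genExt]
        refine (map_mul (toRat X.toSheafedSpace (U.ι ''ᵁ (W ⊓ V₀))) _ _).trans ?_
        exact congrArg (· * _) (ratRes_toRat (Z := X.toSheafedSpace) _ r).symm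
      refine (congrArg (formalRes Y hU W) h1).trans ?_
      refine (map_mul (formalRes Y hU W) _ _).trans ?_
      exact congrArg (· * _) (formalRes_toRat Y hU W r))
    (fun W W' h c => by
      have h1 : genExt (U.ι.image_mono inf_le_left) (nonempty_image_inf h₀ W')
          (toRat X.toSheafedSpace (U.ι ''ᵁ (W' ⊓ V₀))
            (ringRes (U : Scheme.{u}).presheaf (inf_le_inf_right V₀ h) c)) =
          ratRes X.toSheafedSpace (U.ι.image_mono h)
            (genExt (U.ι.image_mono inf_le_left) (nonempty_image_inf h₀ W)
              (toRat X.toSheafedSpace (U.ι ''ᵁ (W ⊓ V₀)) c)) := by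
        rw [genExt_eq_iff, ringRes_ringRes]
        refine (ratRes_toRat (Z := X.toSheafedSpace)
          (U.ι.image_mono (inf_le_inf_right V₀ h)) c).symm.trans ?_
        rw [← ratRes_genExt (U.ι.image_mono inf_le_left) (nonempty_image_inf h₀ W)
          (toRat X.toSheafedSpace (U.ι ''ᵁ (W ⊓ V₀)) c), ringRes_ringRes, ratRes_genExt]
      refine (congrArg (formalRes Y hU W') h1).trans ?_
      exact formalRes_ratRes Y hU h _ _)

lemma homApp_formalCoord (hb : IsFrame E V₀ b) (h₀ : (V₀ : Set U).Nonempty) (k : Fin n)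
    {W : (U : Scheme.{u}).Opens} (hW : (W : Set U).Nonempty) (s : sections E W) :
    homApp (formalCoord Y hU hb h₀ k) W s =
      ratRes (completion Y) le_top (alpha Y (coordRat hb h₀ k hW s)) := by
  refine Eq.trans ?_ (formalRes_ratRes_top Y hU W _)
  refine congrArg (formalRes Y hU W) ?_
  refine (genExt_eq_iff (U.ι.image_mono inf_le_left) (nonempty_image_inf h₀ W) _ _).2 ?_
  rw [ringRes_ringRes]
  exact (ratRes_openToRat _ _ _).symm

/-- The coordinates of a formal section. -/
def formalSectionCoord (hb : IsFrame E V₀ b) (h₀ : (V₀ : Set U).Nonempty) (k : Fin n)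
    (ξ : sections ((pullback (completionToOpen Y U hU)).obj E) ⊤) :
    RationalFunctions (completion Y) :=
  homApp (((pullbackAdj (completionToOpen Y U hU)).homEquiv _ _).symm
    (formalCoord Y hU hb h₀ k)) ⊤ ξ

/-- Linearity of the transposed coordinate function, which takes pulled-back sections to their
rational coordinates. The outcome is the shape required by `exists_alpha_eq`. -/
lemma ratRes_formalSectionCoord (hb : IsFrame E V₀ b) (h₀ : (V₀ : Set U).Nonempty) (k : Fin n)
    (ξ : sections ((pullback (completionToOpen Y U hU)).obj E) ⊤)
    {V₁ : (U : Scheme.{u}).Opens} (h₁ : (V₁ : Set U).Nonempty) {n' : ℕ}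
    {b' : Fin n' → sections E V₁} {W : Opens (completion Y)}
    (hW : W ≤ preimageOpen (completionToOpen Y U hU) V₁)
    (c : Fin n' → (completion Y).presheaf.obj (op W))
    (hc : modRes _ le_top ξ = ∑ i, c i • modRes _ hW
      (unitApp (completionToOpen Y U hU) E V₁ (b' i))) :
    ratRes (completion Y) le_top (formalSectionCoord Y hU hb h₀ k ξ) =
      ∑ i, toRat (completion Y) W (c i) *
        ratRes (completion Y) le_top (alpha Y (coordRat hb h₀ k h₁ (b' i))) := by
  set φ := ((pullbackAdj (completionToOpen Y U hU)).homEquiv _ _).symm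
    (formalCoord Y hU hb h₀ k) with hφ
  refine (homApp_modRes φ le_top ξ).symm.trans ?_
  rw [hc, map_sum]
  refine Finset.sum_congr rfl fun i _ => ?_
  rw [map_smul, homApp_modRes, hφ, homApp_transpose, homApp_formalCoord Y hU hb h₀ k h₁]
  refine congrArg (toRat (completion Y) W (c i) * ·) ?_
  exact ringRes_ringRes _ _ _ _

end OpenNeighbourhood

end FormalGeometry

end

noncomputable section

namespace FormalGeometry

/-! ### The Grothendieck--Lefschetz condition -/

/-! ### Stability of regularity at a point. -/

section Regular

variable {X : Scheme.{u}} {V : X.Opens}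
  {t t' : (rationalSheaf X.toSheafedSpace).obj.obj (op V)} {x : X}

/-- Open sets are stable under generization. -/
lemma IsRegularAt.of_specializes (h : IsRegularAt t x) {z : X} (hz : z ⤳ x) : IsRegularAt t z := by
  obtain ⟨W, hW, hx, c, hc⟩ := h
  exact ⟨W, hW, hz.mem_open W.isOpen hx, c, hc⟩

lemma IsRegularAt.ratRes (h : IsRegularAt t x) {W : X.Opens} (hW : W ≤ V) (hx : x ∈ W) :
    IsRegularAt (FormalGeometry.ratRes X.toSheafedSpace hW t) x := by
  obtain ⟨W', hW', hx', c, hc⟩ := h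
  refine ⟨W ⊓ W', inf_le_left, ⟨hx, hx'⟩, ringRes X.presheaf inf_le_right c, ?_⟩
  refine Eq.trans ?_ (ratRes_toRat (Z := X.toSheafedSpace) (inf_le_right : W ⊓ W' ≤ W') c)
  rw [← hc, ringRes_ringRes, ringRes_ringRes]

lemma IsRegularAt.mul (h : IsRegularAt t x) (h' : IsRegularAt t' x) : IsRegularAt (t * t') x := by
  obtain ⟨W, hW, hx, c, hc⟩ := h
  obtain ⟨W', hW', hx', c', hc'⟩ := h'
  refine ⟨W ⊓ W', inf_le_left.trans hW, ⟨hx, hx'⟩,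
    ringRes X.presheaf inf_le_left c * ringRes X.presheaf inf_le_right c', ?_⟩
  refine Eq.trans ?_ (map_mul (toRat X.toSheafedSpace (W ⊓ W')) _ _).symm
  refine Eq.trans ?_ (congrArg₂ (· * ·)
    (ratRes_toRat (Z := X.toSheafedSpace) (inf_le_left : W ⊓ W' ≤ W) c)
    (ratRes_toRat (Z := X.toSheafedSpace) (inf_le_right : W ⊓ W' ≤ W') c'))
  rw [← hc, ← hc', ringRes_ringRes, ringRes_ringRes, map_mul]

lemma IsRegularAt.add (h : IsRegularAt t x) (h' : IsRegularAt t' x) : IsRegularAt (t + t') x := by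
  obtain ⟨W, hW, hx, c, hc⟩ := h
  obtain ⟨W', hW', hx', c', hc'⟩ := h'
  refine ⟨W ⊓ W', inf_le_left.trans hW, ⟨hx, hx'⟩,
    ringRes X.presheaf inf_le_left c + ringRes X.presheaf inf_le_right c', ?_⟩
  refine Eq.trans ?_ (map_add (toRat X.toSheafedSpace (W ⊓ W')) _ _).symm
  refine Eq.trans ?_ (congrArg₂ (· + ·)
    (ratRes_toRat (Z := X.toSheafedSpace) (inf_le_left : W ⊓ W' ≤ W) c)
    (ratRes_toRat (Z := X.toSheafedSpace) (inf_le_right : W ⊓ W' ≤ W') c'))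
  rw [← hc, ← hc', ringRes_ringRes, ringRes_ringRes, map_add]

lemma IsRegularAt.sum {ι : Type*} (s : Finset ι)
    {t : ι → (rationalSheaf X.toSheafedSpace).obj.obj (op V)} (hx : x ∈ V)
    (h : ∀ i ∈ s, IsRegularAt (t i) x) : IsRegularAt (∑ i ∈ s, t i) x :=
  Finset.sum_induction _ (IsRegularAt · x) (fun _ _ => .add)
    ⟨V, le_rfl, hx, 0, by rw [map_zero, map_zero]⟩ h

end Regular

/-! ### Points of codimension one specialize into `Y`. -/

section Divisors

variable {X : Scheme.{u}} (Y : Closeds X)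

lemma nonempty_of_nontrivial [Nontrivial (RationalFunctions (completion Y))] : Nonempty Y := by
  by_contra h
  have h1 : (⊤ : Opens (completion Y)) = ⊥ :=
    Opens.ext (Set.eq_empty_of_forall_notMem fun y _ => h ⟨y⟩)
  have := subsingleton_of_eq_bot h1 (rationalSheaf (completion Y)).property
  exact not_subsingleton _ this

/-- The hypothesis on divisors is applied to the prime divisor with generic point `z`. -/
lemma exists_specializes
    (hY : ∀ D : AlgebraicCycle X ℤ, IsEffectiveDivisor D → D ≠ 0 → MeetsCycle Y D)
    {z : X} (hz : ringKrullDim (X.presheaf.stalk z) = 1) : ∃ y : Y, z ⤳ y.1 := by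
  classical
  obtain ⟨x, hx, y, hxy, hyY⟩ := hY (Function.locallyFinsuppWithin.single z 1)
    ⟨fun x => by
      rw [Function.locallyFinsuppWithin.single_apply]
      split_ifs <;> norm_num, fun x hx => by
      rw [Function.locallyFinsuppWithin.single_apply] at hx
      split_ifs at hx with h
      · rw [h, hz]
      · exact (hx rfl).elim⟩
    (fun h => by
      have := DFunLike.congr_fun h z
      rw [Function.locallyFinsuppWithin.single_apply, if_pos rfl] at this
      exact one_ne_zero this)
  rw [Function.locallyFinsuppWithin.single_apply] at hx
  split_ifs at hx with h
  · exact ⟨⟨y, hyY⟩, h ▸ specializes_iff_mem_closure.2 hxy⟩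
  · exact (hx rfl).elim

end Divisors

/-! ### Covers by frames over affine open sets. -/

section FrameCover

variable {X : Scheme.{u}} {U : X.Opens} {E : Mod (U : Scheme.{u}).toSheafedSpace}

/-- A trivialization of a vector bundle over affine open subsets. -/
structure FrameCover (E : Mod (U : Scheme.{u}).toSheafedSpace) where
  /-- The affine open neighbourhoods. -/
  V : U → (U : Scheme.{u}).Opens
  mem : ∀ x, x ∈ V x
  isAffineOpen : ∀ x, IsAffineOpen (V x)
  /-- The ranks. -/
  n : U → ℕ
  /-- The frames. -/
  b : ∀ x, Fin (n x) → sections E (V x)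
  isFrame : ∀ x, IsFrame E (V x) (b x)

lemma exists_frameCover (hE : IsVectorBundle E) : Nonempty (FrameCover E) := by
  have key (x : U) : ∃ V : (U : Scheme.{u}).Opens, x ∈ V ∧ IsAffineOpen V ∧
      ∃ (n : ℕ) (b : Fin n → sections E V), IsFrame E V b := by
    obtain ⟨V, hx, n, b, hb⟩ := hE x
    obtain ⟨A, hA, hxA, hAV⟩ := exists_affineOpen_le (X := (U : Scheme.{u})) hx
    exact ⟨A, hxA, hA, n, _, hb.modRes hAV⟩
  choose V hV hA n b hb using key
  exact ⟨⟨V, hV, hA, n, b, hb⟩⟩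

namespace FrameCover

variable (C : FrameCover E)

lemma nonempty (x : U) : (C.V x : Set U).Nonempty := ⟨x, C.mem x⟩

lemma exists_local_coord (Y : Closeds X) (hU : (Y : Set X) ⊆ U)
    (ξ : sections ((pullback (completionToOpen Y U hU)).obj E) ⊤) (y : Y) :
    ∃ (W : Opens (completion Y))
      (hW : W ≤ preimageOpen (completionToOpen Y U hU) (C.V ⟨y.1, hU y.2⟩))
      (c : Fin (C.n ⟨y.1, hU y.2⟩) → (completion Y).presheaf.obj (op W)), y ∈ W ∧
        modRes _ le_top ξ = ∑ i, c i • modRes _ hW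
          (unitApp (completionToOpen Y U hU) E _ (C.b ⟨y.1, hU y.2⟩ i)) := by
  obtain ⟨W, h, h', c, hy, hc⟩ := exists_coord_pullback (completionToOpen Y U hU)
    (C.isFrame ⟨y.1, hU y.2⟩) ξ (z := y) trivial (C.mem ⟨y.1, hU y.2⟩)
  exact ⟨W, h', c, hy, hc⟩

end FrameCover

end FrameCover

/-! ### Coordinates of sections and formal sections, and the main argument. -/

section Lefschetz

variable {X : Scheme.{u}} [IsIntegral X] {U : X.Opens}
  {E : Mod (U : Scheme.{u}).toSheafedSpace} {V₀ V₁ : (U : Scheme.{u}).Opens} {n n' : ℕ}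
  {b : Fin n → sections E V₀} {b' : Fin n' → sections E V₁}

lemma isRegularAt_coordRat (hb : IsFrame E V₀ b) (h₀ : (V₀ : Set U).Nonempty) (k : Fin n)
    {W : (U : Scheme.{u}).Opens} (hW : (W : Set U).Nonempty) (s : sections E W) {x : U}
    (hx : x ∈ W) (hx₀ : x ∈ V₀) : IsRegularAt (coordRat hb h₀ k hW s) x.1 :=
  ⟨U.ι ''ᵁ (W ⊓ V₀), le_top, Set.mem_image_of_mem _ ⟨hx, hx₀⟩, _, ratRes_openToRat _ _ _⟩

lemma coordRat_modRes (hb : IsFrame E V₀ b) (h₀ : (V₀ : Set U).Nonempty) (k : Fin n)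
    {W T : (U : Scheme.{u}).Opens} (hW : (W : Set U).Nonempty) (hT : (T : Set U).Nonempty)
    (h : T ≤ W) (s : sections E W) :
    coordRat hb h₀ k hT (modRes E h s) = coordRat hb h₀ k hW s := by
  rw [coordRat_eq hb h₀ k hW s (nonempty_inf_open hT h₀) (inf_le_left.trans h) inf_le_right,
    coordRat, modRes_modRes]

lemma eq_of_coordRat_eq (hb : IsFrame E V₀ b) (h₀ : (V₀ : Set U).Nonempty)
    {W : (U : Scheme.{u}).Opens} (hW : (W : Set U).Nonempty) (h : W ≤ V₀) {s s' : sections E W}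
    (hs : ∀ k, coordRat hb h₀ k hW s = coordRat hb h₀ k hW s') : s = s' := by
  refine (hb.coord h).injective (funext fun k => openToRat_injective W hW ?_)
  have h1 := hs k
  rw [coordRat_eq hb h₀ k hW s hW le_rfl h, coordRat_eq hb h₀ k hW s' hW le_rfl h,
    modRes_self, modRes_self] at h1
  exact h1

lemma coordRat_sum_smul (hb : IsFrame E V₀ b) (h₀ : (V₀ : Set U).Nonempty) (k : Fin n)
    (d : Fin n → Γ(U, V₀)) :
    coordRat hb h₀ k h₀ (∑ i, (show (U : Scheme.{u}).toSheafedSpace.presheaf.obj (op V₀) from d i)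
      • b i) = openToRat V₀ h₀ (d k) := by
  rw [coordRat_eq hb h₀ k h₀ _ h₀ le_rfl le_rfl, modRes_self]
  have h1 := hb.coord_sum le_rfl d
  simp_rw [modRes_self] at h1
  exact congrArg (openToRat V₀ h₀) (congrFun h1 k)

namespace FrameCover

variable (C : FrameCover E)

/-- The coordinates of a section over the neighbourhood of `x`, as rational functions. -/
def coord (x : U) (k : Fin (C.n x)) {W : (U : Scheme.{u}).Opens} (hW : (W : Set U).Nonempty)
    (s : sections E W) : RationalFunctions X.toSheafedSpace :=
  coordRat (C.isFrame x) (C.nonempty x) k hW s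

/-- A system of rational functions that transform like the coordinates of a section, and are
regular functions on the affine pieces, comes from a section. -/
lemma exists_section [Nonempty U] (t : ∀ x, Fin (C.n x) → RationalFunctions X.toSheafedSpace)
    (ht : ∀ x x' k, t x k = ∑ l, C.coord x k (C.nonempty x') (C.b x' l) * t x' l)
    (hd : ∀ x k, ∃ d : Γ(X, U.ι ''ᵁ C.V x),
      ratRes X.toSheafedSpace le_top (t x k) = toRat X.toSheafedSpace (U.ι ''ᵁ C.V x) d)
    (hU : ((⊤ : (U : Scheme.{u}).Opens) : Set U).Nonempty) :
    ∃ r : sections E ⊤, ∀ x k, C.coord x k hU r = t x k := by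
  choose d hd using hd
  set s : ∀ x, sections E (C.V x) := fun x => ∑ i,
    (show (U : Scheme.{u}).toSheafedSpace.presheaf.obj (op (C.V x)) from d x i) • C.b x i with hs
  have hsx (x : U) (k : Fin (C.n x)) : C.coord x k (C.nonempty x) (s x) = t x k :=
    (coordRat_sum_smul (C.isFrame x) (C.nonempty x) k (d x)).trans
      ((openToRat_eq_iff _ _ _ _).2 (hd x k).symm)
  -- The local section built in the frame at `x'` also has the prescribed coordinates in the frame
  -- at `x`, by the transformation rule `ht`; hence the local sections agree on overlaps.
  have hsx' (x x' : U) (k : Fin (C.n x)) : C.coord x k (C.nonempty x') (s x') = t x k := by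
    refine (coordRat_change (C.isFrame x) (C.nonempty x) k (C.isFrame x') (C.nonempty x')
      (C.nonempty x') (s x')).trans ?_
    rw [ht x x' k]
    exact Finset.sum_congr rfl fun l _ => congrArg _ (hsx x' l)
  obtain ⟨r, hr⟩ := exists_modRes_glue E C.V (fun _ => le_top)
    (fun x _ => Opens.mem_iSup.2 ⟨x, C.mem x⟩) s fun x x' => by
      have hne := nonempty_inf_open (C.nonempty x) (C.nonempty x')
      refine eq_of_coordRat_eq (C.isFrame x) (C.nonempty x) hne inf_le_left fun k => ?_
      rw [coordRat_modRes _ _ _ (C.nonempty x) hne, coordRat_modRes _ _ _ (C.nonempty x') hne]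
      exact (hsx x k).trans (hsx' x x' k).symm
  refine ⟨r, fun x k => ?_⟩
  rw [← hsx x k, ← hr x]
  exact (coordRat_modRes _ _ _ hU (C.nonempty x) _ _).symm

variable [IsLocallyNoetherian X] (Y : Closeds X) (hU : (Y : Set X) ⊆ U)

/-- The coordinates of a formal section over the neighbourhood of `x`. -/
def formalCoord (x : U) (k : Fin (C.n x))
    (ξ : sections ((pullback (completionToOpen Y U hU)).obj E) ⊤) :
    RationalFunctions (completion Y) :=
  formalSectionCoord Y hU (C.isFrame x) (C.nonempty x) k ξ

lemma ratRes_formalCoord (ξ : sections ((pullback (completionToOpen Y U hU)).obj E) ⊤)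
    (x x' : U) (k : Fin (C.n x)) {W : Opens (completion Y)}
    (hW : W ≤ preimageOpen (completionToOpen Y U hU) (C.V x'))
    (c : Fin (C.n x') → (completion Y).presheaf.obj (op W))
    (hc : modRes _ le_top ξ = ∑ i, c i • modRes _ hW
      (unitApp (completionToOpen Y U hU) E _ (C.b x' i))) :
    ratRes (completion Y) le_top (C.formalCoord Y hU x k ξ) =
      ∑ i, toRat (completion Y) W (c i) *
        ratRes (completion Y) le_top (alpha Y (C.coord x k (C.nonempty x') (C.b x' i))) :=
  ratRes_formalSectionCoord Y hU (C.isFrame x) (C.nonempty x) k ξ (C.nonempty x') hW c hc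

/-- In the frame used for the expansion itself, the coordinate matrix is the identity, so the formal
rational coordinate is a genuine formal function. -/
lemma ratRes_formalCoord_self (ξ : sections ((pullback (completionToOpen Y U hU)).obj E) ⊤)
    (x : U) (k : Fin (C.n x)) {W : Opens (completion Y)}
    (hW : W ≤ preimageOpen (completionToOpen Y U hU) (C.V x))
    (c : Fin (C.n x) → (completion Y).presheaf.obj (op W))
    (hc : modRes _ le_top ξ = ∑ i, c i • modRes _ hW
      (unitApp (completionToOpen Y U hU) E _ (C.b x i))) :
    ratRes (completion Y) le_top (C.formalCoord Y hU x k ξ) = toRat (completion Y) W (c k) := by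
  rw [C.ratRes_formalCoord Y hU ξ x x k hW c hc, Finset.sum_eq_single k]
  · have h1 : C.coord x k (C.nonempty x) (C.b x k) = 1 :=
      (coordRat_self _ _ _ _).trans (if_pos rfl)
    rw [h1, map_one, map_one, mul_one]
  · intro i _ hi
    have h1 : C.coord x k (C.nonempty x) (C.b x i) = 0 :=
      (coordRat_self _ _ _ _).trans (if_neg hi)
    rw [h1, map_zero, map_zero, mul_zero]
  · exact fun h => (h (Finset.mem_univ k)).elim

/-- Near `y ∈ Y`, expand `ξ` in the frame at `y`. Both sides are then linear in the same
coefficients, and the claim reduces to the change of frames `x`, `x'`, `y` over `K(X)`. -/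
lemma formalCoord_change (ξ : sections ((pullback (completionToOpen Y U hU)).obj E) ⊤)
    (x x' : U) (k : Fin (C.n x)) : C.formalCoord Y hU x k ξ =
      ∑ l, alpha Y (C.coord x k (C.nonempty x') (C.b x' l)) * C.formalCoord Y hU x' l ξ := by
  refine ringRes_eq_of_locally (rationalSheaf (completion Y)).property fun y _ => ?_
  obtain ⟨W, hW, c, hy, hc⟩ := C.exists_local_coord Y hU ξ y
  refine ⟨W, le_top, hy, (C.ratRes_formalCoord Y hU ξ x _ k hW c hc).trans ?_⟩
  rw [map_sum]
  simp_rw [map_mul, C.ratRes_formalCoord Y hU ξ x' _ _ hW c hc, Finset.mul_sum]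
  rw [Finset.sum_comm]
  refine Finset.sum_congr rfl fun i _ => ?_
  have h1 : C.coord x k (C.nonempty ⟨y.1, hU y.2⟩) (C.b ⟨y.1, hU y.2⟩ i) = _ :=
    coordRat_change (C.isFrame x) (C.nonempty x) k (C.isFrame x') (C.nonempty x')
    (C.nonempty ⟨y.1, hU y.2⟩) (C.b ⟨y.1, hU y.2⟩ i)
  rw [h1, map_sum, map_sum, Finset.mul_sum]
  refine Finset.sum_congr rfl fun l _ => ?_
  rw [map_mul, map_mul, mul_left_comm]
  rfl

/-- Near `y`, the coordinates in the frame at `y` recover the coefficients, since formal functions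
embed into `ℳ_{X_{/Y}}`. -/
lemma eq_of_formalCoord_eq {ξ ξ' : sections ((pullback (completionToOpen Y U hU)).obj E) ⊤}
    (h : ∀ x k, C.formalCoord Y hU x k ξ = C.formalCoord Y hU x k ξ') : ξ = ξ' := by
  refine modRes_eq_of_locally _ fun y _ => ?_
  obtain ⟨W, hW, c, hy, hc⟩ := C.exists_local_coord Y hU ξ y
  obtain ⟨W', hW', c', hy', hc'⟩ := C.exists_local_coord Y hU ξ' y
  refine ⟨W ⊓ W', le_top, ⟨hy, hy'⟩, ?_⟩
  have key (i) : ringRes (completion Y).presheaf (inf_le_left : W ⊓ W' ≤ W) (c i) =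
      ringRes (completion Y).presheaf (inf_le_right : W ⊓ W' ≤ W') (c' i) := by
    refine toRat_injective _ ?_
    rw [← ratRes_toRat, ← ratRes_toRat, ← C.ratRes_formalCoord_self Y hU ξ _ i hW c hc,
      ← C.ratRes_formalCoord_self Y hU ξ' _ i hW' c' hc', h, ringRes_ringRes, ringRes_ringRes]
  rw [← modRes_modRes _ (inf_le_left : W ⊓ W' ≤ W) le_top, hc,
    ← modRes_modRes _ (inf_le_right : W ⊓ W' ≤ W') le_top, hc', map_sum, map_sum]
  refine Finset.sum_congr rfl fun i _ => ?_
  rw [modRes_smul, modRes_smul, key, modRes_modRes, modRes_modRes]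

lemma formalCoord_unitApp (hne : ((⊤ : (U : Scheme.{u}).Opens) : Set U).Nonempty)
    (s : sections E ⊤) (x : U) (k : Fin (C.n x)) :
    C.formalCoord Y hU x k (unitApp (completionToOpen Y U hU) E ⊤ s) =
      alpha Y (C.coord x k hne s) := by
  have h1 := homApp_transpose (completionToOpen Y U hU)
    (FormalGeometry.formalCoord Y hU (C.isFrame x) (C.nonempty x) k) ⊤ s
  have h2 := homApp_formalCoord Y hU (C.isFrame x) (C.nonempty x) k hne s
  have h3 : ratRes (completion Y) (le_top : (⊤ : Opens (completion Y)) ≤ ⊤)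
    (alpha Y (C.coord x k hne s)) = _ := ringRes_self _ le_rfl _
  exact h1.trans (h2.trans h3)

end FrameCover

variable [IsLocallyNoetherian X] (Y : Closeds X)

lemma alpha_injective [Nontrivial (RationalFunctions (completion Y))] :
    Function.Injective (alpha Y) := by
  refine (injective_iff_map_eq_zero (alpha Y).hom).2 fun t ht => ?_
  by_contra h
  have h1 := (isUnit_of_ne_zero h).map (alpha Y).hom
  rw [ht] at h1
  exact not_isUnit_zero h1

theorem lef_of_weaklyG3 [CompactSpace X] (hS2 : SatisfiesSerre 2 X) {L : Mod X.toSheafedSpace}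
    (hL : IsLineBundle L) (hG3 : WeaklyG3 Y L)
    (hY : ∀ D : AlgebraicCycle X ℤ, IsEffectiveDivisor D → D ≠ 0 → MeetsCycle Y D) : Lef Y := by
  intro U hU _ E hE
  have : Nontrivial (RationalFunctions (completion Y)) := hG3.1.nontrivial
  obtain ⟨y₀⟩ := nonempty_of_nontrivial Y
  have : Nonempty U := ⟨⟨y₀.1, hU y₀.2⟩⟩
  have hne : ((⊤ : (U : Scheme.{u}).Opens) : Set U).Nonempty := Set.univ_nonempty
  have : CompactSpace Y := isCompact_iff_compactSpace.1 Y.isClosed.isCompact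
  obtain ⟨C⟩ := exists_frameCover hE
  refine ⟨fun s s' hs => ?_, fun ξ => ?_⟩
  · refine modRes_eq_of_locally E fun x _ => ⟨C.V x, le_top, C.mem x, ?_⟩
    refine eq_of_coordRat_eq (C.isFrame x) (C.nonempty x) (C.nonempty x) le_rfl fun k => ?_
    rw [coordRat_modRes _ _ _ hne, coordRat_modRes _ _ _ hne]
    have h1 : C.formalCoord Y hU x k (unitApp (completionToOpen Y U hU) E ⊤ s) =
      C.formalCoord Y hU x k (unitApp (completionToOpen Y U hU) E ⊤ s') :=
      congrArg (C.formalCoord Y hU x k) hs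
    exact alpha_injective Y ((C.formalCoord_unitApp Y hU hne s x k).symm.trans
      (h1.trans (C.formalCoord_unitApp Y hU hne s' x k)))
  -- Weak G3 enters here: every formal coordinate is a rational function on `X`.
  · have hα (x : U) (k : Fin (C.n x)) : ∃ t, alpha Y t = C.formalCoord Y hU x k ξ := by
      refine exists_alpha_eq Y hL hG3 _ fun y => ?_
      obtain ⟨W, hW, c, hy, hc⟩ := C.exists_local_coord Y hU ξ y
      exact ⟨W, hy, _, c, _, C.ratRes_formalCoord Y hU ξ x _ k hW c hc⟩
    choose t ht using hα
    have htr (x x' : U) (k : Fin (C.n x)) :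
        t x k = ∑ l, C.coord x k (C.nonempty x') (C.b x' l) * t x' l := by
      refine alpha_injective Y ?_
      rw [ht, map_sum, C.formalCoord_change Y hU ξ x x' k]
      exact Finset.sum_congr rfl fun l _ => by rw [map_mul, ht]
    -- Only the frame at `y` itself is used: in it the coordinates are formal functions near `y`.
    have hreg (y : Y) (k) : IsRegularAt (t ⟨y.1, hU y.2⟩ k) y.1 := by
      obtain ⟨W, hW, c, hy, hc⟩ := C.exists_local_coord Y hU ξ y
      refine isRegularAt_of_pullRat Y (t ⟨y.1, hU y.2⟩ k) le_top (c k) hy ?_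
      rw [← C.ratRes_formalCoord_self Y hU ξ _ k hW c hc, ← ht]
      rfl
    have hd (x : U) (k : Fin (C.n x)) : ∃ d : Γ(X, U.ι ''ᵁ C.V x),
        ratRes X.toSheafedSpace le_top (t x k) = toRat X.toSheafedSpace (U.ι ''ᵁ C.V x) d := by
      refine exists_toRat_eq_of_isRegularAt hS2 ((C.isAffineOpen x).image_of_isOpenImmersion U.ι) _
        fun z hz hdim => ?_
      obtain ⟨y, hzy⟩ := exists_specializes Y hY hdim
      refine IsRegularAt.ratRes ?_ _ hz
      obtain ⟨z, hz, rfl⟩ := hz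
      -- The neighbourhood of `y` contains every generization of `y`, so `z` lies in the domains of
      -- both frames. The transition matrix between them is therefore regular at `z`, and regularity
      -- of the coordinates at `z` can be tested in the frame at `y`.
      have hzV : z ∈ C.V ⟨y.1, hU y.2⟩ := by
        have h1 : (y.1 : X) ∈ U.ι ''ᵁ (C.V ⟨y.1, hU y.2⟩) :=
          Set.mem_image_of_mem _ (C.mem ⟨y.1, hU y.2⟩)
        obtain ⟨z', hz', h⟩ := hzy.mem_open (U.ι ''ᵁ (C.V ⟨y.1, hU y.2⟩)).isOpen h1
        rwa [← Subtype.ext (show z'.1 = z.1 from h)]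
      rw [htr x ⟨y.1, hU y.2⟩ k]
      refine IsRegularAt.sum _ trivial fun l _ => ?_
      exact (isRegularAt_coordRat _ _ _ _ _ hzV hz).mul ((hreg y l).of_specializes hzy)
    obtain ⟨r, hr⟩ := C.exists_section t htr hd hne
    refine ⟨r, C.eq_of_formalCoord_eq Y hU fun x k => ?_⟩
    refine (C.formalCoord_unitApp Y hU hne r x k).trans ?_
    rw [hr, ht]

end Lefschetz

end FormalGeometry

end

theorem mainTheorem9 (k : Type u) [Field k] [IsAlgClosed k] [CharZero k]
    (X : FormalGeometry.ProjectiveVariety k)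
    (hdim : 2 ≤ topologicalKrullDim X.scheme)
    (hS2 : FormalGeometry.SatisfiesSerre 2 X.scheme)
    (Y : Closeds X.scheme)
    (L : FormalGeometry.Mod X.scheme.toSheafedSpace)
    (hL : FormalGeometry.IsAmple L)
    (hG3 : FormalGeometry.WeaklyG3 Y L)
    (hY : ∀ D : AlgebraicCycle X.scheme ℤ, FormalGeometry.IsEffectiveDivisor D → D ≠ 0 →
      FormalGeometry.MeetsCycle Y D) :
    FormalGeometry.Lef Y := by
  have : CompactSpace X.scheme :=
    have := X.quasiCompact
    QuasiCompact.compactSpace_of_compactSpace X.str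
  exact FormalGeometry.lef_of_weaklyG3 Y hS2 hL.1 hG3 hY
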